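/- Let $d\ge 1$ and let $\Omega\subset\mathbb{R}^d$ be a bounded open set with $\operatorname{diam}(\Omega)\le 1$. Let $a$ be a measurable symmetric $d\times d$ matrix field on $\Omega$, and let $\lambda_{\min}(a)>0$ and $\lambda_{\max}(a)$ be constants such that $\lambda_{\min}(a)|\xi|^2\le \xi^Ta(x)\xi\le\lambda_{\max}(a)|\xi|^2$ for all $\xi\in\mathbb{R}^d$ and almost every $x\in\Omega$. Write $\langle v,w\rangle_a=\int_\Omega(\nabla v)^Ta\nabla w$ and $\|v\|_a=\langle v,v\rangle_a^{1/2}$. Let $H>0$ and $\delta\in(0,1)$, let $(\tau_i)_{1\le i\le m}$ be a partition of $\Omega$ into convex sets of diameter at most $H$, each containing a ball of diameter $\delta H$, let $\phi_i=1_{\tau_i}$, and let $x_i\in\tau_i$. The gamblet $\psi_i$ is the minimizer of $\|\psi\|_a$ over $\psi\in H^1_0(\Omega)$ such that $\int_\Omega\phi_j\psi=\delta_{i,j}$ for $1\le j\le m$. For $r>0$ let $S_r^i$ be the union of the sets $\tau_j$ that intersect the ball $B(x_i,r)$. The localized gamblet $\psi_i^{\mathrm{loc},r}$ is the minimizer of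 $\int_{S_r^i}(\nabla\psi)^Ta\nabla\psi$ over $\psi\in H^1_0(S_r^i)$, that is, $\psi\in H^1_0(\operatorname{int}S_r^i)$, such that $\int_{S_r^i}\phi_j\psi=\delta_{i,j}$ for all $j$ with $\tau_j\subset S_r^i$; it is extended by zero to an element of $H^1_0(\Omega)$. Let $V_d$ be the volume of the unit ball of $\mathbb{R}^d$, let $e$ be Euler's number, and set $$l=1+\frac{e}{\pi}\sqrt{\frac{\lambda_{\max}(a)}{\lambda_{\min}(a)}}\Big(1+2^{3/2}(2/\delta)^{1+d/2}\Big),\qquad C=\frac{\lambda_{\max}(a)}{\sqrt{\lambda_{\min}(a)}}\,H^{-\frac d2-2}\,\frac{2^{2d+9}}{\sqrt{V_d}\,\delta^{d+2}},$$ $$C_1=(d+4)\,l,\qquad C_2=2l\ln\Big(\frac{\lambda_{\max}(a)}{\lambda_{\min}(a)}\,\frac{2^{\frac32d+11}}{\delta^{d+2}}\Big).$$ Then, for every $r>0$: (1) for every $i$, $\ \|\psi_i-\psi_i^{\mathrm{loc},r}\|_a\le C\,e^{-\frac{r}{2lH}}$; (2) if $r\ge H\big(C_1\ln\frac1H+C_2\big)$,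 then for every $g\in L^2(\Omega)$ and the weak solution $u\in H^1_0(\Omega)$ of $-\operatorname{div}(a\nabla u)=g$ in $\Omega$, $u=0$ on $\partial\Omega$, $$\inf_{v\in\operatorname{span}\{\psi_1^{\mathrm{loc},r},\dots,\psi_m^{\mathrm{loc},r}\}}\|u-v\|_a\le\frac{1}{\sqrt{\lambda_{\min}(a)}}\,H\,\|g\|_{L^2(\Omega)},$$ and this upper bound is achieved by $v=\sum_{i=1}^m\psi_i^{\mathrm{loc},r}\int_\Omega u\phi_i$, i.e. $\|u-v\|_a\le \frac{1}{\sqrt{\lambda_{\min}(a)}}H\|g\|_{L^2(\Omega)}$ for this $v$. -/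

import Mathlib

open MeasureTheory Matrix
open scoped ContDiff

noncomputable section

namespace Gamblet

/-- The space `ℝ^d` with its Euclidean norm. -/
abbrev Rd (d : ℕ) : Type := EuclideanSpace ℝ (Fin d)

/-- Pairs `(v, G)` with `v ∈ L²(ℝ^d)` and `G ∈ L²(ℝ^d; ℝ^d)`, with the Hilbert norm
`(‖v‖² + ‖G‖²)^(1/2)`. An element of a Sobolev space is the pair of a function and its gradient. -/
abbrev L2Pair (d : ℕ) : Type :=
  WithLp 2 (Lp ℝ 2 (volume : Measure (Rd d)) × Lp (Rd d) 2 (volume : Measure (Rd d)))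

/-- The pairs `(φ, ∇φ)` with `φ` a smooth function compactly supported in `U`. -/
def testPairs {d : ℕ} (U : Set (Rd d)) : Set (L2Pair d) :=
  {p | ∃ φ : Rd d → ℝ, ContDiff ℝ ∞ φ ∧ HasCompactSupport φ ∧ tsupport φ ⊆ U ∧
    p.fst =ᵐ[volume] φ ∧ p.snd =ᵐ[volume] fun x => gradient φ x}

/-- `H¹₀(U)`, for open `U`: the closure of the smooth functions compactly supported in `U` for the
`H¹` norm. Functions are extended by zero outside `U`, so that `H¹₀(U) ⊆ H¹₀(Ω)` for `U ⊆ Ω`. -/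
def H10 {d : ℕ} (U : Set (Rd d)) : Submodule ℝ (L2Pair d) :=
  (Submodule.span ℝ (testPairs U)).topologicalClosure

/-- The energy product `∫_S (∇v)ᵀ a ∇w`. -/
def energyInner {d : ℕ} (a : Rd d → Matrix (Fin d) (Fin d) ℝ) (S : Set (Rd d))
    (v w : L2Pair d) : ℝ :=
  ∫ x in S, (v.snd x).ofLp ⬝ᵥ (a x *ᵥ (w.snd x).ofLp)

/-- The energy norm `(∫_S (∇v)ᵀ a ∇v)^(1/2)`. -/
def energyNorm {d : ℕ} (a : Rd d → Matrix (Fin d) (Fin d) ℝ) (S : Set (Rd d))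
    (v : L2Pair d) : ℝ :=
  Real.sqrt (energyInner a S v v)

/-- `a` is a measurable, symmetric, uniformly elliptic matrix field on `Ω`, with ellipticity
constants `0 < lmin` and `lmax`. -/
structure IsElliptic {d : ℕ} (Ω : Set (Rd d)) (a : Rd d → Matrix (Fin d) (Fin d) ℝ)
    (lmin lmax : ℝ) : Prop where
  measurable : ∀ k l, AEStronglyMeasurable (fun x => a x k l) (volume.restrict Ω)
  symm : ∀ᵐ x ∂(volume.restrict Ω), (a x).IsSymm
  pos : 0 < lmin
  lower : ∀ᵐ x ∂(volume.restrict Ω), ∀ ξ : Fin d → ℝ, lmin * (ξ ⬝ᵥ ξ) ≤ ξ ⬝ᵥ (a x *ᵥ ξ)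
  upper : ∀ᵐ x ∂(volume.restrict Ω), ∀ ξ : Fin d → ℝ, ξ ⬝ᵥ (a x *ᵥ ξ) ≤ lmax * (ξ ⬝ᵥ ξ)

/-- `u` is the weak solution of `-div(a ∇u) = g` in `Ω`, `u = 0` on `∂Ω`. -/
def IsWeakSolution {d : ℕ} (Ω : Set (Rd d)) (a : Rd d → Matrix (Fin d) (Fin d) ℝ)
    (g : Rd d → ℝ) (u : L2Pair d) : Prop :=
  u ∈ H10 Ω ∧ ∀ v ∈ H10 Ω, energyInner a Ω u v = ∫ x in Ω, g x * v.fst x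

/-- `τ` is a partition of `Ω` into convex sets of diameter at most `H`, each of which contains a
ball of diameter `δ H`. (A bounded convex set with an interior point has Lipschitz boundary.) -/
structure IsConvexPartition {d m : ℕ} (Ω : Set (Rd d)) (H δ : ℝ) (τ : Fin m → Set (Rd d)) :
    Prop where
  iUnion_eq : ⋃ i, τ i = Ω
  disjoint : Pairwise (fun i j => Disjoint (τ i) (τ j))
  convex : ∀ i, Convex ℝ (τ i)
  diam_le : ∀ i, Metric.diam (τ i) ≤ H
  ball_subset : ∀ i, ∃ c, Metric.ball c (δ * H / 2) ⊆ τ i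

/-- The measurement function `φ_j`: equal to one on `τ_j` and to zero elsewhere. -/
def measFun {d m : ℕ} (τ : Fin m → Set (Rd d)) (j : Fin m) : Rd d → ℝ :=
  (τ j).indicator fun _ => 1

/-- The functions `ψ ∈ H¹₀(S)` with `∫_S φ_j ψ = δ_{i,j}` for all `j` such that `τ_j ⊆ S`. -/
def admissible {d m : ℕ} (τ : Fin m → Set (Rd d)) (S : Set (Rd d)) (i : Fin m) :
    Set (L2Pair d) :=
  {ψ | ψ ∈ H10 (interior S) ∧
    ∀ j, τ j ⊆ S → ∫ x in S, measFun τ j x * ψ.fst x = if i = j then 1 else 0}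

/-- `ψ` is the minimizer of the energy on `S` under the constraints of `admissible`. For `S = Ω`
it is the gamblet `ψ_i`, and for `S` a patch around `τ_i` the localized gamblet. -/
def IsGamblet {d m : ℕ} (a : Rd d → Matrix (Fin d) (Fin d) ℝ) (τ : Fin m → Set (Rd d))
    (S : Set (Rd d)) (i : Fin m) (ψ : L2Pair d) : Prop :=
  ψ ∈ admissible τ S i ∧ ∀ χ ∈ admissible τ S i, energyNorm a S ψ ≤ energyNorm a S χ

/-- The patch `S_r`: the union of the `τ_j` that intersect the ball `B(y, r)`. -/
def patch {d m : ℕ} (τ : Fin m → Set (Rd d)) (y : Rd d) (r : ℝ) : Set (Rd d) :=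
  ⋃ j ∈ {j : Fin m | (τ j ∩ Metric.ball y r).Nonempty}, τ j

/-- `V_d`, the volume of the unit ball of `ℝ^d`. -/
def unitBallVol (d : ℕ) : ℝ := (volume (Metric.ball (0 : Rd d) 1)).toReal

/-- `l = 1 + (e/π) √(lmax/lmin) (1 + 2^(3/2) (2/δ)^(1 + d/2))`. -/
def decayLength (d : ℕ) (lmin lmax δ : ℝ) : ℝ :=
  1 + Real.exp 1 / Real.pi * Real.sqrt (lmax / lmin) *
    (1 + (2 : ℝ) ^ (3 / 2 : ℝ) * (2 / δ) ^ (1 + (d : ℝ) / 2))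

/-- `C = (lmax/√lmin) H^(-d/2-2) 2^(2d+9) / (√V_d δ^(d+2))`. -/
def locConst (d : ℕ) (lmin lmax δ H : ℝ) : ℝ :=
  lmax / Real.sqrt lmin * H ^ (-(d : ℝ) / 2 - 2) * 2 ^ (2 * d + 9) /
    (Real.sqrt (unitBallVol d) * δ ^ (d + 2))

/-- `C₁ = (d + 4) l`. -/
def radiusConst₁ (d : ℕ) (lmin lmax δ : ℝ) : ℝ :=
  ((d : ℝ) + 4) * decayLength d lmin lmax δ

/-- `C₂ = 2 l ln((lmax/lmin) 2^(3d/2+11) / δ^(d+2))`. -/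
def radiusConst₂ (d : ℕ) (lmin lmax δ : ℝ) : ℝ :=
  2 * decayLength d lmin lmax δ *
    Real.log (lmax / lmin * ((2 : ℝ) ^ (3 / 2 * (d : ℝ) + 11) / δ ^ (d + 2)))

end Gamblet

end

open scoped ENNReal

noncomputable section

namespace Gamblet

/-! ### Brunn-Minkowski on the line and the Prékopa-Leindler inequality. -/

section

/-! A gamblet minimises the energy under linear constraints, so it is orthogonal in energy to every
function of H¹₀(Ω) whose integrals over all cells vanish (`energyInner_gamblet_eq_zero`). For a
smooth η the product ηψ is not such a function, but ηψ - Σ c_j b_j is, where b_j is a bump of unit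
integral supported in the cell τ_j (`exists_cell_bump`) and c_j is the integral of ηψ over τ_j. On
every cell but the i-th the gamblet has mean zero, so the Poincaré inequality bounds both c_j and
the term ψ∇η by the energy of ψ on that same cell.

Decay (`gamblet_decay`): with η = exp(θ/(lH)) - 1 and θ essentially the distance to x_i,
orthogonality bounds the energy weighted by exp(θ/(lH)), up to error terms that are at most 7/10 of
the weighted energy and are absorbed. The definition of l is what makes 7/10 possible.

Localization: for χ admissible on the patch, χ - ψ has vanishing measurements, so the energy of χ is
that of ψ plus that of χ - ψ. The localized gamblet is therefore the best approximation of ψ among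
such χ. The competitor (1 - η)ψ + Σ c_j b_j, with a cutoff η, differs from ψ only on far cells,
where the energy of ψ is exponentially small (`energyNorm_sub_le_far`).

Approximation: with exact gamblets the error u - Σ c_i ψ_i has vanishing cell integrals, and
Poincaré gives 5/6 of the allowed bound. Replacing ψ_i by its localization costs at most Σ |c_i|
times the localization error. The sum is controlled by the L² norm of u, hence by g (Friedrichs),
and the condition on r makes the cost at most the remaining 1/6.

The Poincaré constant on a convex cell must depend on the diameter only. Here it is 5/6 times the
diameter (`poincare_convex_of_isOpen`), weaker than the optimal 1/π but sufficient, because l and C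
leave room. It comes from a Gaussian Poincaré inequality on convex sets, obtained by expanding
Prékopa-Leindler to second order, combined with an approximate Jung theorem: on a ball of squared
radius 2s² a Gaussian density of variance s² varies by a factor e only. -/

/-- One-dimensional Brunn-Minkowski inequality, for compact sets. -/
theorem volume_add_le_of_isCompact {A B C : Set ℝ} (hA : IsCompact A) (hB : IsCompact B)
    (hA0 : A.Nonempty) (hB0 : B.Nonempty) (hC : ∀ x ∈ A, ∀ y ∈ B, (x + y) / 2 ∈ C) :
    volume A + volume B ≤ 2 * volume C := by
  set M := sSup A
  set m := sInf B
  have hM : M ∈ A := hA.sSup_mem hA0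
  have hm : m ∈ B := hB.sInf_mem hB0
  -- These are (A + inf B)/2 and (sup A + B)/2. Both lie in C, and they share at most the point (sup
  -- A + inf B)/2, so their measures add.
  set A' : Set ℝ := (fun x => 2 * x) ⁻¹' ((fun x => x + -m) ⁻¹' A)
  set B' : Set ℝ := (fun x => 2 * x) ⁻¹' ((fun x => x + -M) ⁻¹' B)
  have hvA : volume A' = ENNReal.ofReal |2⁻¹| * volume A := by
    rw [Real.volume_preimage_mul_left two_ne_zero, measure_preimage_add_right]
  have hvB : volume B' = ENNReal.ofReal |2⁻¹| * volume B := by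
    rw [Real.volume_preimage_mul_left two_ne_zero, measure_preimage_add_right]
  have hA'C : A' ⊆ C := by
    intro x hx
    have := hC _ hx m hm
    convert this using 1
    ring
  have hB'C : B' ⊆ C := by
    intro x hx
    have := hC M hM _ hx
    convert this using 1
    ring
  have hmB : MeasurableSet B' :=
    (measurable_const_mul 2) ((measurable_add_const (-M)) hB.measurableSet)
  have hdisj : AEDisjoint volume A' B' := by
    refine measure_mono_null (t := {(M + m) / 2}) ?_ (by simp)
    rintro x ⟨hx1, hx2⟩
    have h1 : 2 * x + -m ≤ M := le_csSup hA.bddAbove hx1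
    have h2 : m ≤ 2 * x + -M := csInf_le hB.bddBelow hx2
    simp only [Set.mem_singleton_iff]
    linarith
  have h := measure_union₀ hmB.nullMeasurableSet hdisj
  have h2 : volume (A' ∪ B') ≤ volume C := measure_mono (Set.union_subset hA'C hB'C)
  rw [h, hvA, hvB, ← mul_add] at h2
  have h3 : (2 : ℝ≥0∞) * ENNReal.ofReal |2⁻¹| = 1 := by
    rw [abs_of_pos (by norm_num), ENNReal.ofReal_inv_of_pos (by norm_num)]
    rw [show ENNReal.ofReal 2 = 2 by simp]
    exact ENNReal.mul_inv_cancel (by simp) (by simp)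
  calc volume A + volume B = 2 * ENNReal.ofReal |2⁻¹| * (volume A + volume B) := by
        rw [h3, one_mul]
    _ ≤ 2 * volume C := by rw [mul_assoc]; gcongr

theorem volume_le_of_forall_isCompact {A : Set ℝ} (hA : MeasurableSet A) {t : ℝ≥0∞}
    (ht : ∀ K ⊆ A, IsCompact K → K.Nonempty → volume K ≤ t) : volume A ≤ t := by
  rw [hA.measure_eq_iSup_isCompact]
  refine iSup₂_le fun K hK => iSup_le fun hKc => ?_
  rcases K.eq_empty_or_nonempty with rfl | h
  · simp
  · exact ht K hK hKc h

/-- One-dimensional Brunn-Minkowski inequality, for measurable sets. -/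
theorem volume_add_le {A B C : Set ℝ} (hA : MeasurableSet A) (hB : MeasurableSet B)
    (hA0 : A.Nonempty) (hB0 : B.Nonempty) (hC : ∀ x ∈ A, ∀ y ∈ B, (x + y) / 2 ∈ C) :
    volume A + volume B ≤ 2 * volume C := by
  by_cases htop : volume C = ⊤
  · simp [htop]
  have key : ∀ K ⊆ A, IsCompact K → K.Nonempty → ∀ L ⊆ B, IsCompact L → L.Nonempty →
      volume K + volume L ≤ 2 * volume C := fun K hK hKc hK0 L hL hLc hL0 =>
    volume_add_le_of_isCompact hKc hLc hK0 hL0 fun x hx y hy => hC x (hK hx) y (hL hy)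
  -- Inner regularity is used in one variable at a time: the other term is moved across by a
  -- subtraction, which needs its measure to be finite.
  have key2 : ∀ K ⊆ A, IsCompact K → K.Nonempty → volume K + volume B ≤ 2 * volume C := by
    intro K hK hKc hK0
    have hKt : volume K ≠ ⊤ := hKc.measure_lt_top.ne
    obtain ⟨y, hy⟩ := hB0
    have hle : volume K ≤ 2 * volume C :=
      le_self_add.trans (key K hK hKc hK0 {y} (by simpa using hy) isCompact_singleton (by simp))
    have : volume B ≤ 2 * volume C - volume K :=
      volume_le_of_forall_isCompact hB fun L hL hLc hL0 =>
        ENNReal.le_sub_of_add_le_left hKt (key K hK hKc hK0 L hL hLc hL0)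
    calc volume K + volume B ≤ volume K + (2 * volume C - volume K) := by gcongr
      _ = 2 * volume C := add_tsub_cancel_of_le hle
  obtain ⟨x, hx⟩ := hA0
  have hBle : volume B ≤ 2 * volume C :=
    le_add_self.trans (key2 {x} (by simpa using hx) isCompact_singleton (by simp))
  have hBt : volume B ≠ ⊤ := ne_top_of_le_ne_top (ENNReal.mul_ne_top (by simp) htop) hBle
  have : volume A ≤ 2 * volume C - volume B :=
    volume_le_of_forall_isCompact hA fun K hK hKc hK0 =>
      ENNReal.le_sub_of_add_le_right hBt (key2 K hK hKc hK0)
  calc volume A + volume B ≤ (2 * volume C - volume B) + volume B := by gcongr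
    _ = 2 * volume C := tsub_add_cancel_of_le hBle

/-- Layer cake: midpoints of {f > t} and {g > t} lie in {h > t}, so Brunn-Minkowski applies level by
level. The common supremum 1 makes both level sets nonempty for t < 1 and both empty beyond. -/
theorem lintegral_add_le_of_sup_eq_one {f g h : ℝ → ℝ} (hf : Measurable f) (hg : Measurable g)
    (hh : Measurable h) (hf0 : ∀ x, 0 ≤ f x) (hg0 : ∀ x, 0 ≤ g x) (hh0 : ∀ x, 0 ≤ h x)
    (hf1 : ∀ x, f x ≤ 1) (hg1 : ∀ x, g x ≤ 1) (hfs : ∀ t < 1, ∃ x, t < f x)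
    (hgs : ∀ t < 1, ∃ x, t < g x) (H : ∀ x y, f x * g y ≤ h ((x + y) / 2) ^ 2) :
    (∫⁻ x, ENNReal.ofReal (f x)) + ∫⁻ x, ENNReal.ofReal (g x) ≤
      2 * ∫⁻ x, ENNReal.ofReal (h x) := by
  rw [lintegral_eq_lintegral_meas_lt _ (ae_of_all _ hf0) hf.aemeasurable,
    lintegral_eq_lintegral_meas_lt _ (ae_of_all _ hg0) hg.aemeasurable,
    lintegral_eq_lintegral_meas_lt _ (ae_of_all _ hh0) hh.aemeasurable]
  have hanti : ∀ k : ℝ → ℝ, Measurable fun t : ℝ => volume {a | t < k a} := fun k =>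
    Antitone.measurable fun s t hst => measure_mono fun a (ha : t < k a) => hst.trans_lt ha
  rw [← lintegral_add_left (hanti f), ← lintegral_const_mul _ (hanti h)]
  refine setLIntegral_mono ((hanti h).const_mul 2) fun t ht => ?_
  rcases lt_or_ge t 1 with h1 | h1
  · refine volume_add_le (measurableSet_lt measurable_const hf)
      (measurableSet_lt measurable_const hg) (hfs t h1) (hgs t h1) ?_
    intro x (hx : t < f x) y (hy : t < g y)
    have h2 := H x y
    have ht : 0 < t := ht
    have h3 : t * t < f x * g y := mul_lt_mul'' hx hy ht.le ht.le
    show t < h ((x + y) / 2)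
    exact lt_of_pow_lt_pow_left₀ 2 (hh0 _) (by nlinarith)
  · have e1 : {a | t < f a} = ∅ := by
      ext a; simpa using (hf1 a).trans h1
    have e2 : {a | t < g a} = ∅ := by
      ext a; simpa using (hg1 a).trans h1
    simp [e1, e2]

theorem mul_le_sq_of_add_le {a b c : ℝ≥0∞} (h : a + b ≤ 2 * c) : a * b ≤ c ^ 2 := by
  by_cases hc : c = ⊤
  · simp [hc]
  have hab : a + b ≠ ⊤ := ne_top_of_le_ne_top (ENNReal.mul_ne_top (by simp) hc) h
  lift c to NNReal using hc
  have ha : a ≠ ⊤ := fun h => hab (by simp [h])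
  have hb : b ≠ ⊤ := fun h => hab (by simp [h])
  lift a to NNReal using ha
  lift b to NNReal using hb
  norm_cast at h ⊢
  have h' : (a : ℝ) + b ≤ 2 * c := by exact_mod_cast h
  have : (a : ℝ) * b ≤ c ^ 2 := by
    nlinarith [sq_nonneg ((a : ℝ) - b), a.2, b.2, c.2, a.coe_nonneg, b.coe_nonneg, c.coe_nonneg]
  exact_mod_cast this

/-- The product inequality is invariant under dividing f and g by their suprema and h by the square
root of the product of these. After this normalisation the additive inequality holds, and the
arithmetic-geometric mean inequality turns it into the product one. -/
theorem prekopa_leindler_real_of_bounded {f g h : ℝ → ℝ} (hf : Measurable f) (hg : Measurable g)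
    (hh : Measurable h) (hf0 : ∀ x, 0 ≤ f x) (hg0 : ∀ x, 0 ≤ g x) (hh0 : ∀ x, 0 ≤ h x)
    {N : ℝ} (hfN : ∀ x, f x ≤ N) (hgN : ∀ x, g x ≤ N)
    (H : ∀ x y, f x * g y ≤ h ((x + y) / 2) ^ 2) :
    (∫⁻ x, ENNReal.ofReal (f x)) * ∫⁻ x, ENNReal.ofReal (g x) ≤
      (∫⁻ x, ENNReal.ofReal (h x)) ^ 2 := by
  by_cases hfz : ∀ x, f x = 0
  · simp [hfz]
  by_cases hgz : ∀ x, g x = 0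
  · simp [hgz]
  push Not at hfz hgz
  obtain ⟨x₀, hx₀⟩ := hfz
  obtain ⟨y₀, hy₀⟩ := hgz
  have bf : BddAbove (Set.range f) := ⟨N, by rintro _ ⟨x, rfl⟩; exact hfN x⟩
  have bg : BddAbove (Set.range g) := ⟨N, by rintro _ ⟨x, rfl⟩; exact hgN x⟩
  set A := ⨆ x, f x
  set B := ⨆ x, g x
  have hA : 0 < A := ((hf0 x₀).lt_of_ne' hx₀).trans_le (le_ciSup bf x₀)
  have hB : 0 < B := ((hg0 y₀).lt_of_ne' hy₀).trans_le (le_ciSup bg y₀)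
  have hs : 0 < Real.sqrt (A * B) := Real.sqrt_pos.2 (mul_pos hA hB)
  have key := lintegral_add_le_of_sup_eq_one (f := fun x => A⁻¹ * f x) (g := fun x => B⁻¹ * g x)
    (h := fun x => (Real.sqrt (A * B))⁻¹ * h x) (hf.const_mul _) (hg.const_mul _) (hh.const_mul _)
    (fun x => mul_nonneg (inv_nonneg.2 hA.le) (hf0 x))
    (fun x => mul_nonneg (inv_nonneg.2 hB.le) (hg0 x))
    (fun x => mul_nonneg (inv_nonneg.2 hs.le) (hh0 x))
    (fun x => by rw [inv_mul_le_one₀ hA]; exact le_ciSup bf x)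
    (fun x => by rw [inv_mul_le_one₀ hB]; exact le_ciSup bg x)
    (fun t ht => by
      obtain ⟨x, hx⟩ := exists_lt_of_lt_ciSup (show t * A < ⨆ x, f x from by
        change t * A < A; nlinarith)
      exact ⟨x, by rw [inv_mul_eq_div, lt_div_iff₀ hA]; exact hx⟩)
    (fun t ht => by
      obtain ⟨x, hx⟩ := exists_lt_of_lt_ciSup (show t * B < ⨆ x, g x from by
        change t * B < B; nlinarith)
      exact ⟨x, by rw [inv_mul_eq_div, lt_div_iff₀ hB]; exact hx⟩)
    (fun x y => by
      rw [mul_pow, inv_pow, Real.sq_sqrt (mul_pos hA hB).le, mul_inv]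
      calc A⁻¹ * f x * (B⁻¹ * g y) = A⁻¹ * B⁻¹ * (f x * g y) := by ring
        _ ≤ _ := by gcongr; exact H x y)
  have e : ∀ (c : ℝ) (k : ℝ → ℝ), 0 ≤ c → Measurable k →
      ∫⁻ x, ENNReal.ofReal (c * k x) = ENNReal.ofReal c * ∫⁻ x, ENNReal.ofReal (k x) := by
    intro c k hc hk
    rw [← lintegral_const_mul _ hk.ennreal_ofReal]
    simp_rw [ENNReal.ofReal_mul hc]
  rw [e _ _ (inv_nonneg.2 hA.le) hf, e _ _ (inv_nonneg.2 hB.le) hg,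
    e _ _ (inv_nonneg.2 hs.le) hh] at key
  have key2 := mul_le_sq_of_add_le key
  set F := ∫⁻ x, ENNReal.ofReal (f x)
  set G := ∫⁻ x, ENNReal.ofReal (g x)
  set I := ∫⁻ x, ENNReal.ofReal (h x)
  have hAB : ENNReal.ofReal (A * B) * (ENNReal.ofReal A⁻¹ * ENNReal.ofReal B⁻¹) = 1 := by
    rw [← ENNReal.ofReal_mul (inv_nonneg.2 hA.le), ← ENNReal.ofReal_mul (mul_pos hA hB).le,
      ← ENNReal.ofReal_one]
    congr 1; field_simp
  have hAB2 : ENNReal.ofReal (A * B) * ENNReal.ofReal (Real.sqrt (A * B))⁻¹ ^ 2 = 1 := by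
    rw [← ENNReal.ofReal_pow (inv_nonneg.2 hs.le), ← ENNReal.ofReal_mul (mul_pos hA hB).le,
      inv_pow, Real.sq_sqrt (mul_pos hA hB).le, mul_inv_cancel₀ (mul_pos hA hB).ne',
      ENNReal.ofReal_one]
  calc F * G = ENNReal.ofReal (A * B) * (ENNReal.ofReal A⁻¹ * ENNReal.ofReal B⁻¹) * (F * G) := by
        rw [hAB, one_mul]
    _ = ENNReal.ofReal (A * B) * (ENNReal.ofReal A⁻¹ * F * (ENNReal.ofReal B⁻¹ * G)) := by ring
    _ ≤ ENNReal.ofReal (A * B) * (ENNReal.ofReal (Real.sqrt (A * B))⁻¹ * I) ^ 2 := by gcongr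
    _ = ENNReal.ofReal (A * B) * ENNReal.ofReal (Real.sqrt (A * B))⁻¹ ^ 2 * I ^ 2 := by ring
    _ = I ^ 2 := by rw [hAB2, one_mul]

theorem lintegral_eq_iSup_min {α : Type*} [MeasurableSpace α] {μ : Measure α} {f : α → ℝ≥0∞}
    (hf : Measurable f) : ∫⁻ x, f x ∂μ = ⨆ n : ℕ, ∫⁻ x, min (f x) n ∂μ := by
  rw [← lintegral_iSup (fun n => hf.min measurable_const)
    (fun m n hmn x => min_le_min le_rfl (by simpa using hmn))]
  congr 1
  ext x
  refine le_antisymm ?_ (iSup_le fun n => min_le_left _ _)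
  refine le_of_forall_lt fun c hc => ?_
  obtain ⟨n, hn⟩ := ENNReal.exists_nat_gt (ne_top_of_lt hc)
  exact (lt_min hc hn).trans_le (le_iSup (fun n : ℕ => min (f x) n) n)

/-- Midpoint Prékopa-Leindler inequality on the line. -/
theorem prekopa_leindler_real {f g h : ℝ → ℝ≥0∞} (hf : Measurable f) (hg : Measurable g)
    (hh : Measurable h) (H : ∀ x y, f x * g y ≤ h ((x + y) / 2) ^ 2) :
    (∫⁻ x, f x) * ∫⁻ x, g x ≤ (∫⁻ x, h x) ^ 2 := by
  have key : ∀ n : ℕ, (∫⁻ x, min (f x) n) * ∫⁻ x, min (g x) n ≤ (∫⁻ x, h x) ^ 2 := by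
    intro n
    have fin : ∀ k : ℝ≥0∞, min k n ≠ ⊤ := fun k => ((min_le_right _ _).trans_lt (by simp)).ne
    have hle : ∀ k : ℝ≥0∞, (min k n).toReal ≤ n := fun k => by
      have := ENNReal.toReal_mono (by simp) (min_le_right k (n : ℝ≥0∞))
      simpa using this
    -- Cutting all three functions at the same level n preserves the hypothesis, since the left side
    -- never exceeds n².
    have := prekopa_leindler_real_of_bounded (f := fun x => (min (f x) n).toReal)
      (g := fun x => (min (g x) n).toReal) (h := fun x => (min (h x) n).toReal)
      (hf.min measurable_const).ennreal_toReal (hg.min measurable_const).ennreal_toReal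
      (hh.min measurable_const).ennreal_toReal (fun _ => ENNReal.toReal_nonneg)
      (fun _ => ENNReal.toReal_nonneg) (fun _ => ENNReal.toReal_nonneg) (N := n)
      (fun x => hle _) (fun x => hle _) (fun x y => by
        rw [← ENNReal.toReal_mul, ← ENNReal.toReal_pow]
        refine ENNReal.toReal_mono (ENNReal.pow_ne_top (fin _)) ?_
        rcases le_total (h ((x + y) / 2)) n with h1 | h1
        · rw [min_eq_left h1]
          exact (mul_le_mul' (min_le_left _ _) (min_le_left _ _)).trans (H x y)
        · rw [min_eq_right h1, sq]
          exact mul_le_mul' (min_le_right _ _) (min_le_right _ _))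
    simp only [ENNReal.ofReal_toReal (fin _)] at this
    refine this.trans ?_
    gcongr
    exact min_le_left _ _
  rw [lintegral_eq_iSup_min hf, lintegral_eq_iSup_min hg]
  rw [ENNReal.iSup_mul]
  refine iSup_le fun m => ?_
  rw [ENNReal.mul_iSup]
  refine iSup_le fun n => ?_
  refine le_trans ?_ (key (max m n))
  gcongr <;> simp

/-- Midpoint Prékopa-Leindler inequality on `ℝⁿ`. -/
theorem prekopa_leindler_pi : ∀ (n : ℕ) {f g h : (Fin n → ℝ) → ℝ≥0∞}, Measurable f →
    Measurable g → Measurable h → (∀ x y, f x * g y ≤ h ((2⁻¹ : ℝ) • (x + y)) ^ 2) →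
    (∫⁻ x, f x) * ∫⁻ x, g x ≤ (∫⁻ x, h x) ^ 2
  | 0, f, g, h, hf, hg, hh, H => by
    have e : ∀ k : (Fin 0 → ℝ) → ℝ≥0∞, ∫⁻ x, k x = k 0 := fun k => by
      rw [volume_pi, Measure.pi_of_empty _ 0, lintegral_dirac]
    rw [e, e, e]
    convert H 0 0 using 3
  | n + 1, f, g, h, hf, hg, hh, H => by
    have e : ∀ k : (Fin (n + 1) → ℝ) → ℝ≥0∞, Measurable k →
        ∫⁻ x, k x = ∫⁻ s : ℝ, ∫⁻ z : Fin n → ℝ, k (Fin.cons s z) := fun k hk => by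
      have mp := (volume_preserving_piFinSuccAbove (fun _ : Fin (n + 1) => ℝ) 0).symm
      rw [← mp.lintegral_comp hk, Measure.volume_eq_prod, lintegral_prod (fun p => k _)
        (hk.comp (MeasurableEquiv.measurable _)).aemeasurable]
      simp [MeasurableEquiv.piFinSuccAbove, Fin.insertNthEquiv]
    have hcons : Measurable fun p : ℝ × (Fin n → ℝ) => (Fin.cons p.1 p.2 : Fin (n + 1) → ℝ) := by
      refine measurable_pi_lambda _ fun i => ?_
      refine Fin.cases ?_ (fun j => ?_) i
      · simpa using measurable_fst
      · simpa [Function.comp_def] using (measurable_pi_apply j).comp measurable_snd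
    have hm : ∀ k : (Fin (n + 1) → ℝ) → ℝ≥0∞, Measurable k →
        Measurable fun s : ℝ => ∫⁻ z : Fin n → ℝ, k (Fin.cons s z) := fun k hk =>
      (hk.comp hcons).lintegral_prod_right'
    have hsl : ∀ k : (Fin (n + 1) → ℝ) → ℝ≥0∞, Measurable k → ∀ s,
        Measurable fun z : Fin n → ℝ => k (Fin.cons s z) := fun k hk s =>
      hk.comp (hcons.comp measurable_prodMk_left)
    rw [e f hf, e g hg, e h hh]
    -- The marginals in the first coordinate satisfy the one-dimensional hypothesis: this is the
    -- induction hypothesis applied to the slices.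
    refine prekopa_leindler_real (hm f hf) (hm g hg) (hm h hh) fun s t => ?_
    refine prekopa_leindler_pi n (hsl f hf s) (hsl g hg t) (hsl h hh _) fun x y => ?_
    convert H (Fin.cons s x) (Fin.cons t y) using 3
    ext i
    refine Fin.cases ?_ (fun j => ?_) i
    · simp; ring
    · simp [mul_add]

/-- Midpoint Prékopa-Leindler inequality on Euclidean space. -/
theorem prekopa_leindler {d : ℕ} {f g h : Rd d → ℝ≥0∞} (hf : Measurable f)
    (hg : Measurable g) (hh : Measurable h)
    (H : ∀ x y, f x * g y ≤ h ((2⁻¹ : ℝ) • (x + y)) ^ 2) :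
    (∫⁻ x, f x) * ∫⁻ x, g x ≤ (∫⁻ x, h x) ^ 2 := by
  have mp := PiLp.volume_preserving_toLp (Fin d)
  rw [← mp.lintegral_comp hf, ← mp.lintegral_comp hg, ← mp.lintegral_comp hh]
  refine prekopa_leindler_pi d (hf.comp mp.measurable) (hg.comp mp.measurable)
    (hh.comp mp.measurable) fun x y => ?_
  simpa using H (WithLp.toLp 2 x) (WithLp.toLp 2 y)

end

/-! ### An approximate Jung theorem, and a variance bound from an exponential inequality. -/

section

open scoped RealInnerProductSpace

/-- An approximate form of Jung's theorem: a set of diameter at most `D` is contained in a ball of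
radius close to `D / √2`. -/
theorem exists_center_of_dist_le {E : Type*} [NormedAddCommGroup E] [InnerProductSpace ℝ E]
    {K : Set E} (hK : K.Nonempty) {D : ℝ} (hD : 0 < D) (h : ∀ x ∈ K, ∀ y ∈ K, dist x y ≤ D) :
    ∃ c, ∀ x ∈ K, ‖x - c‖ ^ 2 ≤ 51 / 100 * D ^ 2 := by
  by_contra hcon
  set A : Set ℝ := {t | ∃ c, ∀ x ∈ K, ‖x - c‖ ^ 2 ≤ t}
  have hup : ∀ s ∈ A, ∀ t, s ≤ t → t ∈ A := fun s ⟨c, hc⟩ t hst =>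
    ⟨c, fun x hx => (hc x hx).trans hst⟩
  have hlow : ∀ s ∈ A, 51 / 100 * D ^ 2 ≤ s := fun s hs => by
    by_contra hlt
    exact hcon (hup s hs _ (not_le.1 hlt).le)
  have hbdd : BddBelow A := ⟨_, hlow⟩
  obtain ⟨x₀, hx₀⟩ := hK
  have hne : A.Nonempty := ⟨D ^ 2, x₀, fun x hx => by
    rw [← dist_eq_norm]; exact pow_le_pow_left₀ dist_nonneg (h x hx x₀ hx₀) 2⟩
  set ρ := sInf A
  have hρ : 51 / 100 * D ^ 2 ≤ ρ := le_csInf hne hlow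
  have hρ0 : 0 < ρ := lt_of_lt_of_le (by positivity) hρ
  obtain ⟨s, ⟨c, hc⟩, hs⟩ := exists_lt_of_csInf_lt hne
    (show sInf A < ρ * (1 + 1 / 1000000) by change ρ < _; nlinarith)
  have hex : ∀ c, ∃ z ∈ K, ρ * (1 - 1 / 1000000) ≤ ‖z - c‖ ^ 2 := fun c => by
    by_contra! hz
    have : ρ ≤ ρ * (1 - 1 / 1000000) := csInf_le hbdd ⟨c, fun x hx => (hz x hx).le⟩
    nlinarith
  obtain ⟨z₁, hz₁, h₁⟩ := hex c
  -- The centre c is almost optimal, so moving it slightly towards the far point z₁ leaves another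
  -- far point z₂. This forces the inner product of z₁ - c and z₂ - c to be at most a small multiple
  -- of ρ, whence the squared distance from z₁ to z₂ is nearly 2ρ or more. As 2ρ is at least 1.02
  -- D², this is a contradiction.
  obtain ⟨z₂, hz₂, h₂⟩ := hex (c + (1 / 1000 : ℝ) • (z₁ - c))
  have u₁ := (hc z₁ hz₁).trans hs.le
  have u₂ := (hc z₂ hz₂).trans hs.le
  have e₂ : ‖z₂ - (c + (1 / 1000 : ℝ) • (z₁ - c))‖ ^ 2 =
      ‖z₂ - c‖ ^ 2 - 2 / 1000 * ⟪z₁ - c, z₂ - c⟫ + 1 / 1000000 * ‖z₁ - c‖ ^ 2 := by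
    rw [← sub_sub, norm_sub_sq_real, norm_smul, inner_smul_right, real_inner_comm]
    rw [mul_pow, Real.norm_eq_abs, sq_abs]
    ring
  have e₁ : ‖z₁ - z₂‖ ^ 2 = ‖z₁ - c‖ ^ 2 - 2 * ⟪z₁ - c, z₂ - c⟫ + ‖z₂ - c‖ ^ 2 := by
    rw [← norm_sub_sq_real]; congr 2; abel
  have hd : ‖z₁ - z₂‖ ^ 2 ≤ D ^ 2 := by
    rw [← dist_eq_norm]; exact pow_le_pow_left₀ dist_nonneg (h z₁ hz₁ z₂ hz₂) 2
  rw [e₂] at h₂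
  rw [e₁] at hd
  nlinarith

/-- Taylor's formula for exp at t = εf - κε²g, where |t| ≤ 2Lε ≤ 1. Since g carries a factor ε²,
only its linear term is of second order; the cross term in t² joins the cubic remainder. -/
theorem exp_ge_quadratic {L κ ε f g : ℝ} (hL : 1 ≤ L) (hf : |f| ≤ L) (hg0 : 0 ≤ κ * g)
    (hg : κ * g ≤ L) (hε : 0 < ε) (hε1 : 2 * L * ε ≤ 1) :
    1 + ε * f - κ * ε ^ 2 * g + ε ^ 2 * f ^ 2 / 2 - 9 * L ^ 3 * ε ^ 3 ≤
      Real.exp (ε * f - κ * ε ^ 2 * g) := by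
  set t := ε * f - κ * ε ^ 2 * g
  have hεL : ε ≤ 1 := by nlinarith
  have ht : |t| ≤ 2 * L * ε := by
    calc |t| ≤ |ε * f| + |κ * ε ^ 2 * g| := abs_sub _ _
      _ ≤ ε * L + ε * L := by
        rw [abs_mul, abs_of_pos hε, show κ * ε ^ 2 * g = ε ^ 2 * (κ * g) by ring, abs_mul,
          abs_of_nonneg hg0, abs_of_nonneg (by positivity : 0 ≤ ε ^ 2)]
        have : ε ^ 2 ≤ ε := by nlinarith
        gcongr
      _ = 2 * L * ε := by ring
  have h := (abs_le.1 (Real.exp_bound (ht.trans hε1) (n := 3) (by norm_num))).1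
  have ht3 : |t| ^ 3 ≤ 8 * L ^ 3 * ε ^ 3 :=
    (pow_le_pow_left₀ (abs_nonneg _) ht 3).trans_eq (by ring)
  simp only [Finset.sum_range_succ, Finset.sum_range_zero, Nat.factorial] at h
  norm_num at h
  have hfg : f * (κ * g) ≤ L ^ 3 := by
    calc f * (κ * g) ≤ |f| * (κ * g) := by gcongr; exact le_abs_self f
      _ ≤ L * L := by gcongr
      _ ≤ L ^ 3 := by nlinarith [sq_nonneg L]
  have hsq : ε ^ 2 * f ^ 2 - 2 * ε ^ 3 * L ^ 3 ≤ t ^ 2 := by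
    have : t ^ 2 = ε ^ 2 * f ^ 2 - 2 * ε ^ 3 * (f * (κ * g)) + (κ * ε ^ 2 * g) ^ 2 := by
      simp only [t]; ring
    rw [this]
    have : ε ^ 3 * (f * (κ * g)) ≤ ε ^ 3 * L ^ 3 := by gcongr
    nlinarith [sq_nonneg (κ * ε ^ 2 * g)]
  have : 0 ≤ L ^ 3 * ε ^ 3 := by positivity
  have : t = ε * f - κ * ε ^ 2 * g := rfl
  nlinarith

/-- Expanding the inequality `∫ exp(εf - κε²g) ∫ exp(-εf) ≤ 1` to second order in `ε` yields a
bound on the variance of `f`. -/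
theorem integral_sq_le_of_exp_mul_le {α : Type*} [MeasurableSpace α] {μ : Measure α} {w f g : α → ℝ}
    {L κ ε₀ : ℝ} (hw : Integrable w μ) (hw0 : ∀ x, 0 ≤ w x) (hZ : 0 < ∫ x, w x ∂μ)
    (hf : AEStronglyMeasurable f μ) (hg : AEStronglyMeasurable g μ) (hL : 1 ≤ L)
    (hfL : ∀ x, |f x| ≤ L) (hκ : 0 < κ) (hg0 : ∀ x, 0 ≤ g x) (hgL : ∀ x, κ * g x ≤ L)
    (hmean : ∫ x, f x * w x ∂μ = 0) (hε₀ : 0 < ε₀)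
    (H : ∀ ε, 0 < ε → ε < ε₀ → (∫ x, Real.exp (ε * f x - κ * ε ^ 2 * g x) * w x ∂μ) *
      (∫ x, Real.exp (-(ε * f x)) * w x ∂μ) ≤ (∫ x, w x ∂μ) ^ 2) :
    ∫ x, f x ^ 2 * w x ∂μ ≤ κ * ∫ x, g x * w x ∂μ := by
  set Z := ∫ x, w x ∂μ
  set F := ∫ x, f x ^ 2 * w x ∂μ
  set G := ∫ x, g x * w x ∂μ
  have if1 : Integrable (fun x => f x * w x) μ :=
    hw.bdd_mul hf (ae_of_all _ fun x => by simpa using hfL x)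
  have if2 : Integrable (fun x => f x ^ 2 * w x) μ :=
    hw.bdd_mul (c := L ^ 2) (hf.pow 2) (ae_of_all _ fun x => by
      rw [norm_pow]; exact pow_le_pow_left₀ (norm_nonneg _) (hfL x) 2)
  have ig : Integrable (fun x => g x * w x) μ :=
    hw.bdd_mul (c := L / κ) hg (ae_of_all _ fun x => by
      rw [Real.norm_of_nonneg (hg0 x), le_div_iff₀ hκ, mul_comm]; exact hgL x)
  -- The pairs (k, e) = (κ, 1) and (0, -1) give the two factors of `H`. The first-order term
  -- integrates to zero because f has weighted mean zero.
  have lower : ∀ (k e : ℝ), 0 ≤ k → k ≤ κ → (e = 1 ∨ e = -1) → ∀ ε, 0 < ε → 2 * L * ε ≤ 1 →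
      Z + ε ^ 2 * (F / 2 - k * G) - 9 * L ^ 3 * ε ^ 3 * Z ≤
        ∫ x, Real.exp (ε * (e * f x) - k * ε ^ 2 * g x) * w x ∂μ := by
    intro k e hk hkκ he ε hε hε1
    have habs : ∀ x, |e * f x| = |f x| := fun x => by rcases he with rfl | rfl <;> simp
    have he2 : e ^ 2 = 1 := by rcases he with rfl | rfl <;> norm_num
    have hkg : ∀ x, k * g x ≤ L := fun x =>
      (mul_le_mul_of_nonneg_right hkκ (hg0 x)).trans (hgL x)
    have hI : Integrable (fun x => Real.exp (ε * (e * f x) - k * ε ^ 2 * g x) * w x) μ := by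
      refine hw.bdd_mul (c := Real.exp (ε * L)) ?_ (ae_of_all _ fun x => ?_)
      · exact Real.continuous_exp.comp_aestronglyMeasurable
          (((hf.const_mul e).const_mul ε).sub (hg.const_mul _))
      · rw [Real.norm_of_nonneg (Real.exp_nonneg _), Real.exp_le_exp]
        have h1 : ε * (e * f x) ≤ ε * L := by
          gcongr; exact (le_abs_self _).trans ((habs x).le.trans (hfL x))
        have h2 : 0 ≤ k * ε ^ 2 * g x := by have := hg0 x; positivity
        linarith
    have j1 : Integrable (fun x => w x + (ε * e) * (f x * w x)) μ := hw.add (if1.const_mul _)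
    have j2 : Integrable (fun x => w x + (ε * e) * (f x * w x) - (k * ε ^ 2) * (g x * w x)) μ :=
      j1.sub (ig.const_mul _)
    have j3 : Integrable (fun x => w x + (ε * e) * (f x * w x) - (k * ε ^ 2) * (g x * w x) +
        (ε ^ 2 / 2) * (f x ^ 2 * w x)) μ := j2.add (if2.const_mul _)
    have hrhs : ∫ x, (w x + (ε * e) * (f x * w x) - (k * ε ^ 2) * (g x * w x) +
        (ε ^ 2 / 2) * (f x ^ 2 * w x) - (9 * L ^ 3 * ε ^ 3) * w x) ∂μ =
        Z + ε ^ 2 * (F / 2 - k * G) - 9 * L ^ 3 * ε ^ 3 * Z := by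
      rw [integral_sub j3 (hw.const_mul _), integral_add j2 (if2.const_mul _),
        integral_sub j1 (ig.const_mul _), integral_add hw (if1.const_mul _)]
      simp only [integral_const_mul]
      rw [hmean]
      ring
    rw [← hrhs]
    refine integral_mono (j3.sub (hw.const_mul _)) hI fun x => ?_
    have := exp_ge_quadratic hL ((habs x).le.trans (hfL x)) (mul_nonneg hk (hg0 x)) (hkg x) hε hε1
    have h2 := mul_le_mul_of_nonneg_right this (hw0 x)
    refine le_trans (le_of_eq ?_) h2
    rw [mul_pow, he2]
    ring
  -- For small ε both lower bounds are positive and may be multiplied. Then Z² cancels against the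
  -- right side of `H`, and division by ε² leaves Z(F - κG) bounded by a quantity tending to zero.
  have poly : ∀ᶠ ε in nhdsWithin (0 : ℝ) (Set.Ioi 0),
      Z * (F - κ * G) ≤ Z * (18 * L ^ 3 * ε * Z) -
        ε ^ 2 * ((F / 2 - κ * G - 9 * L ^ 3 * ε * Z) * (F / 2 - 9 * L ^ 3 * ε * Z)) := by
    have p1 : ∀ᶠ ε in nhdsWithin (0 : ℝ) (Set.Ioi 0),
        0 < Z + ε ^ 2 * (F / 2 - κ * G) - 9 * L ^ 3 * ε ^ 3 * Z := by
      refine (Filter.Tendsto.mono_left ?_ nhdsWithin_le_nhds).eventually (lt_mem_nhds hZ)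
      have : Continuous fun ε : ℝ => Z + ε ^ 2 * (F / 2 - κ * G) - 9 * L ^ 3 * ε ^ 3 * Z := by
        fun_prop
      simpa using this.tendsto 0
    have p2 : ∀ᶠ ε in nhdsWithin (0 : ℝ) (Set.Ioi 0),
        0 < Z + ε ^ 2 * (F / 2 - 0 * G) - 9 * L ^ 3 * ε ^ 3 * Z := by
      refine (Filter.Tendsto.mono_left ?_ nhdsWithin_le_nhds).eventually (lt_mem_nhds hZ)
      have : Continuous fun ε : ℝ => Z + ε ^ 2 * (F / 2 - 0 * G) - 9 * L ^ 3 * ε ^ 3 * Z := by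
        fun_prop
      simpa using this.tendsto 0
    have p3 : ∀ᶠ ε in nhdsWithin (0 : ℝ) (Set.Ioi 0), ε < min ε₀ (1 / (2 * L)) :=
      nhdsWithin_le_nhds (gt_mem_nhds (lt_min hε₀ (by positivity)))
    filter_upwards [p1, p2, p3, self_mem_nhdsWithin] with ε h1 h2 h3 hε
    have hε : 0 < ε := hε
    have hε1 : 2 * L * ε ≤ 1 := by
      have := (h3.trans_le (min_le_right _ _)).le
      rw [le_div_iff₀ (by positivity)] at this
      linarith
    have hA := lower κ 1 hκ.le le_rfl (Or.inl rfl) ε hε hε1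
    have hB := lower 0 (-1) le_rfl hκ.le (Or.inr rfl) ε hε hε1
    have hAB := H ε hε (h3.trans_le (min_le_left _ _))
    have e1 : ∫ x, Real.exp (ε * (1 * f x) - κ * ε ^ 2 * g x) * w x ∂μ =
      ∫ x, Real.exp (ε * f x - κ * ε ^ 2 * g x) * w x ∂μ := by simp only [one_mul]
    have e2 : ∫ x, Real.exp (ε * (-1 * f x) - 0 * ε ^ 2 * g x) * w x ∂μ =
      ∫ x, Real.exp (-(ε * f x)) * w x ∂μ := by
      congr 1; ext x; congr 2; ring
    rw [e1] at hA
    rw [e2] at hB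
    have := (mul_le_mul hA hB h2.le (h1.le.trans hA)).trans hAB
    have hε2 : 0 < ε ^ 2 := by positivity
    have h5 : ε ^ 2 * (Z * (F - κ * G) - (Z * (18 * L ^ 3 * ε * Z) -
        ε ^ 2 * ((F / 2 - κ * G - 9 * L ^ 3 * ε * Z) * (F / 2 - 9 * L ^ 3 * ε * Z)))) ≤ 0 := by
      nlinarith
    by_contra hcon
    push Not at hcon
    have := mul_pos hε2 (sub_pos.2 hcon)
    linarith
  have hlim : Filter.Tendsto (fun ε : ℝ => Z * (18 * L ^ 3 * ε * Z) -
        ε ^ 2 * ((F / 2 - κ * G - 9 * L ^ 3 * ε * Z) * (F / 2 - 9 * L ^ 3 * ε * Z)))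
      (nhdsWithin (0 : ℝ) (Set.Ioi 0)) (nhds 0) := by
    refine Filter.Tendsto.mono_left ?_ nhdsWithin_le_nhds
    have : Continuous fun ε : ℝ => Z * (18 * L ^ 3 * ε * Z) -
        ε ^ 2 * ((F / 2 - κ * G - 9 * L ^ 3 * ε * Z) * (F / 2 - 9 * L ^ 3 * ε * Z)) := by
      fun_prop
    simpa using this.tendsto 0
  have := ge_of_tendsto hlim poly
  by_contra hcon
  push Not at hcon
  have := mul_pos hZ (sub_pos.2 hcon)
  linarith

end

/-! ### The Poincaré inequality on convex sets, through Gaussian weights. -/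

section

open scoped RealInnerProductSpace

variable {d : ℕ}

theorem norm_gradient_eq (f : Rd d → ℝ) (x : Rd d) : ‖gradient f x‖ = ‖fderiv ℝ f x‖ := by
  simp [gradient]

theorem continuous_gradient {f : Rd d → ℝ} (hf : ContDiff ℝ ∞ f) :
    Continuous fun x => gradient f x := by
  unfold gradient
  exact (LinearIsometryEquiv.continuous _).comp (hf.continuous_fderiv (by simp))

theorem hasCompactSupport_gradient {f : Rd d → ℝ} (hf : HasCompactSupport f) :
    HasCompactSupport fun x => gradient f x := by
  unfold gradient
  exact (hf.fderiv ℝ).comp_left (g := (InnerProductSpace.toDual ℝ (Rd d)).symm) (by simp)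

/-- A second-order Taylor bound with a uniform constant. -/
theorem exists_taylor_bound {f : Rd d → ℝ} (hf : ContDiff ℝ ∞ f) (hc : HasCompactSupport f) :
    ∃ M, 0 ≤ M ∧ ∀ x y, f x - f y ≤ ‖gradient f x‖ * ‖x - y‖ + M * ‖x - y‖ ^ 2 := by
  have hf' : ContDiff ℝ 1 (fderiv ℝ f) := hf.fderiv_right (m := 1) (by norm_cast)
  obtain ⟨M, hM⟩ := hf'.lipschitzWith_of_hasCompactSupport (hc.fderiv ℝ) one_ne_zero
  refine ⟨M, M.2, fun x y => ?_⟩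
  have h := (convex_segment x y).norm_image_sub_le_of_norm_fderiv_le' (𝕜 := ℝ) (f := f)
    (C := M * ‖x - y‖) (φ := fderiv ℝ f x) (fun z _ => hf.differentiable (by simp) z)
    (fun z hz => by
      refine (hM.norm_sub_le z x).trans ?_
      gcongr
      obtain ⟨t, ht0, ht1, rfl⟩ : ∃ t : ℝ, 0 ≤ t ∧ t ≤ 1 ∧ x + t • (y - x) = z := by
        rw [segment_eq_image'] at hz
        obtain ⟨t, ht, rfl⟩ := hz
        exact ⟨t, ht.1, ht.2, rfl⟩
      rw [add_sub_cancel_left, norm_smul, Real.norm_of_nonneg ht0, norm_sub_rev]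
      exact mul_le_of_le_one_left (norm_nonneg _) ht1)
    (left_mem_segment ℝ x y) (right_mem_segment ℝ x y)
  have h1 := neg_le_of_abs_le h
  have h2 : fderiv ℝ f x (x - y) ≤ ‖gradient f x‖ * ‖x - y‖ := by
    rw [norm_gradient_eq]
    exact (le_abs_self _).trans ((fderiv ℝ f x).le_opNorm _)
  have h3 : fderiv ℝ f x (y - x) = - fderiv ℝ f x (x - y) := by
    rw [← map_neg, neg_sub]
  rw [h3, norm_sub_rev y x] at h1
  nlinarith

/-- Parallelogram law. The surplus ‖x - y‖²/(4s²) is the strong log-concavity of the Gaussian, and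
it pays for the oscillation of f in the Prékopa-Leindler hypothesis. -/
theorem neg_sq_midpoint {s : ℝ} (hs : s ≠ 0) (c x y : Rd d) :
    -(‖x - c‖ ^ 2 / (2 * s ^ 2)) + -(‖y - c‖ ^ 2 / (2 * s ^ 2)) + ‖x - y‖ ^ 2 / (4 * s ^ 2) =
      2 * -(‖(2⁻¹ : ℝ) • (x + y) - c‖ ^ 2 / (2 * s ^ 2)) := by
  have h1 : (2⁻¹ : ℝ) • (x + y) - c = (2⁻¹ : ℝ) • ((x - c) + (y - c)) := by
    have : c = (2⁻¹ : ℝ) • (c + c) := by rw [← two_smul ℝ c, smul_smul]; norm_num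
    conv_lhs => rw [this]
    rw [← smul_sub]; congr 1; abel
  have h2 := parallelogram_law_with_norm ℝ (x - c) (y - c)
  have h3 : x - c - (y - c) = x - y := by abel
  rw [h3] at h2
  rw [h1, norm_smul, mul_pow, Real.norm_of_nonneg (by norm_num)]
  field_simp
  linarith

/-- The Poincaré inequality for a Gaussian measure restricted to a convex set. -/
theorem integral_sq_le_gaussian {K : Set (Rd d)} (hKo : IsOpen K) (hK : Convex ℝ K)
    (hKb : Bornology.IsBounded K) (hKn : K.Nonempty) {f : Rd d → ℝ} (hf : ContDiff ℝ ∞ f)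
    (hc : HasCompactSupport f) (c : Rd d) {s κ m : ℝ} (hs : 0 < s) (hκ : s ^ 2 < κ)
    (hm : ∫ x in K, (f x - m) * Real.exp (-(‖x - c‖ ^ 2 / (2 * s ^ 2))) = 0) :
    ∫ x in K, (f x - m) ^ 2 * Real.exp (-(‖x - c‖ ^ 2 / (2 * s ^ 2))) ≤
      κ * ∫ x in K, ‖gradient f x‖ ^ 2 * Real.exp (-(‖x - c‖ ^ 2 / (2 * s ^ 2))) := by
  have hKv : volume K ≠ ⊤ := hKb.measure_lt_top.ne
  have : IsFiniteMeasure (volume.restrict K) := ⟨by simpa using hKb.measure_lt_top⟩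
  have hs2 : 0 < s ^ 2 := by positivity
  have hκ0 : 0 < κ := hs2.trans hκ
  set w : Rd d → ℝ := fun x => Real.exp (-(‖x - c‖ ^ 2 / (2 * s ^ 2)))
  have hwc : Continuous w := by fun_prop
  have hw1 : ∀ x, w x ≤ 1 := fun x => by
    rw [Real.exp_le_one_iff]; exact neg_nonpos.2 (by positivity)
  have hw0 : ∀ x, 0 < w x := fun x => Real.exp_pos _
  have hwi : Integrable w (volume.restrict K) :=
    Integrable.of_bound hwc.aestronglyMeasurable 1 (ae_of_all _ fun x => by
      rw [Real.norm_of_nonneg (hw0 x).le]; exact hw1 x)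
  have hgc := continuous_gradient hf
  obtain ⟨L₁, hL₁⟩ := hc.exists_bound_of_continuous hf.continuous
  obtain ⟨L₂, hL₂⟩ := (hasCompactSupport_gradient hc).exists_bound_of_continuous hgc
  obtain ⟨M, hM0, hM⟩ := exists_taylor_bound hf hc
  set L := max 1 (max (L₁ + |m|) (κ * L₂ ^ 2))
  have hZ : 0 < ∫ x in K, w x := by
    rw [integral_pos_iff_support_of_nonneg (fun x => (hw0 x).le) hwi]
    have : Function.support w = Set.univ := by
      ext x; simpa using (hw0 x).ne'
    rw [this, Measure.restrict_apply_univ]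
    exact hKo.measure_pos volume hKn
  -- The threshold ε₀ ensures εM ≤ 1/(4s²) - 1/(4κ), with M the Taylor constant of f. It is positive
  -- because s² < κ, and M + 1 avoids a division by zero.
  refine integral_sq_le_of_exp_mul_le (μ := volume.restrict K) (w := w) (f := fun x => f x - m)
    (g := fun x => ‖gradient f x‖ ^ 2) (L := L) (κ := κ)
    (ε₀ := (1 / (4 * s ^ 2) - 1 / (4 * κ)) / (M + 1)) hwi
    (fun x => (hw0 x).le) hZ (hf.continuous.sub continuous_const).aestronglyMeasurable
    (hgc.norm.pow 2).aestronglyMeasurable (le_max_left _ _) ?_ hκ0 (fun x => by positivity) ?_ hm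
    ?_ ?_
  · intro x
    refine (abs_sub _ _).trans (le_trans ?_ ((le_max_left _ _).trans (le_max_right _ _)))
    gcongr
    exact hL₁ x
  · intro x
    refine le_trans ?_ ((le_max_right _ _).trans (le_max_right _ _))
    gcongr
    exact hL₂ x
  · have : 1 / (4 * κ) < 1 / (4 * s ^ 2) := by gcongr
    exact div_pos (sub_pos.2 this) (by positivity)
  intro ε hε hε1
  rw [lt_div_iff₀ (by positivity)] at hε1
  set u : Rd d → ℝ := fun x => Real.exp (ε * (f x - m) - κ * ε ^ 2 * ‖gradient f x‖ ^ 2) * w x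
  set v : Rd d → ℝ := fun x => Real.exp (-(ε * (f x - m))) * w x
  have huc : Continuous u := by have := hf.continuous; fun_prop
  have hvc : Continuous v := by have := hf.continuous; fun_prop
  have hu0 : ∀ x, 0 ≤ u x := fun x => mul_nonneg (Real.exp_nonneg _) (hw0 x).le
  have hv0 : ∀ x, 0 ≤ v x := fun x => mul_nonneg (Real.exp_nonneg _) (hw0 x).le
  -- By Taylor and Young, ε(f x - f y) is at most κε²‖∇f x‖² plus (1/(4κ) + εM)‖x - y‖². The first
  -- term is subtracted in the exponent of u, and the second fits into the Gaussian surplus.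
  have hPL := prekopa_leindler (f := K.indicator fun x => ENNReal.ofReal (u x))
    (g := K.indicator fun x => ENNReal.ofReal (v x))
    (h := K.indicator fun x => ENNReal.ofReal (w x))
    (huc.measurable.ennreal_ofReal.indicator hKo.measurableSet)
    (hvc.measurable.ennreal_ofReal.indicator hKo.measurableSet)
    (hwc.measurable.ennreal_ofReal.indicator hKo.measurableSet) (by
      intro x y
      by_cases hx : x ∈ K
      swap
      · simp [hx]
      by_cases hy : y ∈ K
      swap
      · simp [hy]
      have hxy : (2⁻¹ : ℝ) • (x + y) ∈ K := by
        rw [smul_add]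
        exact hK hx hy (by norm_num) (by norm_num) (by norm_num)
      rw [Set.indicator_of_mem hx, Set.indicator_of_mem hy, Set.indicator_of_mem hxy,
        ← ENNReal.ofReal_mul (hu0 x), ← ENNReal.ofReal_pow (hw0 _).le]
      refine ENNReal.ofReal_le_ofReal ?_
      simp only [u, v, w]
      rw [← Real.exp_add, ← Real.exp_add, ← Real.exp_add, ← Real.exp_nat_mul, Real.exp_le_exp]
      push_cast
      rw [← neg_sq_midpoint hs.ne']
      have hT := hM x y
      have hT2 : ε * (f x - f y) ≤ ε * (‖gradient f x‖ * ‖x - y‖ + M * ‖x - y‖ ^ 2) := by gcongr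
      have hAG : ε * (‖gradient f x‖ * ‖x - y‖) ≤
          κ * ε ^ 2 * ‖gradient f x‖ ^ 2 + 1 / (4 * κ) * ‖x - y‖ ^ 2 := by
        have : 0 ≤ κ * (ε * ‖gradient f x‖ - 1 / (2 * κ) * ‖x - y‖) ^ 2 := by positivity
        have e : κ * (ε * ‖gradient f x‖ - 1 / (2 * κ) * ‖x - y‖) ^ 2 =
          κ * ε ^ 2 * ‖gradient f x‖ ^ 2 + 1 / (4 * κ) * ‖x - y‖ ^ 2 -
            ε * (‖gradient f x‖ * ‖x - y‖) := by field_simp; ring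
        linarith
      have hb : ε * M ≤ 1 / (4 * s ^ 2) - 1 / (4 * κ) := by nlinarith
      have hb2 : ε * M * ‖x - y‖ ^ 2 ≤ (1 / (4 * s ^ 2) - 1 / (4 * κ)) * ‖x - y‖ ^ 2 := by gcongr
      have e2 : ‖x - y‖ ^ 2 / (4 * s ^ 2) = 1 / (4 * s ^ 2) * ‖x - y‖ ^ 2 := by ring
      rw [e2]
      linarith)
  rw [lintegral_indicator hKo.measurableSet, lintegral_indicator hKo.measurableSet,
    lintegral_indicator hKo.measurableSet] at hPL
  have hui : Integrable u (volume.restrict K) :=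
    (huc.continuousOn.integrableOn_compact hKb.isCompact_closure).mono_set subset_closure
  have hvi : Integrable v (volume.restrict K) :=
    (hvc.continuousOn.integrableOn_compact hKb.isCompact_closure).mono_set subset_closure
  rw [← ofReal_integral_eq_lintegral_ofReal hui (ae_of_all _ hu0),
    ← ofReal_integral_eq_lintegral_ofReal hvi (ae_of_all _ hv0),
    ← ofReal_integral_eq_lintegral_ofReal hwi (ae_of_all _ fun x => (hw0 x).le),
    ← ENNReal.ofReal_mul (integral_nonneg hu0), ← ENNReal.ofReal_pow hZ.le] at hPL
  exact (ENNReal.ofReal_le_ofReal_iff (by positivity)).1 hPL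

/-- A Poincaré inequality on bounded convex open sets, with a constant that depends on the diameter
only. -/
theorem poincare_convex_of_isOpen {K : Set (Rd d)} (hKo : IsOpen K) (hK : Convex ℝ K)
    (hKb : Bornology.IsBounded K) (hKn : K.Nonempty) {D : ℝ} (hD : 0 < D)
    (hKD : ∀ x ∈ K, ∀ y ∈ K, dist x y ≤ D) {f : Rd d → ℝ} (hf : ContDiff ℝ ∞ f)
    (hc : HasCompactSupport f) :
    ∫ x in K, f x ^ 2 ≤ 25 / 36 * D ^ 2 * (∫ x in K, ‖gradient f x‖ ^ 2) +
      (∫ x in K, f x) ^ 2 / volume.real K := by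
  obtain ⟨c, hcK⟩ := exists_center_of_dist_le hKn hD hKD
  have : IsFiniteMeasure (volume.restrict K) := ⟨by simpa using hKb.measure_lt_top⟩
  have hint : ∀ {g : Rd d → ℝ}, Continuous g → IntegrableOn g K := fun hg =>
    (hg.continuousOn.integrableOn_compact hKb.isCompact_closure).mono_set subset_closure
  -- With s² equal to half the squared radius R² = 51/100 D², the weight stays between 1/e and 1 on
  -- K. This choice minimises s² exp(R²/(2s²)), the resulting constant.
  set s : ℝ := Real.sqrt (51 / 200 * D ^ 2)
  have hs2 : s ^ 2 = 51 / 200 * D ^ 2 := Real.sq_sqrt (by positivity)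
  have hs : 0 < s := Real.sqrt_pos.2 (by positivity)
  set w : Rd d → ℝ := fun x => Real.exp (-(‖x - c‖ ^ 2 / (2 * s ^ 2)))
  have hwc : Continuous w := by fun_prop
  have hfc := hf.continuous
  have hgc := continuous_gradient hf
  have hw0 : ∀ x, 0 < w x := fun x => Real.exp_pos _
  have hw1 : ∀ x, w x ≤ 1 := fun x => by
    rw [Real.exp_le_one_iff]; exact neg_nonpos.2 (by positivity)
  have hwl : ∀ x ∈ K, 1 ≤ Real.exp 1 * w x := fun x hx => by
    rw [← Real.exp_add, Real.one_le_exp_iff, le_add_neg_iff_add_le, zero_add,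
      div_le_one (by positivity), hs2]
    linarith [hcK x hx]
  have hKpos : 0 < volume.real K := ENNReal.toReal_pos (hKo.measure_pos volume hKn).ne'
    hKb.measure_lt_top.ne
  have hZ : 0 < ∫ x in K, w x := by
    rw [integral_pos_iff_support_of_nonneg (fun x => (hw0 x).le) (hint hwc)]
    have : Function.support w = Set.univ := by
      ext x; simpa using (hw0 x).ne'
    rw [this, Measure.restrict_apply_univ]
    exact hKo.measure_pos volume hKn
  set m := (∫ x in K, f x * w x) / ∫ x in K, w x
  have hm : ∫ x in K, (f x - m) * w x = 0 := by
    simp_rw [sub_mul]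
    rw [integral_sub (hint (g := fun x => f x * w x) (hfc.mul hwc))
      (hint (g := fun x => m * w x) (continuous_const.mul hwc)), integral_const_mul]
    simp only [m]
    rw [div_mul_cancel₀ _ hZ.ne', sub_self]
  -- The value of κ may be anything above s² = 0.255 D² for which eκ ≤ 25/36 D².
  have hκ : s ^ 2 < 2551 / 10000 * D ^ 2 := by
    rw [hs2]; have : 0 < D ^ 2 := by positivity
    linarith
  have hG := integral_sq_le_gaussian hKo hK hKb hKn hf hc c hs hκ hm
  have h1 : ∫ x in K, (f x - m) ^ 2 ≤ Real.exp 1 * ∫ x in K, (f x - m) ^ 2 * w x := by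
    rw [← integral_const_mul]
    refine setIntegral_mono_on (hint (by fun_prop)) (hint (by fun_prop)) hKo.measurableSet
      fun x hx => ?_
    nlinarith [hwl x hx, sq_nonneg (f x - m)]
  have h2 : ∫ x in K, ‖gradient f x‖ ^ 2 * w x ≤ ∫ x in K, ‖gradient f x‖ ^ 2 :=
    setIntegral_mono_on (hint (by fun_prop)) (hint (by fun_prop)) hKo.measurableSet
      fun x hx => mul_le_of_le_one_right (by positivity) (hw1 x)
  have hG0 : 0 ≤ ∫ x in K, ‖gradient f x‖ ^ 2 := integral_nonneg fun x => by positivity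
  have h3 : ∫ x in K, (f x - m) ^ 2 ≤ 25 / 36 * D ^ 2 * ∫ x in K, ‖gradient f x‖ ^ 2 := by
    have he := Real.exp_one_lt_d9
    calc ∫ x in K, (f x - m) ^ 2 ≤ Real.exp 1 * ∫ x in K, (f x - m) ^ 2 * w x := h1
      _ ≤ Real.exp 1 * (2551 / 10000 * D ^ 2 * ∫ x in K, ‖gradient f x‖ ^ 2) := by
        gcongr
        exact hG.trans (by gcongr)
      _ = (Real.exp 1 * (2551 / 10000)) * (D ^ 2 * ∫ x in K, ‖gradient f x‖ ^ 2) := by ring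
      _ ≤ 25 / 36 * (D ^ 2 * ∫ x in K, ‖gradient f x‖ ^ 2) := by
        gcongr
        linarith
      _ = _ := by ring
  have h4 : ∫ x in K, (f x - m) ^ 2 =
      (∫ x in K, f x ^ 2) - 2 * m * (∫ x in K, f x) + m ^ 2 * volume.real K := by
    have e : ∀ x, (f x - m) ^ 2 = f x ^ 2 - (2 * m) * f x + m ^ 2 := fun x => by ring
    simp_rw [e]
    rw [integral_add (hint (by fun_prop)) (hint continuous_const),
      integral_sub (hint (by fun_prop)) (hint (by fun_prop)), integral_const_mul]
    simp [mul_comm]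
  -- Here m is the Gaussian mean of f, not its mean over K. The left side is quadratic in m and is
  -- largest at the true mean.
  have h5 : 2 * m * (∫ x in K, f x) - m ^ 2 * volume.real K ≤
      (∫ x in K, f x) ^ 2 / volume.real K := by
    rw [le_div_iff₀ hKpos]
    nlinarith [sq_nonneg ((∫ x in K, f x) - m * volume.real K)]
  linarith

end

/-! ### Mollification, and bump functions in convex sets. -/

section

variable {d : ℕ}

/-- Mollification of a `1`-Lipschitz function. -/
theorem exists_smooth_approx {f : Rd d → ℝ} (hf : LipschitzWith 1 f) {ε : ℝ} (hε : 0 < ε) :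
    ∃ g : Rd d → ℝ, ContDiff ℝ ∞ g ∧ (∀ x, ‖gradient g x‖ ≤ 1) ∧ (∀ x, |g x - f x| ≤ ε) ∧
      (∀ x c, (∀ y ∈ Metric.ball x ε, f y = c) → g x = c) ∧
      (∀ a b, (∀ y, f y ∈ Set.Icc a b) → ∀ x, g x ∈ Set.Icc a b) := by
  let φ : ContDiffBump (0 : Rd d) := ⟨ε / 2, ε, by positivity, by linarith⟩
  have hfi : LocallyIntegrable f volume := hf.continuous.locallyIntegrable
  set g := convolution (φ.normed volume) f (ContinuousLinearMap.lsmul ℝ ℝ) volume with hgdef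
  have hgx : ∀ x, g x = ∫ t, φ.normed volume t * f (x - t) := fun x => rfl
  have hint : ∀ x, Integrable fun t => φ.normed volume t * f (x - t) := fun x =>
    Continuous.integrable_of_hasCompactSupport
      (φ.continuous_normed.mul (hf.continuous.comp (by fun_prop)))
      (φ.hasCompactSupport_normed.mul_right)
  have hφi : Integrable (φ.normed (volume : Measure (Rd d))) := φ.integrable_normed
  have hφ1 : ∫ t, φ.normed (volume : Measure (Rd d)) t = 1 := φ.integral_normed
  have hlip : LipschitzWith 1 g := by
    refine LipschitzWith.of_dist_le_mul fun x y => ?_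
    rw [Real.dist_eq, hgx, hgx, ← integral_sub (hint x) (hint y)]
    have hb : ‖∫ t, (φ.normed volume t * f (x - t) - φ.normed volume t * f (y - t))‖ ≤
        ∫ t, φ.normed volume t * dist x y := by
      refine norm_integral_le_of_norm_le (hφi.mul_const (dist x y)) (ae_of_all _ fun t => ?_)
      rw [← mul_sub, norm_mul, Real.norm_of_nonneg (φ.nonneg_normed t)]
      refine mul_le_mul_of_nonneg_left ?_ (φ.nonneg_normed t)
      have := hf.dist_le_mul (x - t) (y - t)
      rwa [Real.dist_eq, NNReal.coe_one, one_mul, dist_sub_right] at this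
    rw [integral_mul_const, hφ1] at hb
    simpa using hb
  refine ⟨g, φ.hasCompactSupport_normed.contDiff_convolution_left _ φ.contDiff_normed hfi, ?_, ?_,
    ?_, ?_⟩
  · intro x
    rw [norm_gradient_eq]
    have : ‖fderiv ℝ g x‖ ≤ ((1 : NNReal) : ℝ) := norm_fderiv_le_of_lipschitz ℝ hlip
    simpa using this
  · intro x
    have := φ.dist_normed_convolution_le (μ := volume) (g := f) (x₀ := x) (ε := ε)
      hf.continuous.aestronglyMeasurable (fun y hy => by
        have h1 := hf.dist_le_mul y x
        rw [NNReal.coe_one, one_mul] at h1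
        exact h1.trans (Metric.mem_ball.1 hy).le)
    simpa [Real.dist_eq] using this
  · intro x c hc
    have := φ.normed_convolution_eq_right (μ := volume) (g := f) (x₀ := x) (fun y hy => by
      rw [hc y hy, hc x (Metric.mem_ball_self hε)])
    rw [hgdef, this, hc x (Metric.mem_ball_self hε)]
  · intro a b hab x
    constructor
    · calc a = ∫ t, φ.normed (volume : Measure (Rd d)) t * a := by
            rw [integral_mul_const, hφ1, one_mul]
        _ ≤ g x := integral_mono (hφi.mul_const a) (hint x) fun t =>
            mul_le_mul_of_nonneg_left (hab _).1 (φ.nonneg_normed t)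
    · calc g x ≤ ∫ t, φ.normed (volume : Measure (Rd d)) t * b :=
            integral_mono (hint x) (hφi.mul_const b) fun t =>
              mul_le_mul_of_nonneg_left (hab _).2 (φ.nonneg_normed t)
        _ = b := by rw [integral_mul_const, hφ1, one_mul]

theorem integral_one_sub_div_pow (n : ℕ) {ρ : ℝ} (hρ : 0 < ρ) :
    ∫ t in (0 : ℝ)..ρ, (1 - t / ρ) ^ n = ρ / (n + 1) := by
  rw [intervalIntegral.integral_comp_sub_div (fun x => x ^ n) hρ.ne', integral_pow]
  simp [hρ.ne']
  field_simp

/-- The integral over a convex set of the distance to its complement. -/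
theorem le_integral_infDist_compl {U : Set (Rd d)} (hU : Convex ℝ U)
    (hUb : Bornology.IsBounded U) {c : Rd d} {ρ : ℝ} (hρ : 0 < ρ) (hball : Metric.ball c ρ ⊆ U)
    (hne : Uᶜ.Nonempty) :
    ρ * volume.real U / (d + 1) ≤ ∫ x in U, Metric.infDist x Uᶜ := by
  have hpc : Continuous fun x : Rd d => Metric.infDist x Uᶜ := Metric.continuous_infDist_pt _
  have hpi : IntegrableOn (fun x : Rd d => Metric.infDist x Uᶜ) U :=
    (hpc.continuousOn.integrableOn_compact hUb.isCompact_closure).mono_set subset_closure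
  -- The ball of radius t about the image of k consists of the combinations of k, with weight 1 -
  -- t/ρ, and of points of the ball about c, with weight t/ρ; by convexity it lies in U. The volume
  -- of the image then scales by (1 - t/ρ)^d, and integrating over t gives the factor ρ/(d + 1).
  have hsub : ∀ t, 0 < t → t < ρ →
      AffineMap.homothety c (1 - t / ρ) '' U ⊆ {x | t ≤ Metric.infDist x Uᶜ} ∩ U := by
    rintro t ht htρ _ ⟨k, hk, rfl⟩
    set lam := 1 - t / ρ
    have hl0 : 0 < lam := by simp only [lam]; rw [sub_pos, div_lt_one hρ]; exact htρ
    have hb : Metric.ball (AffineMap.homothety c lam k) t ⊆ U := by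
      intro y hy
      have h1 : c + (ρ / t) • (y - AffineMap.homothety c lam k) ∈ U := by
        refine hball ?_
        rw [Metric.mem_ball, dist_eq_norm] at hy ⊢
        rw [add_sub_cancel_left, norm_smul, Real.norm_of_nonneg (by positivity), div_mul_eq_mul_div,
          div_lt_iff₀ ht]
        gcongr
      have h2 := hU hk h1 hl0.le (show 0 ≤ t / ρ by positivity) (by simp [lam])
      convert h2 using 1
      rw [smul_add, smul_smul, div_mul_div_cancel₀ hρ.ne', div_self ht.ne', one_smul,
        AffineMap.homothety_apply]
      have : t / ρ = 1 - lam := by simp [lam]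
      rw [this]
      simp only [vsub_eq_sub, vadd_eq_add]
      module
    refine ⟨?_, hb (Metric.mem_ball_self ht)⟩
    refine (Metric.le_infDist hne).2 fun y hy => ?_
    by_contra hlt
    push Not at hlt
    exact hy (hb (by rwa [Metric.mem_ball, dist_comm]))
  have hvt : volume U ≠ ⊤ := hUb.measure_lt_top.ne
  have h1 : ENNReal.ofReal (ρ * volume.real U / (d + 1)) ≤
      ENNReal.ofReal (∫ x in U, Metric.infDist x Uᶜ) := by
    rw [ofReal_integral_eq_lintegral_ofReal hpi (ae_of_all _ fun x => Metric.infDist_nonneg),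
      lintegral_eq_lintegral_meas_le _ (ae_of_all _ fun x => Metric.infDist_nonneg)
        hpc.aemeasurable]
    calc ENNReal.ofReal (ρ * volume.real U / (d + 1))
        = ENNReal.ofReal (∫ t in (0 : ℝ)..ρ, (1 - t / ρ) ^ d * volume.real U) := by
          rw [intervalIntegral.integral_mul_const, integral_one_sub_div_pow d hρ]
          congr 1; ring
      _ = ∫⁻ t in Set.Ioc 0 ρ, ENNReal.ofReal ((1 - t / ρ) ^ d * volume.real U) := by
          rw [intervalIntegral.integral_of_le hρ.le, ofReal_integral_eq_lintegral_ofReal]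
          · exact (Continuous.integrableOn_Icc (by fun_prop)).mono_set Set.Ioc_subset_Icc_self
          · refine (ae_restrict_iff' measurableSet_Ioc).2 (ae_of_all _ fun t ht => ?_)
            have : 0 ≤ 1 - t / ρ := by rw [sub_nonneg, div_le_one hρ]; exact ht.2
            positivity
      _ = ∫⁻ t in Set.Ioo 0 ρ, ENNReal.ofReal ((1 - t / ρ) ^ d * volume.real U) := by
          rw [restrict_Ioo_eq_restrict_Ioc]
      _ ≤ ∫⁻ t in Set.Ioo 0 ρ, volume.restrict U {a | t ≤ Metric.infDist a Uᶜ} := by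
          refine setLIntegral_mono' measurableSet_Ioo fun t ht => ?_
          rw [Measure.restrict_apply (measurableSet_le measurable_const hpc.measurable)]
          refine le_trans (le_of_eq ?_) (measure_mono (hsub t ht.1 ht.2))
          have : 0 ≤ 1 - t / ρ := by rw [sub_nonneg, div_le_one hρ]; exact ht.2.le
          rw [Measure.addHaar_image_homothety, finrank_euclideanSpace_fin,
            abs_of_nonneg (by positivity), ENNReal.ofReal_mul (by positivity), ofReal_measureReal hvt]
      _ ≤ ∫⁻ t in Set.Ioi 0, volume.restrict U {a | t ≤ Metric.infDist a Uᶜ} :=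
          lintegral_mono_set fun t ht => ht.1
  exact (ENNReal.ofReal_le_ofReal_iff
    (integral_nonneg fun x => Metric.infDist_nonneg)).1 h1

/-- A smooth function supported in a convex set, with gradient at most one and a large integral. -/
theorem exists_bump_convex (hd : 1 ≤ d) {K : Set (Rd d)} (hK : Convex ℝ K)
    (hKb : Bornology.IsBounded K) {c : Rd d} {ρ : ℝ} (hρ : 0 < ρ) (hball : Metric.ball c ρ ⊆ K) :
    ∃ φ : Rd d → ℝ, ContDiff ℝ ∞ φ ∧ HasCompactSupport φ ∧ tsupport φ ⊆ interior K ∧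
      (∀ x, ‖gradient φ x‖ ≤ 1) ∧ ρ * volume.real K / (d + 1) ≤ 11 / 10 * ∫ x, φ x := by
  -- In positive dimension a bounded set has nonempty complement, so the distance to the complement
  -- is meaningful.
  have : Nonempty (Fin d) := ⟨⟨0, hd⟩⟩
  set U := interior K
  have hUo : IsOpen U := isOpen_interior
  have hU : Convex ℝ U := hK.interior
  have hUb : Bornology.IsBounded U := hKb.subset interior_subset
  have hUball : Metric.ball c ρ ⊆ U := interior_maximal hball Metric.isOpen_ball
  have hUK : volume.real U = volume.real K := measureReal_congr
    (interior_ae_eq_of_null_frontier (hK.addHaar_frontier volume))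
  have hne : Uᶜ.Nonempty := by
    rw [Set.nonempty_compl]
    intro h
    rw [h] at hUb
    exact NormedSpace.unbounded_univ ℝ (Rd d) hUb
  have hI := le_integral_infDist_compl hU hUb hρ hUball hne
  -- Lowering the distance by s and mollifying at scale s/2 costs at most 3s/2 pointwise, hence 1/11
  -- of the lower bound for the integral. The remaining fraction is 10/11.
  set s : ℝ := 2 / 3 * (ρ / (11 * (d + 1)))
  have hs : 0 < s := by positivity
  set p : Rd d → ℝ := fun x => max (Metric.infDist x Uᶜ - s) 0
  have hp : LipschitzWith 1 p := by
    have h1 : LipschitzWith 1 fun x : Rd d => Metric.infDist x Uᶜ := Metric.lipschitz_infDist_pt _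
    have h2 : LipschitzWith 1 fun x : Rd d => Metric.infDist x Uᶜ - s := by
      refine LipschitzWith.of_dist_le_mul fun x y => ?_
      rw [dist_sub_right]
      exact h1.dist_le_mul x y
    exact h2.max_const 0
  obtain ⟨g, hg, hg1, hgp, hgc, -⟩ := exists_smooth_approx hp (half_pos hs)
  have hsupp : tsupport g ⊆ {x | s / 2 ≤ Metric.infDist x Uᶜ} := by
    refine closure_minimal ?_ (isClosed_le continuous_const (Metric.continuous_infDist_pt _))
    intro x hx
    by_contra hlt
    have hlt : Metric.infDist x Uᶜ < s / 2 := not_le.1 hlt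
    refine hx (hgc x 0 fun y hy => ?_)
    have := Metric.infDist_le_infDist_add_dist (s := Uᶜ) (x := y) (y := x)
    rw [Metric.mem_ball] at hy
    exact max_eq_right (by linarith)
  have hsuppU : {x | s / 2 ≤ Metric.infDist x Uᶜ} ⊆ U := by
    intro x hx
    by_contra hxU
    have h0 := Metric.infDist_zero_of_mem (show x ∈ Uᶜ from hxU)
    have hx : s / 2 ≤ Metric.infDist x Uᶜ := hx
    linarith
  have hcs : HasCompactSupport g := by
    refine hUb.isCompact_closure.of_isClosed_subset (isClosed_tsupport g) ?_
    exact (hsupp.trans hsuppU).trans subset_closure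
  refine ⟨g, hg, hcs, hsupp.trans hsuppU, hg1, ?_⟩
  have hgi : Integrable g := hg.continuous.integrable_of_hasCompactSupport hcs
  have hpi : IntegrableOn (fun x : Rd d => Metric.infDist x Uᶜ) U :=
    ((Metric.continuous_infDist_pt _).continuousOn.integrableOn_compact
      hUb.isCompact_closure).mono_set subset_closure
  have : IsFiniteMeasure (volume.restrict U) := ⟨by simpa using hUb.measure_lt_top⟩
  have h1 : (∫ x in U, Metric.infDist x Uᶜ) - 3 / 2 * s * volume.real U ≤ ∫ x, g x := by
    rw [← setIntegral_eq_integral_of_forall_compl_eq_zero (s := U) (f := g) (fun x hx => by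
      by_contra h
      exact hx (hsuppU (hsupp (subset_tsupport g h))))]
    have e : (∫ x in U, Metric.infDist x Uᶜ) - 3 / 2 * s * volume.real U =
        ∫ x in U, (Metric.infDist x Uᶜ - 3 / 2 * s) := by
      rw [integral_sub hpi (integrable_const _)]
      simp [mul_comm]
    rw [e]
    refine integral_mono (hpi.sub (integrable_const _)) hgi.integrableOn fun x => ?_
    have h2 := (abs_le.1 (hgp x)).1
    have h3 : Metric.infDist x Uᶜ - s ≤ p x := le_max_left _ _
    show Metric.infDist x Uᶜ - 3 / 2 * s ≤ g x
    linarith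
  rw [hUK] at h1 hI
  have h2 : 3 / 2 * s * volume.real K = 1 / 11 * (ρ * volume.real K / (d + 1)) := by
    simp only [s]; field_simp
  linarith

end

/-! ### The space H¹₀: density, Poincaré, Friedrichs, multiplication by smooth functions. -/

section

variable {d : ℕ}

theorem gradient_add_apply {f g : Rd d → ℝ} (hf : ContDiff ℝ ∞ f) (hg : ContDiff ℝ ∞ g) (x : Rd d) :
    gradient (fun y => f y + g y) x = gradient f x + gradient g x := by
  unfold gradient
  rw [fderiv_fun_add (hf.differentiable (by simp) x) (hg.differentiable (by simp) x), map_add]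

theorem gradient_const_mul_apply {f : Rd d → ℝ} (hf : ContDiff ℝ ∞ f) (c : ℝ) (x : Rd d) :
    gradient (fun y => c * f y) x = c • gradient f x := by
  unfold gradient
  rw [fderiv_const_mul (hf.differentiable (by simp) x), map_smul]

theorem gradient_mul_apply {f g : Rd d → ℝ} (hf : ContDiff ℝ ∞ f) (hg : ContDiff ℝ ∞ g) (x : Rd d) :
    gradient (fun y => f y * g y) x = f x • gradient g x + g x • gradient f x := by
  unfold gradient
  rw [fderiv_fun_mul (hf.differentiable (by simp) x) (hg.differentiable (by simp) x), map_add,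
    map_smul, map_smul]

theorem gradient_eq_zero_of_notMem_tsupport {f : Rd d → ℝ} {x : Rd d} (hx : x ∉ tsupport f) :
    gradient f x = 0 := by
  rw [← norm_eq_zero, norm_gradient_eq, norm_eq_zero]
  by_contra h
  exact hx (support_fderiv_subset ℝ h)

theorem exists_mem_testPairs {U : Set (Rd d)} {φ : Rd d → ℝ} (hφ : ContDiff ℝ ∞ φ)
    (hc : HasCompactSupport φ) (hU : tsupport φ ⊆ U) :
    ∃ p ∈ testPairs U, p.fst =ᵐ[volume] φ ∧ p.snd =ᵐ[volume] fun x => gradient φ x := by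
  have h1 : MemLp φ 2 (volume : Measure (Rd d)) := hφ.continuous.memLp_of_hasCompactSupport hc
  have h2 : MemLp (fun x => gradient φ x) 2 (volume : Measure (Rd d)) :=
    (continuous_gradient hφ).memLp_of_hasCompactSupport (hasCompactSupport_gradient hc)
  exact ⟨WithLp.toLp 2 (h1.toLp, h2.toLp), ⟨φ, hφ, hc, hU, h1.coeFn_toLp, h2.coeFn_toLp⟩,
    h1.coeFn_toLp, h2.coeFn_toLp⟩

/-- Test pairs already form a subspace, so H¹₀ is their plain closure. This gives `H10_induction`: a
closed property need only be checked on smooth functions. -/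
theorem span_testPairs (U : Set (Rd d)) :
    (Submodule.span ℝ (testPairs U) : Set (L2Pair d)) = testPairs U := by
  let V : Submodule ℝ (L2Pair d) :=
    { carrier := testPairs U
      zero_mem' := ⟨fun _ => 0, contDiff_const, HasCompactSupport.zero, by simp [tsupport],
        Lp.coeFn_zero _ _ _, by
          refine (Lp.coeFn_zero _ _ _).trans (ae_of_all _ fun x => ?_)
          simp [gradient]⟩
      add_mem' := by
        rintro p q ⟨f, hf, hfc, hfU, hf1, hf2⟩ ⟨g, hg, hgc, hgU, hg1, hg2⟩
        refine ⟨fun x => f x + g x, hf.add hg, hfc.add hgc,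
          (tsupport_add f g).trans (Set.union_subset hfU hgU), ?_, ?_⟩
        · exact (Lp.coeFn_add p.fst q.fst).trans (hf1.add hg1)
        · filter_upwards [Lp.coeFn_add p.snd q.snd, hf2, hg2] with x h1 h2 h3
          rw [gradient_add_apply hf hg, ← h2, ← h3]
          exact h1
      smul_mem' := by
        rintro c p ⟨f, hf, hfc, hfU, hf1, hf2⟩
        refine ⟨fun x => c * f x, contDiff_const.mul hf, hfc.mul_left,
          (tsupport_mul_subset_right (f := fun _ => c) (g := f)).trans hfU, ?_, ?_⟩
        · filter_upwards [Lp.coeFn_smul c p.fst, hf1] with x h1 h2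
          rw [← h2]
          exact h1
        · filter_upwards [Lp.coeFn_smul c p.snd, hf2] with x h1 h2
          rw [gradient_const_mul_apply hf, ← h2]
          exact h1 }
  exact congrArg (SetLike.coe) (Submodule.span_eq V)

theorem mem_H10_iff {U : Set (Rd d)} {v : L2Pair d} : v ∈ H10 U ↔ v ∈ closure (testPairs U) := by
  rw [H10, ← SetLike.mem_coe, Submodule.topologicalClosure_coe, span_testPairs]

theorem mem_H10_of_mem_testPairs {U : Set (Rd d)} {v : L2Pair d} (hv : v ∈ testPairs U) :
    v ∈ H10 U := mem_H10_iff.2 (subset_closure hv)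

theorem H10_induction {U : Set (Rd d)} {P : L2Pair d → Prop} (hP : IsClosed {v | P v})
    (h : ∀ v ∈ testPairs U, P v) {v : L2Pair d} (hv : v ∈ H10 U) : P v :=
  closure_minimal (show testPairs U ⊆ {v | P v} from h) hP (mem_H10_iff.1 hv)

theorem H10_mono {U U' : Set (Rd d)} (h : U ⊆ U') : H10 U ≤ H10 U' := by
  refine Submodule.topologicalClosure_mono (Submodule.span_mono ?_)
  rintro p ⟨f, hf, hfc, hfU, hf1, hf2⟩
  exact ⟨f, hf, hfc, hfU.trans h, hf1, hf2⟩

theorem norm_sq_Lp_eq {E : Type*} [NormedAddCommGroup E] [InnerProductSpace ℝ E]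
    {μ : Measure (Rd d)} (f : Lp E 2 μ) : ‖f‖ ^ 2 = ∫ x, ‖f x‖ ^ 2 ∂μ := by
  rw [← real_inner_self_eq_norm_sq, L2.inner_def]
  simp

theorem continuous_setIntegral_norm_sq {E : Type*} [NormedAddCommGroup E] [InnerProductSpace ℝ E]
    (S : Set (Rd d)) :
    Continuous fun f : Lp E 2 (volume : Measure (Rd d)) => ∫ x in S, ‖f x‖ ^ 2 := by
  have h : ∀ f : Lp E 2 (volume : Measure (Rd d)),
      ∫ x in S, ‖f x‖ ^ 2 = ‖LpToLpRestrictCLM (Rd d) E ℝ volume 2 S f‖ ^ 2 := fun f => by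
    rw [norm_sq_Lp_eq]
    refine integral_congr_ae ?_
    filter_upwards [LpToLpRestrictCLM_coeFn ℝ S f] with x hx
    rw [hx]
  simp_rw [h]
  fun_prop

theorem continuous_setIntegral_Lp_two {S : Set (Rd d)} (hS : volume S ≠ ⊤) :
    Continuous fun f : Lp ℝ 2 (volume : Measure (Rd d)) => ∫ x in S, f x := by
  have : IsFiniteMeasure (volume.restrict S) := ⟨by simpa using hS.lt_top⟩
  have h : ∀ f : Lp ℝ 2 (volume : Measure (Rd d)), ∫ x in S, f x =
      inner ℝ (Lp.const 2 (volume.restrict S) (1 : ℝ))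
        (LpToLpRestrictCLM (Rd d) ℝ ℝ volume 2 S f) := fun f => by
    rw [L2.inner_def]
    refine integral_congr_ae ?_
    filter_upwards [LpToLpRestrictCLM_coeFn ℝ S f,
      Lp.coeFn_const (p := 2) (μ := volume.restrict S) (1 : ℝ)] with x hx hx2
    rw [hx, hx2]
    simp
  simp_rw [h]
  fun_prop

theorem continuous_fst : Continuous fun v : L2Pair d => v.fst := WithLp.continuous_fst 2 _ _

theorem continuous_snd : Continuous fun v : L2Pair d => v.snd := WithLp.continuous_snd 2 _ _

theorem integrable_norm_sq_Lp {E : Type*} [NormedAddCommGroup E] {μ : Measure (Rd d)}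
    (f : Lp E 2 μ) : Integrable (fun x => ‖f x‖ ^ 2) μ :=
  (memLp_two_iff_integrable_sq_norm (Lp.memLp f).1).1 (Lp.memLp f)

/-- Vanishing on S is the zero set of the continuous functional f ↦ ∫_S ‖f‖². -/
theorem isClosed_ae_eq_zero {E : Type*} [NormedAddCommGroup E] [InnerProductSpace ℝ E]
    {S : Set (Rd d)} (hS : MeasurableSet S) :
    IsClosed {f : Lp E 2 (volume : Measure (Rd d)) | ∀ᵐ x, x ∈ S → f x = 0} := by
  have h : {f : Lp E 2 (volume : Measure (Rd d)) | ∀ᵐ x, x ∈ S → f x = 0} =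
      {f | ∫ x in S, ‖f x‖ ^ 2 = 0} := by
    ext f
    rw [Set.mem_ofPred_eq, Set.mem_ofPred_eq, integral_eq_zero_iff_of_nonneg (fun x => by positivity)
      (integrable_norm_sq_Lp f).integrableOn, ← ae_restrict_iff' hS]
    refine Filter.eventually_congr (ae_of_all _ fun x => ?_)
    simp
  rw [h]
  exact isClosed_eq (continuous_setIntegral_norm_sq S) continuous_const

theorem fst_ae_eq_zero_of_mem_H10 {U : Set (Rd d)} (hU : MeasurableSet U) {v : L2Pair d}
    (hv : v ∈ H10 U) : ∀ᵐ x, x ∈ Uᶜ → v.fst x = 0 := by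
  refine H10_induction (P := fun v => ∀ᵐ x, x ∈ Uᶜ → v.fst x = 0)
    ((isClosed_ae_eq_zero hU.compl).preimage continuous_fst) ?_ hv
  rintro p ⟨φ, -, -, hφU, h1, -⟩
  filter_upwards [h1] with x hx hxU
  rw [hx]
  by_contra h
  exact hxU (hφU (subset_tsupport φ h))

theorem snd_ae_eq_zero_of_mem_H10 {U : Set (Rd d)} (hU : MeasurableSet U) {v : L2Pair d}
    (hv : v ∈ H10 U) : ∀ᵐ x, x ∈ Uᶜ → v.snd x = 0 := by
  refine H10_induction (P := fun v => ∀ᵐ x, x ∈ Uᶜ → v.snd x = 0)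
    ((isClosed_ae_eq_zero hU.compl).preimage continuous_snd) ?_ hv
  rintro p ⟨φ, -, -, hφU, -, h2⟩
  filter_upwards [h2] with x hx hxU
  rw [hx]
  exact gradient_eq_zero_of_notMem_tsupport fun h => hxU (hφU h)

/-- Both sides are continuous for the H¹ norm, so smooth functions suffice. A convex set has null
frontier, so K need not be open. -/
theorem poincare_H10 {U K : Set (Rd d)} (hK : Convex ℝ K) (hKb : Bornology.IsBounded K)
    (hKn : (interior K).Nonempty) {D : ℝ} (hD : 0 < D) (hKD : ∀ x ∈ K, ∀ y ∈ K, dist x y ≤ D)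
    {v : L2Pair d} (hv : v ∈ H10 U) :
    ∫ x in K, ‖v.fst x‖ ^ 2 ≤ 25 / 36 * D ^ 2 * (∫ x in K, ‖v.snd x‖ ^ 2) +
      (∫ x in K, v.fst x) ^ 2 / volume.real K := by
  refine H10_induction (P := fun v : L2Pair d => ∫ x in K, ‖v.fst x‖ ^ 2 ≤
    25 / 36 * D ^ 2 * (∫ x in K, ‖v.snd x‖ ^ 2) + (∫ x in K, v.fst x) ^ 2 / volume.real K) ?_ ?_ hv
  · have h1 := (continuous_setIntegral_norm_sq (E := ℝ) K).comp (continuous_fst (d := d))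
    have h2 := (continuous_setIntegral_norm_sq (E := Rd d) K).comp (continuous_snd (d := d))
    have h3 := (continuous_setIntegral_Lp_two hKb.measure_lt_top.ne).comp (continuous_fst (d := d))
    exact isClosed_le h1 ((h2.const_mul _).add ((h3.pow 2).div_const _))
  · rintro p ⟨φ, hφ, hφc, -, h1, h2⟩
    have hae : interior K =ᵐ[volume] K :=
      interior_ae_eq_of_null_frontier (hK.addHaar_frontier volume)
    have := poincare_convex_of_isOpen isOpen_interior hK.interior (hKb.subset interior_subset) hKn hD
      (fun x hx y hy => hKD x (interior_subset hx) y (interior_subset hy)) hφ hφc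
    rw [Measure.restrict_congr_set hae, measureReal_congr hae] at this
    have e1 : ∫ x in K, ‖p.fst x‖ ^ 2 = ∫ x in K, φ x ^ 2 :=
      integral_congr_ae (ae_restrict_of_ae (by filter_upwards [h1] with x hx; simp [hx]))
    have e2 : ∫ x in K, ‖p.snd x‖ ^ 2 = ∫ x in K, ‖gradient φ x‖ ^ 2 :=
      integral_congr_ae (ae_restrict_of_ae (by filter_upwards [h2] with x hx; rw [hx]))
    have e3 : ∫ x in K, p.fst x = ∫ x in K, φ x := integral_congr_ae (ae_restrict_of_ae h1)
    rw [e1, e2, e3]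
    exact this

/-- Let g be the first coordinate, shifted to vanish at a point of U, so that |g| ≤ 1 on U.
Integrating φ² times the derivative 1 of g by parts gives -2∫ φ ∂φ g, and Young's inequality absorbs
half of ∫ φ². -/
theorem friedrichs_of_smooth (hd : 1 ≤ d) {U : Set (Rd d)} (hU : ∀ x ∈ U, ∀ y ∈ U, dist x y ≤ 1)
    {φ : Rd d → ℝ} (hφ : ContDiff ℝ ∞ φ) (hc : HasCompactSupport φ) (hφU : tsupport φ ⊆ U) :
    ∫ x, φ x ^ 2 ≤ 4 * ∫ x, ‖gradient φ x‖ ^ 2 := by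
  rcases U.eq_empty_or_nonempty with rfl | ⟨x₀, hx₀⟩
  · have : φ = 0 := tsupport_eq_empty_iff.1 (Set.subset_empty_iff.1 hφU)
    simp only [this, Pi.zero_apply, ne_eq, OfNat.ofNat_ne_zero, not_false_eq_true, zero_pow,
      integral_zero]
    exact mul_nonneg (by norm_num) (integral_nonneg fun x => by positivity)
  set e : Rd d := EuclideanSpace.single (⟨0, hd⟩ : Fin d) 1
  have he : ‖e‖ = 1 := by simp [e]
  set g : Rd d → ℝ := fun x => innerSL ℝ e x - innerSL ℝ e x₀
  have hgF : ∀ x, HasFDerivAt g (innerSL ℝ e) x := fun x =>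
    ((innerSL ℝ e).hasFDerivAt (x := x)).sub_const _
  have hg : ∀ x, fderiv ℝ g x e = 1 := fun x => by
    rw [(hgF x).fderiv, innerSL_apply_apply, real_inner_self_eq_norm_sq, he, one_pow]
  have hgd : Differentiable ℝ g := fun x => (hgF x).differentiableAt
  have hgc : Continuous g := hgd.continuous
  have hg1 : ∀ x ∈ U, |g x| ≤ 1 := fun x hx => by
    have h1 : g x = inner ℝ e (x - x₀) := by
      simp only [g, innerSL_apply_apply, inner_sub_right]
    have h2 := abs_real_inner_le_norm e (x - x₀)
    rw [he, one_mul, ← dist_eq_norm] at h2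
    rw [h1]
    exact h2.trans (hU x hx x₀ hx₀)
  have hφ2 : ∀ x, fderiv ℝ (fun y => φ y ^ 2) x e = 2 * φ x * fderiv ℝ φ x e := fun x => by
    rw [fderiv_fun_pow 2 (hφ.differentiable (by simp) x)]
    simp
  have hfc : Continuous fun x => fderiv ℝ φ x e :=
    (hφ.continuous_fderiv (by simp)).clm_apply continuous_const
  have hint : ∀ {f : Rd d → ℝ}, Continuous f → Integrable fun x => φ x * f x := fun hf =>
    (hφ.continuous.mul hf).integrable_of_hasCompactSupport hc.mul_right
  have hφi : Integrable fun x => φ x ^ 2 := by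
    simpa only [sq] using hint hφ.continuous
  have hGi : Integrable fun x => ‖gradient φ x‖ ^ 2 := by
    have h := (continuous_gradient hφ).memLp_of_hasCompactSupport (p := 2) (μ := volume)
      (hasCompactSupport_gradient hc)
    exact (memLp_two_iff_integrable_sq_norm h.1).1 h
  have i1 : Integrable fun x => 2 * φ x * fderiv ℝ φ x e * g x := by
    refine (hint ((continuous_const (y := (2 : ℝ)).mul hfc).mul hgc)).congr
      (ae_of_all _ fun x => ?_)
    simp only [Pi.mul_apply]
    ring
  have i2 : Integrable fun x => φ x ^ 2 * g x := by
    refine (hint (hφ.continuous.mul hgc)).congr (ae_of_all _ fun x => ?_)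
    simp only [Pi.mul_apply]
    ring
  have hd2 : Differentiable ℝ fun y => φ y ^ 2 := (hφ.differentiable (by simp)).pow 2
  have key : ∫ x, φ x ^ 2 * fderiv ℝ g x e = -∫ x, fderiv ℝ (fun y => φ y ^ 2) x e * g x :=
    integral_mul_fderiv_eq_neg_fderiv_mul_of_integrable (by simpa only [hφ2] using i1)
      (by simpa only [hg, mul_one] using hφi) i2 (fun x _ => hd2 x)
      (fun x _ => hgd x)
  simp only [hg, mul_one, hφ2] at key
  rw [← integral_neg] at key
  have hle : ∫ x, φ x ^ 2 ≤ ∫ x, (1 / 2 * φ x ^ 2 + 2 * ‖gradient φ x‖ ^ 2) := by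
    rw [key]
    refine integral_mono i1.neg ((hφi.const_mul _).add (hGi.const_mul _)) fun x => ?_
    show -(2 * φ x * fderiv ℝ φ x e * g x) ≤ 1 / 2 * φ x ^ 2 + 2 * ‖gradient φ x‖ ^ 2
    by_cases hx : x ∈ U
    · have h1 : |fderiv ℝ φ x e| ≤ ‖gradient φ x‖ := by
        rw [norm_gradient_eq]
        simpa [he] using (fderiv ℝ φ x).le_opNorm e
      have h2 : |fderiv ℝ φ x e * g x| ≤ ‖gradient φ x‖ := by
        rw [abs_mul]
        exact (mul_le_of_le_one_right (abs_nonneg _) (hg1 x hx)).trans h1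
      have h3 : (fderiv ℝ φ x e * g x) ^ 2 ≤ ‖gradient φ x‖ ^ 2 := by
        rw [← sq_abs]; gcongr
      nlinarith [sq_nonneg (φ x + 2 * (fderiv ℝ φ x e * g x))]
    · have h0 : φ x = 0 := by
        by_contra h
        exact hx (hφU (subset_tsupport φ h))
      rw [h0]
      nlinarith [sq_nonneg ‖gradient φ x‖]
  rw [integral_add (hφi.const_mul _) (hGi.const_mul _), integral_const_mul, integral_const_mul]
    at hle
  linarith

theorem friedrichs_H10 (hd : 1 ≤ d) {U : Set (Rd d)} (hU : ∀ x ∈ U, ∀ y ∈ U, dist x y ≤ 1)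
    {v : L2Pair d} (hv : v ∈ H10 U) : ‖v.fst‖ ≤ 2 * ‖v.snd‖ := by
  refine H10_induction (P := fun v : L2Pair d => ‖v.fst‖ ≤ 2 * ‖v.snd‖) ?_ ?_ hv
  · exact isClosed_le (continuous_fst.norm) (continuous_snd.norm.const_mul 2)
  · rintro p ⟨φ, hφ, hφc, hφU, h1, h2⟩
    have := friedrichs_of_smooth hd hU hφ hφc hφU
    refine le_of_sq_le_sq ?_ (by positivity)
    rw [mul_pow, norm_sq_Lp_eq, norm_sq_Lp_eq]
    have e1 : ∫ x, ‖p.fst x‖ ^ 2 = ∫ x, φ x ^ 2 :=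
      integral_congr_ae (by filter_upwards [h1] with x hx; simp [hx])
    have e2 : ∫ x, ‖p.snd x‖ ^ 2 = ∫ x, ‖gradient φ x‖ ^ 2 :=
      integral_congr_ae (by filter_upwards [h2] with x hx; rw [hx])
    rw [e1, e2]
    linarith

/-- Multiplication by a smooth function maps `H¹₀(U)` to `H¹₀(U')` if `U'` contains the part of `U`
in which the function does not vanish. -/
theorem exists_mul_mem_H10 {U U' : Set (Rd d)} (hU : MeasurableSet U) (hUb : Bornology.IsBounded U)
    {η : Rd d → ℝ} (hη : ContDiff ℝ ∞ η) (hU' : U ∩ tsupport η ⊆ U') {v : L2Pair d}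
    (hv : v ∈ H10 U) :
    ∃ w ∈ H10 U', (w.fst =ᵐ[volume] fun x => η x * v.fst x) ∧
      w.snd =ᵐ[volume] fun x => η x • v.snd x + v.fst x • gradient η x := by
  have hgc := continuous_gradient hη
  -- The function η may be unbounded, but only its values on the bounded set U matter for elements
  -- of H¹₀(U). For the same reason the product map is built on H¹₀(U) alone.
  obtain ⟨C, hC⟩ := (hUb.isCompact_closure.image hη.continuous).isBounded.exists_norm_le
  obtain ⟨C', hC'⟩ := (hUb.isCompact_closure.image hgc).isBounded.exists_norm_le
  set M := max 0 (max C C')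
  have hM0 : 0 ≤ M := le_max_left _ _
  have hM1 : ∀ x ∈ U, ‖η x‖ ≤ M := fun x hx =>
    (hC _ ⟨x, subset_closure hx, rfl⟩).trans ((le_max_left _ _).trans (le_max_right _ _))
  have hM2 : ∀ x ∈ U, ‖gradient η x‖ ≤ M := fun x hx =>
    (hC' _ ⟨x, subset_closure hx, rfl⟩).trans ((le_max_right _ _).trans (le_max_right _ _))
  have b1 : ∀ u ∈ H10 U, ∀ᵐ x, ‖η x * u.fst x‖ ≤ M * ‖u.fst x‖ := fun u hu => by
    filter_upwards [fst_ae_eq_zero_of_mem_H10 hU hu] with x hx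
    by_cases hxU : x ∈ U
    · rw [norm_mul]; exact mul_le_mul_of_nonneg_right (hM1 x hxU) (norm_nonneg _)
    · simp [hx hxU]
  have b2 : ∀ u ∈ H10 U, ∀ᵐ x, ‖η x • u.snd x‖ ≤ M * ‖u.snd x‖ := fun u hu => by
    filter_upwards [snd_ae_eq_zero_of_mem_H10 hU hu] with x hx
    by_cases hxU : x ∈ U
    · rw [norm_smul]; exact mul_le_mul_of_nonneg_right (hM1 x hxU) (norm_nonneg _)
    · simp [hx hxU]
  have b3 : ∀ u ∈ H10 U, ∀ᵐ x, ‖u.fst x • gradient η x‖ ≤ M * ‖u.fst x‖ := fun u hu => by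
    filter_upwards [fst_ae_eq_zero_of_mem_H10 hU hu] with x hx
    by_cases hxU : x ∈ U
    · rw [norm_smul, mul_comm]; exact mul_le_mul_of_nonneg_right (hM2 x hxU) (norm_nonneg _)
    · simp [hx hxU]
  have m1 : ∀ u ∈ H10 U, MemLp (fun x => η x * u.fst x) 2 volume := fun u hu =>
    (Lp.memLp u.fst).of_le_mul
      (hη.continuous.aestronglyMeasurable.mul (Lp.memLp u.fst).1) (b1 u hu)
  have m2 : ∀ u ∈ H10 U, MemLp (fun x => η x • u.snd x) 2 volume := fun u hu =>
    (Lp.memLp u.snd).of_le_mul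
      (hη.continuous.aestronglyMeasurable.smul (Lp.memLp u.snd).1) (b2 u hu)
  have m3 : ∀ u ∈ H10 U, MemLp (fun x => u.fst x • gradient η x) 2 volume := fun u hu =>
    (Lp.memLp u.fst).of_le_mul
      ((Lp.memLp u.fst).1.smul hgc.aestronglyMeasurable) (b3 u hu)
  let T1 : H10 U → Lp ℝ 2 (volume : Measure (Rd d)) := fun u => (m1 u u.2).toLp
  let T2 : H10 U → Lp (Rd d) 2 (volume : Measure (Rd d)) := fun u => (m2 u u.2).toLp
  let T3 : H10 U → Lp (Rd d) 2 (volume : Measure (Rd d)) := fun u => (m3 u u.2).toLp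
  have lip : ∀ {E : Type} [NormedAddCommGroup E] (T : H10 U → Lp E 2 (volume : Measure (Rd d))),
      (∀ u u', ‖T u - T u'‖ ≤ M * ‖u - u'‖) → Continuous T := fun T hT =>
    (LipschitzWith.of_dist_le_mul (K := ⟨M, hM0⟩) fun u u' => by
      rw [dist_eq_norm, dist_eq_norm]; exact hT u u').continuous
  have nf : ∀ u : L2Pair d, ‖u.fst‖ ≤ ‖u‖ := fun u => WithLp.norm_fst_le _ _
  have ns : ∀ u : L2Pair d, ‖u.snd‖ ≤ ‖u‖ := fun u => WithLp.norm_snd_le _ _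
  have c1 : Continuous T1 := lip _ fun u u' => by
    refine le_trans ?_ (mul_le_mul_of_nonneg_left (nf (u - u' : H10 U)) hM0)
    refine Lp.norm_le_mul_norm_of_ae_le_mul ?_
    filter_upwards [b1 _ (u - u').2, Lp.coeFn_sub (T1 u) (T1 u'), (m1 u u.2).coeFn_toLp,
      (m1 u' u'.2).coeFn_toLp, Lp.coeFn_sub (u : L2Pair d).fst (u' : L2Pair d).fst]
      with x h1 h2 h3 h4 h5
    have h5 : ((u - u' : H10 U) : L2Pair d).fst x =
      (u : L2Pair d).fst x - (u' : L2Pair d).fst x := h5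
    rw [h2, Pi.sub_apply, h3, h4, ← mul_sub, ← h5]
    exact h1
  have c2 : Continuous T2 := lip _ fun u u' => by
    refine le_trans ?_ (mul_le_mul_of_nonneg_left (ns (u - u' : H10 U)) hM0)
    refine Lp.norm_le_mul_norm_of_ae_le_mul ?_
    filter_upwards [b2 _ (u - u').2, Lp.coeFn_sub (T2 u) (T2 u'), (m2 u u.2).coeFn_toLp,
      (m2 u' u'.2).coeFn_toLp, Lp.coeFn_sub (u : L2Pair d).snd (u' : L2Pair d).snd]
      with x h1 h2 h3 h4 h5
    have h5 : ((u - u' : H10 U) : L2Pair d).snd x =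
      (u : L2Pair d).snd x - (u' : L2Pair d).snd x := h5
    rw [h2, Pi.sub_apply, h3, h4, ← smul_sub, ← h5]
    exact h1
  have c3 : Continuous T3 := lip _ fun u u' => by
    refine le_trans ?_ (mul_le_mul_of_nonneg_left (nf (u - u' : H10 U)) hM0)
    refine Lp.norm_le_mul_norm_of_ae_le_mul ?_
    filter_upwards [b3 _ (u - u').2, Lp.coeFn_sub (T3 u) (T3 u'), (m3 u u.2).coeFn_toLp,
      (m3 u' u'.2).coeFn_toLp, Lp.coeFn_sub (u : L2Pair d).fst (u' : L2Pair d).fst]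
      with x h1 h2 h3 h4 h5
    have h5 : ((u - u' : H10 U) : L2Pair d).fst x =
      (u : L2Pair d).fst x - (u' : L2Pair d).fst x := h5
    rw [h2, Pi.sub_apply, h3, h4, ← sub_smul, ← h5]
    exact h1
  let T : H10 U → L2Pair d := fun u => WithLp.toLp 2 (T1 u, T2 u + T3 u)
  have cT : Continuous T := (WithLp.prod_continuous_toLp 2 _ _).comp (c1.prodMk (c2.add c3))
  have hsndT : ∀ u : H10 U, (T2 u + T3 u : Lp (Rd d) 2 (volume : Measure (Rd d))) =ᵐ[volume]
      fun x => η x • (u : L2Pair d).snd x + (u : L2Pair d).fst x • gradient η x := fun u => by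
    filter_upwards [Lp.coeFn_add (T2 u) (T3 u), (m2 u u.2).coeFn_toLp, (m3 u u.2).coeFn_toLp]
      with x h1 h2 h3
    rw [h1, Pi.add_apply, h2, h3]
  refine ⟨T ⟨v, hv⟩, ?_, (m1 v hv).coeFn_toLp, hsndT ⟨v, hv⟩⟩
  -- The product map is continuous and, by the Leibniz rule, sends test pairs of U to test pairs of
  -- U'; density concludes.
  have hcl : IsClosed {u : H10 U | T u ∈ H10 U'} :=
    (Submodule.isClosed_topologicalClosure _).preimage cT
  have hdense : ∀ u : H10 U, u ∈ closure {u : H10 U | (u : L2Pair d) ∈ testPairs U} := fun u => by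
    rw [closure_subtype]
    have : ((↑) : H10 U → L2Pair d) '' {u : H10 U | (u : L2Pair d) ∈ testPairs U} =
        testPairs U := by
      ext p
      exact ⟨by rintro ⟨q, hq, rfl⟩; exact hq,
        fun hp => ⟨⟨p, mem_H10_of_mem_testPairs hp⟩, hp, rfl⟩⟩
    rw [this]
    exact mem_H10_iff.1 u.2
  refine closure_minimal (s := {u : H10 U | (u : L2Pair d) ∈ testPairs U}) ?_ hcl (hdense ⟨v, hv⟩)
  rintro ⟨p, hp⟩ ⟨φ, hφ, hφc, hφU, h1, h2⟩
  refine mem_H10_of_mem_testPairs ⟨fun x => η x * φ x, hη.mul hφ, hφc.mul_left, ?_, ?_, ?_⟩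
  · exact fun x hx => hU' ⟨hφU (tsupport_mul_subset_right hx), tsupport_mul_subset_left hx⟩
  · filter_upwards [(m1 p hp).coeFn_toLp, h1] with x hx hx1
    rw [← hx1]
    exact hx
  · filter_upwards [hsndT ⟨p, hp⟩, h1, h2] with x hx hx1 hx2
    rw [gradient_mul_apply hη hφ, ← hx1, ← hx2]
    exact hx

end

/-! ### The energy product: pointwise bounds, integrability, Cauchy-Schwarz, comparison with the
gradient norm. -/

section

variable {d : ℕ}

section Pointwise

variable {A : Matrix (Fin d) (Fin d) ℝ} {lmin lmax : ℝ}

theorem dotProduct_mulVec_comm (hA : A.IsSymm) (v w : Fin d → ℝ) :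
    v ⬝ᵥ (A *ᵥ w) = w ⬝ᵥ (A *ᵥ v) := by
  rw [dotProduct_mulVec, ← mulVec_transpose, hA.eq, dotProduct_comm]

theorem dotProduct_self_eq_norm_sq (v : Rd d) : v.ofLp ⬝ᵥ v.ofLp = ‖v‖ ^ 2 := by
  rw [EuclideanSpace.real_norm_sq_eq]
  simp [dotProduct, sq]

theorem dotProduct_mulVec_sq_le (hA : A.IsSymm) (hp : ∀ v, 0 ≤ v ⬝ᵥ (A *ᵥ v))
    (v w : Fin d → ℝ) : (v ⬝ᵥ (A *ᵥ w)) ^ 2 ≤ (v ⬝ᵥ (A *ᵥ v)) * (w ⬝ᵥ (A *ᵥ w)) := by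
  have := (Matrix.toBilin' A).apply_mul_apply_le_of_forall_zero_le
    (fun x => by rw [Matrix.toBilin'_apply']; exact hp x) v w
  simp only [Matrix.toBilin'_apply'] at this
  rwa [dotProduct_mulVec_comm hA w v, ← sq] at this

/-- Cauchy-Schwarz followed by Young. The parameter t is kept free so that the cutoff estimates on
cells can balance the two terms. -/
theorem abs_dotProduct_mulVec_le (hA : A.IsSymm) (hp : ∀ v, 0 ≤ v ⬝ᵥ (A *ᵥ v)) {t : ℝ} (ht : 0 < t)
    (v w : Fin d → ℝ) :
    |v ⬝ᵥ (A *ᵥ w)| ≤ t / 2 * (v ⬝ᵥ (A *ᵥ v)) + 1 / (2 * t) * (w ⬝ᵥ (A *ᵥ w)) := by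
  have h := dotProduct_mulVec_sq_le hA hp v w
  have h1 := hp v
  have h2 := hp w
  refine abs_le_of_sq_le_sq ?_ (by positivity)
  refine h.trans ?_
  have e : (t / 2 * (v ⬝ᵥ (A *ᵥ v)) + 1 / (2 * t) * (w ⬝ᵥ (A *ᵥ w))) ^ 2 -
      (v ⬝ᵥ (A *ᵥ v)) * (w ⬝ᵥ (A *ᵥ w)) =
      (t / 2 * (v ⬝ᵥ (A *ᵥ v)) - 1 / (2 * t) * (w ⬝ᵥ (A *ᵥ w))) ^ 2 := by
    field_simp
    ring
  nlinarith [sq_nonneg (t / 2 * (v ⬝ᵥ (A *ᵥ v)) - 1 / (2 * t) * (w ⬝ᵥ (A *ᵥ w)))]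

theorem abs_dotProduct_mulVec_le_norm (hA : A.IsSymm) (hp : ∀ v, 0 ≤ v ⬝ᵥ (A *ᵥ v))
    (hu : ∀ v, v ⬝ᵥ (A *ᵥ v) ≤ lmax * (v ⬝ᵥ v)) (hl : 0 ≤ lmax) (v w : Rd d) :
    |v.ofLp ⬝ᵥ (A *ᵥ w.ofLp)| ≤ lmax * (‖v‖ * ‖w‖) := by
  refine abs_le_of_sq_le_sq ?_ (by positivity)
  refine (dotProduct_mulVec_sq_le hA hp v.ofLp w.ofLp).trans ?_
  have h1 := hu v.ofLp
  have h2 := hu w.ofLp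
  rw [dotProduct_self_eq_norm_sq] at h1 h2
  calc _ ≤ (lmax * ‖v‖ ^ 2) * (lmax * ‖w‖ ^ 2) := mul_le_mul h1 h2 (hp _) (by positivity)
    _ = _ := by ring

end Pointwise

variable {Ω S : Set (Rd d)} {a : Rd d → Matrix (Fin d) (Fin d) ℝ} {lmin lmax : ℝ}

theorem IsElliptic.ae_nonneg (ha : IsElliptic Ω a lmin lmax) :
    ∀ᵐ x ∂(volume.restrict Ω), ∀ v : Fin d → ℝ, 0 ≤ v ⬝ᵥ (a x *ᵥ v) := by
  filter_upwards [ha.lower] with x hx v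
  refine le_trans (mul_nonneg ha.pos.le ?_) (hx v)
  exact Finset.sum_nonneg fun i _ => mul_self_nonneg _

theorem aestronglyMeasurable_form (ha : IsElliptic Ω a lmin lmax) {F G : Rd d → Rd d}
    (hF : AEStronglyMeasurable F (volume.restrict Ω))
    (hG : AEStronglyMeasurable G (volume.restrict Ω)) :
    AEStronglyMeasurable (fun x => (F x).ofLp ⬝ᵥ (a x *ᵥ (G x).ofLp)) (volume.restrict Ω) := by
  have hcoord : ∀ {F : Rd d → Rd d}, AEStronglyMeasurable F (volume.restrict Ω) → ∀ k,
      AEStronglyMeasurable (fun x => (F x).ofLp k) (volume.restrict Ω) := fun hF k =>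
    (EuclideanSpace.proj (𝕜 := ℝ) k).continuous.comp_aestronglyMeasurable hF
  simp only [dotProduct, mulVec]
  refine Finset.aestronglyMeasurable_fun_sum _ fun k _ => (hcoord hF k).mul ?_
  exact Finset.aestronglyMeasurable_fun_sum _ fun l _ => (ha.measurable k l).mul (hcoord hG l)

theorem integrableOn_form (ha : IsElliptic Ω a lmin lmax) (hl : 0 ≤ lmax) {F G : Rd d → Rd d}
    (hF : MemLp F 2 (volume.restrict Ω)) (hG : MemLp G 2 (volume.restrict Ω)) :
    IntegrableOn (fun x => (F x).ofLp ⬝ᵥ (a x *ᵥ (G x).ofLp)) Ω := by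
  have hFG : Integrable (fun x => lmax * (‖F x‖ * ‖G x‖)) (volume.restrict Ω) :=
    (hF.norm.integrable_mul hG.norm).const_mul lmax
  refine hFG.mono' (aestronglyMeasurable_form ha hF.1 hG.1) ?_
  filter_upwards [ha.symm, ha.upper, ha.ae_nonneg] with x h1 h2 h3
  exact abs_dotProduct_mulVec_le_norm h1 h3 h2 hl _ _

theorem integrableOn_energy (ha : IsElliptic Ω a lmin lmax) (hl : 0 ≤ lmax) (v w : L2Pair d) :
    IntegrableOn (fun x => (v.snd x).ofLp ⬝ᵥ (a x *ᵥ (w.snd x).ofLp)) Ω :=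
  integrableOn_form ha hl ((Lp.memLp v.snd).restrict Ω) ((Lp.memLp w.snd).restrict Ω)

theorem snd_add_ae (v w : L2Pair d) : (v + w).snd =ᵐ[volume] fun x => v.snd x + w.snd x :=
  Lp.coeFn_add v.snd w.snd

theorem fst_add_ae (v w : L2Pair d) : (v + w).fst =ᵐ[volume] fun x => v.fst x + w.fst x :=
  Lp.coeFn_add v.fst w.fst

theorem snd_smul_ae (c : ℝ) (v : L2Pair d) : (c • v).snd =ᵐ[volume] fun x => c • v.snd x :=
  Lp.coeFn_smul c v.snd

theorem fst_smul_ae (c : ℝ) (v : L2Pair d) : (c • v).fst =ᵐ[volume] fun x => c * v.fst x :=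
  Lp.coeFn_smul c v.fst

theorem energyInner_comm (ha : IsElliptic Ω a lmin lmax) (hS : S ⊆ Ω) (v w : L2Pair d) :
    energyInner a S v w = energyInner a S w v := by
  refine integral_congr_ae ?_
  filter_upwards [ae_restrict_of_ae_restrict_of_subset hS ha.symm] with x hx
  exact dotProduct_mulVec_comm hx _ _

theorem energyInner_add_left (ha : IsElliptic Ω a lmin lmax) (hl : 0 ≤ lmax) (hS : S ⊆ Ω)
    (u v w : L2Pair d) :
    energyInner a S (u + v) w = energyInner a S u w + energyInner a S v w := by
  unfold energyInner
  rw [← integral_add ((integrableOn_energy ha hl u w).mono_set hS)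
    ((integrableOn_energy ha hl v w).mono_set hS)]
  refine integral_congr_ae (ae_restrict_of_ae ?_)
  filter_upwards [snd_add_ae u v] with x hx
  rw [hx, WithLp.ofLp_add, add_dotProduct]

theorem energyInner_smul_left (c : ℝ) (v w : L2Pair d) :
    energyInner a S (c • v) w = c * energyInner a S v w := by
  unfold energyInner
  rw [← integral_const_mul]
  refine integral_congr_ae (ae_restrict_of_ae ?_)
  filter_upwards [snd_smul_ae c v] with x hx
  rw [hx, WithLp.ofLp_smul, smul_dotProduct, smul_eq_mul]

theorem energyInner_smul_right (c : ℝ) (v w : L2Pair d) :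
    energyInner a S v (c • w) = c * energyInner a S v w := by
  unfold energyInner
  rw [← integral_const_mul]
  refine integral_congr_ae (ae_restrict_of_ae ?_)
  filter_upwards [snd_smul_ae c w] with x hx
  rw [hx, WithLp.ofLp_smul, mulVec_smul, dotProduct_smul, smul_eq_mul]

theorem energyInner_self_nonneg (ha : IsElliptic Ω a lmin lmax) (hS : S ⊆ Ω) (v : L2Pair d) :
    0 ≤ energyInner a S v v := by
  refine integral_nonneg_of_ae ?_
  filter_upwards [ae_restrict_of_ae_restrict_of_subset hS ha.ae_nonneg] with x hx
  exact hx _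

/-- The energy product as a bilinear form. -/
def energyForm (ha : IsElliptic Ω a lmin lmax) (hl : 0 ≤ lmax) (hS : S ⊆ Ω) :
    LinearMap.BilinForm ℝ (L2Pair d) :=
  LinearMap.mk₂ ℝ (energyInner a S) (energyInner_add_left ha hl hS)
    (fun c v w => energyInner_smul_left c v w)
    (fun u v w => by
      rw [energyInner_comm ha hS, energyInner_add_left ha hl hS, energyInner_comm ha hS v,
        energyInner_comm ha hS w])
    (fun c v w => energyInner_smul_right c v w)

theorem energyForm_apply (ha : IsElliptic Ω a lmin lmax) (hl : 0 ≤ lmax) (hS : S ⊆ Ω)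
    (v w : L2Pair d) : energyForm ha hl hS v w = energyInner a S v w := rfl

theorem energyInner_sq_le (ha : IsElliptic Ω a lmin lmax) (hl : 0 ≤ lmax) (hS : S ⊆ Ω)
    (v w : L2Pair d) :
    energyInner a S v w ^ 2 ≤ energyInner a S v v * energyInner a S w w := by
  have := (energyForm ha hl hS).apply_mul_apply_le_of_forall_zero_le
    (fun x => energyInner_self_nonneg ha hS x) v w
  rw [energyForm_apply, energyForm_apply, energyForm_apply, energyForm_apply,
    energyInner_comm ha hS w v, ← sq] at this
  exact this

theorem abs_energyInner_le (ha : IsElliptic Ω a lmin lmax) (hl : 0 ≤ lmax) (hS : S ⊆ Ω)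
    (v w : L2Pair d) : |energyInner a S v w| ≤ energyNorm a S v * energyNorm a S w := by
  rw [energyNorm, energyNorm, ← Real.sqrt_mul (energyInner_self_nonneg ha hS v)]
  exact Real.abs_le_sqrt (energyInner_sq_le ha hl hS v w)

theorem energyNorm_sq (ha : IsElliptic Ω a lmin lmax) (hS : S ⊆ Ω) (v : L2Pair d) :
    energyNorm a S v ^ 2 = energyInner a S v v :=
  Real.sq_sqrt (energyInner_self_nonneg ha hS v)

theorem energyNorm_nonneg (v : L2Pair d) : 0 ≤ energyNorm a S v := Real.sqrt_nonneg _

theorem energyInner_add_self (ha : IsElliptic Ω a lmin lmax) (hl : 0 ≤ lmax) (hS : S ⊆ Ω)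
    (v w : L2Pair d) : energyInner a S (v + w) (v + w) =
      energyInner a S v v + 2 * energyInner a S v w + energyInner a S w w := by
  have h : energyForm ha hl hS (v + w) (v + w) = energyForm ha hl hS v v +
      energyForm ha hl hS v w + (energyForm ha hl hS w v + energyForm ha hl hS w w) := by
    rw [LinearMap.map_add₂, map_add, map_add]
  simp only [energyForm_apply] at h
  rw [h, energyInner_comm ha hS w v]
  ring

theorem energyNorm_add_le (ha : IsElliptic Ω a lmin lmax) (hl : 0 ≤ lmax) (hS : S ⊆ Ω)
    (v w : L2Pair d) : energyNorm a S (v + w) ≤ energyNorm a S v + energyNorm a S w := by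
  have hv := energyNorm_nonneg (a := a) (S := S) v
  have hw := energyNorm_nonneg (a := a) (S := S) w
  refine le_of_sq_le_sq ?_ (by positivity)
  rw [energyNorm_sq ha hS, energyInner_add_self ha hl hS, add_sq, energyNorm_sq ha hS,
    energyNorm_sq ha hS]
  have := (le_abs_self _).trans (abs_energyInner_le ha hl hS v w)
  linarith

theorem energyNorm_smul (c : ℝ) (ha : IsElliptic Ω a lmin lmax) (hl : 0 ≤ lmax) (hS : S ⊆ Ω)
    (v : L2Pair d) : energyNorm a S (c • v) = |c| * energyNorm a S v := by
  have h : energyForm ha hl hS (c • v) (c • v) = c ^ 2 * energyForm ha hl hS v v := by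
    rw [LinearMap.map_smul₂, map_smul, smul_eq_mul, smul_eq_mul]; ring
  simp only [energyForm_apply] at h
  rw [energyNorm, h, Real.sqrt_mul (sq_nonneg c), Real.sqrt_sq_eq_abs]
  rfl

theorem energyNorm_sum_le {ι : Type*} (s : Finset ι) (ha : IsElliptic Ω a lmin lmax)
    (hl : 0 ≤ lmax) (hS : S ⊆ Ω) (v : ι → L2Pair d) :
    energyNorm a S (∑ i ∈ s, v i) ≤ ∑ i ∈ s, energyNorm a S (v i) := by
  classical
  induction s using Finset.induction_on with
  | empty =>
    have h : energyForm ha hl hS (0 : L2Pair d) 0 = 0 := by simp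
    rw [energyForm_apply] at h
    simp [energyNorm, h]
  | insert i s hi ih =>
    rw [Finset.sum_insert hi, Finset.sum_insert hi]
    exact (energyNorm_add_le ha hl hS _ _).trans (by gcongr)

theorem lmin_mul_le_energyInner (ha : IsElliptic Ω a lmin lmax) (hl : 0 ≤ lmax) (hS : S ⊆ Ω)
    (v : L2Pair d) : lmin * ∫ x in S, ‖v.snd x‖ ^ 2 ≤ energyInner a S v v := by
  rw [← integral_const_mul]
  refine integral_mono_ae ((integrable_norm_sq_Lp v.snd).integrableOn.const_mul _)
    ((integrableOn_energy ha hl v v).mono_set hS) ?_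
  filter_upwards [ae_restrict_of_ae_restrict_of_subset hS ha.lower] with x hx
  have := hx (v.snd x).ofLp
  rwa [dotProduct_self_eq_norm_sq] at this

theorem energyInner_le_lmax_mul (ha : IsElliptic Ω a lmin lmax) (hl : 0 ≤ lmax) (hS : S ⊆ Ω)
    (v : L2Pair d) : energyInner a S v v ≤ lmax * ∫ x in S, ‖v.snd x‖ ^ 2 := by
  rw [← integral_const_mul]
  refine integral_mono_ae ((integrableOn_energy ha hl v v).mono_set hS)
    ((integrable_norm_sq_Lp v.snd).integrableOn.const_mul _) ?_
  filter_upwards [ae_restrict_of_ae_restrict_of_subset hS ha.upper] with x hx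
  have := hx (v.snd x).ofLp
  rwa [dotProduct_self_eq_norm_sq] at this

/-- The energy product of a function of `H¹₀(U)` can be computed on any set containing `U`. -/
theorem energyInner_eq_of_mem_H10 (hΩ : NullMeasurableSet Ω) {U : Set (Rd d)} (hU : MeasurableSet U)
    (hUS : U ⊆ S) (hS : S ⊆ Ω) (v : L2Pair d) {w : L2Pair d} (hw : w ∈ H10 U) :
    energyInner a Ω v w = energyInner a S v w := by
  refine setIntegral_eq_of_subset_of_ae_sdiff_eq_zero hΩ hS ?_
  filter_upwards [snd_ae_eq_zero_of_mem_H10 hU hw] with x hx hxS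
  rw [hx fun h => hxS.2 (hUS h)]
  simp

/-- The integral over a set of finite measure, as a linear form on pairs. -/
def integralForm (S : Set (Rd d)) (hS : volume S ≠ ⊤) : L2Pair d →ₗ[ℝ] ℝ where
  toFun v := ∫ x in S, v.fst x
  map_add' v w := by
    have : IsFiniteMeasure (volume.restrict S) := ⟨by simpa using hS.lt_top⟩
    rw [← integral_add (((Lp.memLp v.fst).restrict S).integrable (by norm_num))
      (((Lp.memLp w.fst).restrict S).integrable (by norm_num))]
    exact integral_congr_ae (ae_restrict_of_ae (fst_add_ae v w))
  map_smul' c v := by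
    rw [RingHom.id_apply, smul_eq_mul, ← integral_const_mul]
    exact integral_congr_ae (ae_restrict_of_ae (fst_smul_ae c v))

theorem integralForm_apply {S : Set (Rd d)} (hS : volume S ≠ ⊤) (v : L2Pair d) :
    integralForm S hS v = ∫ x in S, v.fst x := rfl

end

/-! ### Cells of the partition, cell bumps, and the orthogonality of gamblets. -/

section

variable {d m : ℕ} {Ω : Set (Rd d)} {a : Rd d → Matrix (Fin d) (Fin d) ℝ} {lmin lmax H δ : ℝ}
  {τ : Fin m → Set (Rd d)}

namespace IsConvexPartition

theorem subset (hτ : IsConvexPartition Ω H δ τ) (j : Fin m) : τ j ⊆ Ω :=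
  (Set.subset_iUnion τ j).trans hτ.iUnion_eq.subset

theorem isBounded (hτ : IsConvexPartition Ω H δ τ) (hΩb : Bornology.IsBounded Ω) (j : Fin m) :
    Bornology.IsBounded (τ j) := hΩb.subset (hτ.subset j)

theorem volume_ne_top (hτ : IsConvexPartition Ω H δ τ) (hΩb : Bornology.IsBounded Ω) (j : Fin m) :
    volume (τ j) ≠ ⊤ := (hτ.isBounded hΩb j).measure_lt_top.ne

theorem nullMeasurableSet (hτ : IsConvexPartition Ω H δ τ) (j : Fin m) :
    NullMeasurableSet (τ j) volume := (hτ.convex j).nullMeasurableSet volume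

theorem dist_le (hτ : IsConvexPartition Ω H δ τ) (hΩb : Bornology.IsBounded Ω) (j : Fin m)
    {x y : Rd d} (hx : x ∈ τ j) (hy : y ∈ τ j) : dist x y ≤ H :=
  (Metric.dist_le_diam_of_mem (hτ.isBounded hΩb j) hx hy).trans (hτ.diam_le j)

theorem nonempty_interior (hτ : IsConvexPartition Ω H δ τ) (hH : 0 < H) (hδ : 0 < δ) (j : Fin m) :
    (interior (τ j)).Nonempty := by
  obtain ⟨c, hc⟩ := hτ.ball_subset j
  exact ⟨c, interior_maximal hc Metric.isOpen_ball (Metric.mem_ball_self (by positivity))⟩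

theorem nonempty (hτ : IsConvexPartition Ω H δ τ) (hH : 0 < H) (hδ : 0 < δ) (j : Fin m) :
    (τ j).Nonempty := (hτ.nonempty_interior hH hδ j).mono interior_subset

theorem le_volume (hτ : IsConvexPartition Ω H δ τ) (hΩb : Bornology.IsBounded Ω) (hH : 0 < H)
    (hδ : 0 < δ) (j : Fin m) : (δ * H / 2) ^ d * unitBallVol d ≤ volume.real (τ j) := by
  obtain ⟨c, hc⟩ := hτ.ball_subset j
  have h := measureReal_mono hc (hτ.volume_ne_top hΩb j)
  rw [measureReal_def, Measure.addHaar_ball_of_pos _ _ (by positivity : 0 < δ * H / 2),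
    finrank_euclideanSpace_fin, ENNReal.toReal_mul,
    ENNReal.toReal_ofReal (by positivity)] at h
  exact h

theorem volume_pos (hτ : IsConvexPartition Ω H δ τ) (hΩb : Bornology.IsBounded Ω) (hH : 0 < H)
    (hδ : 0 < δ) (j : Fin m) : 0 < volume.real (τ j) :=
  ENNReal.toReal_pos (Measure.measure_pos_of_nonempty_interior _
    (hτ.nonempty_interior hH hδ j)).ne' (hτ.volume_ne_top hΩb j)

theorem setIntegral_eq_sum (hτ : IsConvexPartition Ω H δ τ) {f : Rd d → ℝ}
    (hf : IntegrableOn f Ω) : ∫ x in Ω, f x = ∑ j, ∫ x in τ j, f x := by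
  rw [← tsum_fintype (L := .unconditional _), ← integral_iUnion_ae hτ.nullMeasurableSet
    (fun i j hij => (hτ.disjoint hij).aedisjoint) (by rwa [hτ.iUnion_eq]), hτ.iUnion_eq]

theorem setIntegral_measFun (hτ : IsConvexPartition Ω H δ τ) {S : Set (Rd d)} {j : Fin m}
    (hS : τ j ⊆ S) (f : Rd d → ℝ) : ∫ x in S, measFun τ j x * f x = ∫ x in τ j, f x := by
  have e : (fun x => measFun τ j x * f x) = (τ j).indicator f := by
    ext x
    by_cases hx : x ∈ τ j <;> simp [measFun, hx]
  rw [e, integral_indicator₀ ((hτ.nullMeasurableSet j).mono Measure.restrict_le_self),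
    Measure.restrict_restrict₀ ((hτ.nullMeasurableSet j).mono Measure.restrict_le_self), Set.inter_eq_left.2 hS]

theorem setIntegral_eq_zero_of_mem_H10 (hτ : IsConvexPartition Ω H δ τ) {j k : Fin m}
    (hjk : j ≠ k) {v : L2Pair d} (hv : v ∈ H10 (interior (τ j))) : ∫ x in τ k, v.fst x = 0 := by
  refine setIntegral_eq_zero_of_ae_eq_zero ?_
  filter_upwards [fst_ae_eq_zero_of_mem_H10 isOpen_interior.measurableSet hv] with x hx hxk
  exact hx fun hxj => (hτ.disjoint hjk).le_bot ⟨interior_subset hxj, hxk⟩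

end IsConvexPartition

theorem mem_admissible_iff (hτ : IsConvexPartition Ω H δ τ) {S : Set (Rd d)} {i : Fin m}
    {v : L2Pair d} : v ∈ admissible τ S i ↔ v ∈ H10 (interior S) ∧
      ∀ j, τ j ⊆ S → ∫ x in τ j, v.fst x = if i = j then 1 else 0 := by
  refine and_congr Iff.rfl (forall₂_congr fun j hj => ?_)
  rw [hτ.setIntegral_measFun hj]

/-- Functions with unit integral supported in the cells of the partition. -/
theorem exists_cell_bump (hd : 1 ≤ d) (hΩb : Bornology.IsBounded Ω)
    (ha : IsElliptic Ω a lmin lmax) (hl : 0 ≤ lmax) (hτ : IsConvexPartition Ω H δ τ) (hH : 0 < H)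
    (hδ : 0 < δ) (j : Fin m) : ∃ b ∈ H10 (interior (τ j)), ∫ x in τ j, b.fst x = 1 ∧
      energyInner a (τ j) b b ≤
        lmax * (11 / 10 * (d + 1) * (2 / (δ * H))) ^ 2 / volume.real (τ j) := by
  obtain ⟨c, hc⟩ := hτ.ball_subset j
  obtain ⟨φ, hφ, hφc, hφs, hφ1, hφi⟩ := exists_bump_convex hd (hτ.convex j) (hτ.isBounded hΩb j)
    (show 0 < δ * H / 2 by positivity) hc
  obtain ⟨p, hp, hp1, hp2⟩ := exists_mem_testPairs hφ hφc hφs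
  have hV := hτ.volume_pos hΩb hH hδ j
  set V := volume.real (τ j)
  set I := ∫ x, φ x
  have hI : 0 < I := by
    have : 0 < δ * H / 2 * V / (d + 1) := by positivity
    linarith
  have hpI : ∫ x in τ j, p.fst x = I := by
    rw [integral_congr_ae (ae_restrict_of_ae hp1)]
    refine setIntegral_eq_integral_of_forall_compl_eq_zero fun x hx => ?_
    by_contra h
    exact hx (interior_subset (hφs (subset_tsupport φ h)))
  have hpE : energyInner a (τ j) p p ≤ lmax * V := by
    refine (energyInner_le_lmax_mul ha hl (hτ.subset j) p).trans ?_
    gcongr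
    have : IsFiniteMeasure (volume.restrict (τ j)) :=
      ⟨by simpa using (hτ.volume_ne_top hΩb j).lt_top⟩
    calc ∫ x in τ j, ‖p.snd x‖ ^ 2 ≤ ∫ x in τ j, (1 : ℝ) := by
          refine integral_mono_ae (integrable_norm_sq_Lp p.snd).integrableOn (integrable_const _) ?_
          filter_upwards [ae_restrict_of_ae hp2] with x hx
          rw [hx]
          exact pow_le_one₀ (norm_nonneg _) (hφ1 x)
      _ = V := by simp [V]
  refine ⟨I⁻¹ • p, Submodule.smul_mem _ _ (mem_H10_of_mem_testPairs hp), ?_, ?_⟩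
  · have := (integralForm (τ j) (hτ.volume_ne_top hΩb j)).map_smul I⁻¹ p
    rw [integralForm_apply, integralForm_apply, hpI, smul_eq_mul, inv_mul_cancel₀ hI.ne'] at this
    exact this
  · rw [← energyNorm_sq ha (hτ.subset j), energyNorm_smul _ ha hl (hτ.subset j), mul_pow,
      energyNorm_sq ha (hτ.subset j), sq_abs]
    -- This is the lower bound for the integral of the bump, with inner radius ρ = δH/2.
    have h1 : I⁻¹ ≤ 11 / 10 * (d + 1) * (2 / (δ * H)) / V := by
      rw [inv_le_iff_one_le_mul₀ hI, div_mul_eq_mul_div, le_div_iff₀ hV]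
      have h2 : V = (d + 1) * (2 / (δ * H)) * (δ * H / 2 * V / (d + 1)) := by field_simp
      calc 1 * V = (d + 1) * (2 / (δ * H)) * (δ * H / 2 * V / (d + 1)) := by rw [one_mul, ← h2]
        _ ≤ (d + 1) * (2 / (δ * H)) * (11 / 10 * I) := by gcongr
        _ = _ := by ring
    calc I⁻¹ ^ 2 * energyInner a (τ j) p p
        ≤ (11 / 10 * (d + 1) * (2 / (δ * H)) / V) ^ 2 * (lmax * V) := by
          gcongr
          exact energyInner_self_nonneg ha (hτ.subset j) p
      _ = _ := by field_simp

/-- A quadratic that vanishes at 0 and is nonnegative everywhere has zero slope there. The test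
value is t = -p/(q + 1) rather than -p/q because q may be zero. -/
theorem sq_le_of_forall_mul_le {p q : ℝ} (h : ∀ t : ℝ, 0 ≤ 2 * t * p + t ^ 2 * q) (hq : 0 ≤ q) :
    p = 0 := by
  have h1 := h (-p / (q + 1))
  have e : 2 * (-p / (q + 1)) * p + (-p / (q + 1)) ^ 2 * q =
      -(p ^ 2 * (q + 2) / (q + 1) ^ 2) := by field_simp; ring
  rw [e] at h1
  have h2 : 0 ≤ p ^ 2 * (q + 2) / (q + 1) ^ 2 := by positivity
  have h3 : p ^ 2 * (q + 2) / (q + 1) ^ 2 = 0 := by linarith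
  have h4 : (q + 1) ^ 2 ≠ 0 := by positivity
  have h5 : q + 2 ≠ 0 := by positivity
  simpa [h4, h5] using h3

/-- A gamblet is orthogonal to the functions whose measurements vanish. -/
theorem energyInner_gamblet_eq_zero (hΩo : IsOpen Ω) (hΩb : Bornology.IsBounded Ω)
    (ha : IsElliptic Ω a lmin lmax) (hl : 0 ≤ lmax) (hτ : IsConvexPartition Ω H δ τ) {i : Fin m}
    {ψ : L2Pair d} (hψ : IsGamblet a τ Ω i ψ) {v : L2Pair d} (hv : v ∈ H10 Ω)
    (hv0 : ∀ j, ∫ x in τ j, v.fst x = 0) : energyInner a Ω ψ v = 0 := by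
  obtain ⟨hadm, hmin⟩ := hψ
  rw [mem_admissible_iff hτ, hΩo.interior_eq] at hadm
  refine sq_le_of_forall_mul_le (q := energyInner a Ω v v) (fun t => ?_)
    (energyInner_self_nonneg ha le_rfl v)
  -- Adding a multiple of v changes no measurement, so minimality of ψ holds along the whole line
  -- and yields the first-order condition.
  have hχ : ψ + t • v ∈ admissible τ Ω i := by
    rw [mem_admissible_iff hτ, hΩo.interior_eq]
    refine ⟨Submodule.add_mem _ hadm.1 (Submodule.smul_mem _ _ hv), fun j hj => ?_⟩
    have h := (integralForm (τ j) (hτ.volume_ne_top hΩb j)).map_add ψ (t • v)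
    rw [map_smul, integralForm_apply, integralForm_apply, integralForm_apply, hv0 j, smul_zero,
      add_zero, hadm.2 j hj] at h
    exact h
  have h := hmin _ hχ
  have h2 := pow_le_pow_left₀ (energyNorm_nonneg _) h 2
  rw [energyNorm_sq ha le_rfl, energyNorm_sq ha le_rfl, energyInner_add_self ha hl le_rfl,
    energyInner_smul_right, energyInner_smul_left, energyInner_smul_right] at h2
  nlinarith

end

/-! ### Estimates on one cell for the product of a cutoff and a function of mean zero. -/

section

variable {d m : ℕ} {Ω : Set (Rd d)} {a : Rd d → Matrix (Fin d) (Fin d) ℝ} {lmin lmax H δ : ℝ}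
  {τ : Fin m → Set (Rd d)}

theorem sq_integral_le {α : Type*} [MeasurableSpace α] {μ : Measure α} [IsFiniteMeasure μ]
    {f : α → ℝ} (hf : MemLp f 2 μ) : (∫ x, f x ∂μ) ^ 2 ≤ μ.real Set.univ * ∫ x, f x ^ 2 ∂μ := by
  rcases eq_or_ne (μ.real Set.univ) 0 with h0 | h0
  · have : μ = 0 := by
      rwa [measureReal_def, ENNReal.toReal_eq_zero_iff, or_iff_left (measure_ne_top _ _),
        Measure.measure_univ_eq_zero] at h0
    simp [this]
  have hV : 0 < μ.real Set.univ := lt_of_le_of_ne measureReal_nonneg h0.symm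
  set V := μ.real Set.univ
  set I := ∫ x, f x ∂μ
  have hf1 : Integrable f μ := hf.integrable (by norm_num)
  have hf2 : Integrable (fun x => f x ^ 2) μ := hf.integrable_sq
  have h : 0 ≤ ∫ x, (f x ^ 2 - 2 * (I / V) * f x + (I / V) ^ 2) ∂μ := integral_nonneg fun x => by
    show 0 ≤ f x ^ 2 - 2 * (I / V) * f x + (I / V) ^ 2
    nlinarith [sq_nonneg (f x - I / V)]
  have hf3 : Integrable (fun x => f x ^ 2 - 2 * (I / V) * f x) μ := hf2.sub (hf1.const_mul _)
  rw [integral_add hf3 (integrable_const _),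
    integral_sub hf2 (hf1.const_mul _), integral_const_mul, integral_const, smul_eq_mul] at h
  change 0 ≤ (∫ x, f x ^ 2 ∂μ) - 2 * (I / V) * I + V * (I / V) ^ 2 at h
  have e : (∫ x, f x ^ 2 ∂μ) - 2 * (I / V) * I + V * (I / V) ^ 2 =
      (∫ x, f x ^ 2 ∂μ) - I ^ 2 / V := by field_simp; ring
  rw [e, sub_nonneg, div_le_iff₀ hV] at h
  linarith

theorem norm_sub_le_of_gradient_le {η : Rd d → ℝ} (hη : ContDiff ℝ ∞ η) {S : Set (Rd d)}
    (hS : Convex ℝ S) {G : ℝ} (hG : ∀ x ∈ S, ‖gradient η x‖ ≤ G) {x y : Rd d} (hx : x ∈ S)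
    (hy : y ∈ S) : |η y - η x| ≤ G * ‖y - x‖ :=
  hS.norm_image_sub_le_of_norm_fderiv_le (𝕜 := ℝ) (fun z _ => hη.differentiable (by simp) z)
    (fun z hz => by rw [← norm_gradient_eq]; exact hG z hz) hx hy

/-- The Poincaré inequality on a cell, in terms of the energy. -/
theorem cell_poincare (hΩb : Bornology.IsBounded Ω) (ha : IsElliptic Ω a lmin lmax) (hl : 0 ≤ lmax)
    (hτ : IsConvexPartition Ω H δ τ) (hH : 0 < H) (hδ : 0 < δ) {j : Fin m} {U : Set (Rd d)}
    {v : L2Pair d} (hv : v ∈ H10 U) (hv0 : ∫ x in τ j, v.fst x = 0) :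
    ∫ x in τ j, v.fst x ^ 2 ≤ 25 / 36 * H ^ 2 / lmin * energyInner a (τ j) v v := by
  have h := poincare_H10 (hτ.convex j) (hτ.isBounded hΩb j) (hτ.nonempty_interior hH hδ j) hH
    (fun x hx y hy => hτ.dist_le hΩb j hx hy) hv
  have h2 := lmin_mul_le_energyInner ha hl (hτ.subset j) v
  rw [hv0] at h
  simp only [Real.norm_eq_abs, sq_abs, ne_eq, OfNat.ofNat_ne_zero, not_false_eq_true, zero_pow,
    zero_div, add_zero] at h
  refine h.trans ?_
  rw [mul_div_assoc, mul_assoc, mul_assoc]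
  gcongr 25 / 36 * ?_
  rw [div_mul_eq_mul_div, mul_div_assoc]
  gcongr
  rw [le_div_iff₀ ha.pos]
  linarith

section Cell

variable (hΩb : Bornology.IsBounded Ω) (ha : IsElliptic Ω a lmin lmax) (hl : 0 < lmax)
  (hτ : IsConvexPartition Ω H δ τ) (hH : 0 < H) (hδ : 0 < δ) {j : Fin m} {U : Set (Rd d)}
  {v w b : L2Pair d} (hv : v ∈ H10 U) (hv0 : ∫ x in τ j, v.fst x = 0) {η : Rd d → ℝ} {G : ℝ}
  (hη : ContDiff ℝ ∞ η) (hG : ∀ x ∈ τ j, ‖gradient η x‖ ≤ G)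
  (hw1 : w.fst =ᵐ[volume] fun x => η x * v.fst x)
  (hw2 : w.snd =ᵐ[volume] fun x => η x • v.snd x + v.fst x • gradient η x)

-- Since v has mean zero on the cell, η may be replaced by η - η(y), which is at most GH there.
-- Cauchy-Schwarz and Poincaré then apply; this subtraction gains one factor H.
include hΩb ha hl hτ hH hδ hv hv0 hη hG hw1 in
theorem sq_setIntegral_mul_le :
    (∫ x in τ j, w.fst x) ^ 2 ≤ (G * (5 / 6) * H ^ 2) ^ 2 * volume.real (τ j) / lmin *
      energyInner a (τ j) v v := by
  have hVt := hτ.volume_ne_top hΩb j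
  have : IsFiniteMeasure (volume.restrict (τ j)) := ⟨by simpa using hVt.lt_top⟩
  obtain ⟨y, hy⟩ := hτ.nonempty hH hδ j
  have hG0 : 0 ≤ G := (norm_nonneg _).trans (hG y hy)
  have hvm : MemLp v.fst 2 (volume.restrict (τ j)) := (Lp.memLp v.fst).restrict _
  have hmem : ∀ᵐ x ∂volume.restrict (τ j), x ∈ τ j := by
    exact ae_restrict_mem₀ (hτ.nullMeasurableSet j)
  have hbd : ∀ᵐ x ∂volume.restrict (τ j), ‖(η x - η y) * v.fst x‖ ≤ G * H * ‖v.fst x‖ := by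
    filter_upwards [hmem] with x hx
    rw [norm_mul]
    gcongr
    refine (norm_sub_le_of_gradient_le hη (hτ.convex j) hG hy hx).trans ?_
    gcongr
    rw [← dist_eq_norm]
    exact hτ.dist_le hΩb j hx hy
  have hfm : MemLp (fun x => (η x - η y) * v.fst x) 2 (volume.restrict (τ j)) :=
    hvm.of_le_mul ((hη.continuous.sub continuous_const).aestronglyMeasurable.mul hvm.1) hbd
  have e : ∫ x in τ j, w.fst x = ∫ x in τ j, (η x - η y) * v.fst x := by
    have h1 : ∫ x in τ j, w.fst x = ∫ x in τ j, ((η x - η y) * v.fst x + η y * v.fst x) := by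
      refine integral_congr_ae (ae_restrict_of_ae ?_)
      filter_upwards [hw1] with x hx
      rw [hx]; ring
    rw [h1, integral_add (hfm.integrable (by norm_num))
      ((hvm.integrable (by norm_num)).const_mul _), integral_const_mul, hv0, mul_zero, add_zero]
  rw [e]
  refine (sq_integral_le hfm).trans ?_
  rw [measureReal_restrict_apply_univ]
  have h2 : ∫ x in τ j, ((η x - η y) * v.fst x) ^ 2 ≤ (G * H) ^ 2 * ∫ x in τ j, v.fst x ^ 2 := by
    rw [← integral_const_mul]
    refine integral_mono_ae hfm.integrable_sq (hvm.integrable_sq.const_mul _) ?_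
    filter_upwards [hbd] with x hx
    have := pow_le_pow_left₀ (norm_nonneg _) hx 2
    rwa [mul_pow (G * H), Real.norm_eq_abs, Real.norm_eq_abs, sq_abs, sq_abs] at this
  have h3 := cell_poincare hΩb ha hl.le hτ hH hδ hv hv0
  calc volume.real (τ j) * ∫ x in τ j, ((η x - η y) * v.fst x) ^ 2
      ≤ volume.real (τ j) * ((G * H) ^ 2 *
        (25 / 36 * H ^ 2 / lmin * energyInner a (τ j) v v)) := by
        gcongr
        exact h2.trans (by gcongr)
    _ = _ := by ring

-- The volume of the cell in the bound for the integral cancels against its inverse in the energy of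
-- the bump, so the correction by bumps costs a factor independent of the cell.
include hΩb ha hl hτ hH hδ hv hv0 hη hG hw1 in
theorem sq_setIntegral_mul_energy_le {K : ℝ}
    (hb : energyInner a (τ j) b b ≤ lmax * (K / H) ^ 2 / volume.real (τ j)) :
    (∫ x in τ j, w.fst x) ^ 2 * energyInner a (τ j) b b ≤
      (G * (5 / 6) * H * K) ^ 2 * (lmax / lmin) * energyInner a (τ j) v v := by
  have h := sq_setIntegral_mul_le hΩb ha hl hτ hH hδ hv hv0 hη hG hw1
  have hV := hτ.volume_pos hΩb hH hδ j
  have he := energyInner_self_nonneg ha (hτ.subset j) v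
  have hp := ha.pos
  calc _ ≤ ((G * (5 / 6) * H ^ 2) ^ 2 * volume.real (τ j) / lmin * energyInner a (τ j) v v) *
        (lmax * (K / H) ^ 2 / volume.real (τ j)) :=
        mul_le_mul h hb (energyInner_self_nonneg ha (hτ.subset j) b) (by positivity)
    _ = _ := by field_simp

include hΩb ha hl hτ hH hδ hv hv0 hη hG hw1 in
theorem abs_setIntegral_mul_energyNorm_le {K : ℝ} (hK : 0 ≤ K)
    (hb : energyInner a (τ j) b b ≤ lmax * (K / H) ^ 2 / volume.real (τ j)) :
    |∫ x in τ j, w.fst x| * energyNorm a (τ j) b ≤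
      G * (5 / 6) * H * Real.sqrt (lmax / lmin) * K * energyNorm a (τ j) v := by
  have h := sq_setIntegral_mul_energy_le hΩb ha hl hτ hH hδ hv hv0 hη hG hw1 hb
  obtain ⟨y, hy⟩ := hτ.nonempty hH hδ j
  have hG0 : 0 ≤ G := (norm_nonneg _).trans (hG y hy)
  have hp := ha.pos
  have hn := energyNorm_nonneg (a := a) (S := τ j) v
  refine le_of_sq_le_sq ?_ (by positivity)
  rw [mul_pow, sq_abs, energyNorm_sq ha (hτ.subset j)]
  refine h.trans (le_of_eq ?_)
  rw [← energyNorm_sq ha (hτ.subset j)]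
  have hs := Real.sq_sqrt (show 0 ≤ lmax / lmin by positivity)
  linear_combination (-(G * (5 / 6) * H * K * energyNorm a (τ j) v) ^ 2) * hs

include hΩb ha hl hτ hH hδ hv hv0 hG in
/-- The energy of the term that involves the gradient of the cutoff function. -/
theorem energy_fst_smul_gradient_le (hη : ContDiff ℝ ∞ η) :
    IntegrableOn (fun x => (v.fst x • gradient η x).ofLp ⬝ᵥ
      (a x *ᵥ (v.fst x • gradient η x).ofLp)) (τ j) ∧
    ∫ x in τ j, (v.fst x • gradient η x).ofLp ⬝ᵥ (a x *ᵥ (v.fst x • gradient η x).ofLp) ≤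
      (G * (5 / 6) * H * Real.sqrt (lmax / lmin)) ^ 2 * energyInner a (τ j) v v := by
  have hvm : MemLp v.fst 2 (volume.restrict (τ j)) := (Lp.memLp v.fst).restrict _
  have hmem : ∀ᵐ x ∂volume.restrict (τ j), x ∈ τ j := ae_restrict_mem₀ (hτ.nullMeasurableSet j)
  have hp := ha.pos
  have hgm : AEStronglyMeasurable (fun x => v.fst x • gradient η x) (volume : Measure (Rd d)) :=
    (Lp.memLp v.fst).1.smul (continuous_gradient hη).aestronglyMeasurable
  have hbd : ∀ᵐ x ∂volume.restrict (τ j), (v.fst x • gradient η x).ofLp ⬝ᵥ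
      (a x *ᵥ (v.fst x • gradient η x).ofLp) ≤ lmax * G ^ 2 * v.fst x ^ 2 := by
    filter_upwards [hmem, ae_restrict_of_ae_restrict_of_subset (hτ.subset j) ha.upper] with x hx h1
    refine (h1 _).trans ?_
    rw [dotProduct_self_eq_norm_sq, norm_smul, mul_pow, Real.norm_eq_abs, sq_abs, mul_assoc,
      mul_comm (v.fst x ^ 2)]
    have := hG x hx
    gcongr
  have hI : Integrable (fun x => lmax * G ^ 2 * v.fst x ^ 2) (volume.restrict (τ j)) :=
    hvm.integrable_sq.const_mul _
  have hint : IntegrableOn (fun x => (v.fst x • gradient η x).ofLp ⬝ᵥ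
      (a x *ᵥ (v.fst x • gradient η x).ofLp)) (τ j) := by
    refine Integrable.mono' hI
      ((aestronglyMeasurable_form ha hgm.restrict hgm.restrict).mono_measure
        (Measure.restrict_mono_set _ (hτ.subset j))) ?_
    filter_upwards [hbd, ae_restrict_of_ae_restrict_of_subset (hτ.subset j) ha.ae_nonneg]
      with x h1 h2
    rwa [Real.norm_of_nonneg (h2 _)]
  refine ⟨hint, (integral_mono_ae hint hI hbd).trans ?_⟩
  rw [integral_const_mul]
  have h3 := cell_poincare hΩb ha hl.le hτ hH hδ hv hv0
  calc lmax * G ^ 2 * ∫ x in τ j, v.fst x ^ 2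
      ≤ lmax * G ^ 2 * (25 / 36 * H ^ 2 / lmin * energyInner a (τ j) v v) := by gcongr
    _ = _ := by rw [mul_pow _ (Real.sqrt _), Real.sq_sqrt (by positivity)]; ring

-- The energy product of v with ηv is the weighted energy plus a cross term with v∇η. The energy of
-- v∇η is at most t² times that of v, so Young with parameter t bounds the cross term by t times the
-- energy of v.
include hΩb ha hl hτ hH hδ hv hv0 hη hG hw2 in
theorem le_energyInner_mul (hG0 : 0 < G)
    (hq : IntegrableOn (fun x => η x * ((v.snd x).ofLp ⬝ᵥ (a x *ᵥ (v.snd x).ofLp))) (τ j)) :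
    ∫ x in τ j, η x * ((v.snd x).ofLp ⬝ᵥ (a x *ᵥ (v.snd x).ofLp)) ≤
      energyInner a (τ j) v w +
        G * (5 / 6) * H * Real.sqrt (lmax / lmin) * energyInner a (τ j) v v := by
  obtain ⟨hint, hle⟩ := energy_fst_smul_gradient_le hΩb ha hl hτ hH hδ hv hv0 hG hη
  have hp := ha.pos
  set t := G * (5 / 6) * H * Real.sqrt (lmax / lmin)
  have ht : 0 < t := by positivity
  have hqi := (integrableOn_energy ha hl.le v v).mono_set (hτ.subset j)
  have hvw := (integrableOn_energy ha hl.le v w).mono_set (hτ.subset j)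
  have h1 : ∫ x in τ j, η x * ((v.snd x).ofLp ⬝ᵥ (a x *ᵥ (v.snd x).ofLp)) ≤
      ∫ x in τ j, ((v.snd x).ofLp ⬝ᵥ (a x *ᵥ (w.snd x).ofLp) +
        (t / 2 * ((v.snd x).ofLp ⬝ᵥ (a x *ᵥ (v.snd x).ofLp)) +
          1 / (2 * t) * ((v.fst x • gradient η x).ofLp ⬝ᵥ
            (a x *ᵥ (v.fst x • gradient η x).ofLp)))) := by
    refine integral_mono_ae hq (hvw.add ((hqi.const_mul _).add (hint.const_mul _))) ?_
    filter_upwards [ae_restrict_of_ae hw2,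
      ae_restrict_of_ae_restrict_of_subset (hτ.subset j) ha.ae_nonneg,
      ae_restrict_of_ae_restrict_of_subset (hτ.subset j) ha.symm] with x h1 h2 h3
    have h4 := abs_dotProduct_mulVec_le h3 h2 ht (v.snd x).ofLp (v.fst x • gradient η x).ofLp
    have h5 := neg_abs_le ((v.snd x).ofLp ⬝ᵥ (a x *ᵥ (v.fst x • gradient η x).ofLp))
    have h6 : (v.snd x).ofLp ⬝ᵥ (a x *ᵥ (w.snd x).ofLp) =
        η x * ((v.snd x).ofLp ⬝ᵥ (a x *ᵥ (v.snd x).ofLp)) +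
          (v.snd x).ofLp ⬝ᵥ (a x *ᵥ (v.fst x • gradient η x).ofLp) := by
      rw [h1, WithLp.ofLp_add, mulVec_add, dotProduct_add, WithLp.ofLp_smul, mulVec_smul,
        dotProduct_smul, smul_eq_mul]
    show _ ≤ _ + (_ + _)
    linarith
  have hsum : IntegrableOn (fun x => t / 2 * ((v.snd x).ofLp ⬝ᵥ (a x *ᵥ (v.snd x).ofLp)) +
      1 / (2 * t) * ((v.fst x • gradient η x).ofLp ⬝ᵥ
        (a x *ᵥ (v.fst x • gradient η x).ofLp))) (τ j) :=
    (hqi.const_mul _).add (hint.const_mul _)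
  rw [integral_add hvw hsum, integral_add (hqi.const_mul _) (hint.const_mul _), integral_const_mul, integral_const_mul] at h1
  refine h1.trans ?_
  change energyInner a (τ j) v w + (t / 2 * energyInner a (τ j) v v + 1 / (2 * t) * _) ≤ _
  have h2 : 1 / (2 * t) * (∫ x in τ j, (v.fst x • gradient η x).ofLp ⬝ᵥ
      (a x *ᵥ (v.fst x • gradient η x).ofLp)) ≤ 1 / (2 * t) * (t ^ 2 *
        energyInner a (τ j) v v) := by gcongr
  have h3 : 1 / (2 * t) * (t ^ 2 * energyInner a (τ j) v v) =
    t / 2 * energyInner a (τ j) v v := by field_simp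
  linarith

-- Triangle inequality for η∇v + v∇η, carried out pointwise as Young with parameter t: (1 + t) + (1
-- + 1/t)t² = (1 + t)².
include hΩb ha hl hτ hH hδ hv hv0 hη hG hw2 in
theorem energyNorm_mul_le (hG0 : 0 < G) (hη1 : ∀ x ∈ τ j, |η x| ≤ 1) :
    energyNorm a (τ j) w ≤
      (1 + G * (5 / 6) * H * Real.sqrt (lmax / lmin)) * energyNorm a (τ j) v := by
  obtain ⟨hint, hle⟩ := energy_fst_smul_gradient_le hΩb ha hl hτ hH hδ hv hv0 hG hη
  have hp := ha.pos
  set t := G * (5 / 6) * H * Real.sqrt (lmax / lmin)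
  have ht : 0 < t := by positivity
  have hqi := (integrableOn_energy ha hl.le v v).mono_set (hτ.subset j)
  have hww := (integrableOn_energy ha hl.le w w).mono_set (hτ.subset j)
  have hn := energyNorm_nonneg (a := a) (S := τ j) v
  refine le_of_sq_le_sq ?_ (by positivity)
  rw [mul_pow, energyNorm_sq ha (hτ.subset j), energyNorm_sq ha (hτ.subset j)]
  have h1 : energyInner a (τ j) w w ≤
      ∫ x in τ j, ((1 + t) * ((v.snd x).ofLp ⬝ᵥ (a x *ᵥ (v.snd x).ofLp)) +
          (1 + 1 / t) * ((v.fst x • gradient η x).ofLp ⬝ᵥ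
            (a x *ᵥ (v.fst x • gradient η x).ofLp))) := by
    refine integral_mono_ae hww ((hqi.const_mul _).add (hint.const_mul _)) ?_
    filter_upwards [ae_restrict_of_ae hw2, ae_restrict_mem₀ (hτ.nullMeasurableSet j),
      ae_restrict_of_ae_restrict_of_subset (hτ.subset j) ha.ae_nonneg,
      ae_restrict_of_ae_restrict_of_subset (hτ.subset j) ha.symm] with x h1 hx h2 h3
    have h4 := (le_abs_self _).trans (abs_dotProduct_mulVec_le h3 h2 ht (η x • v.snd x).ofLp
      (v.fst x • gradient η x).ofLp)
    have h6 : (w.snd x).ofLp ⬝ᵥ (a x *ᵥ (w.snd x).ofLp) =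
        (η x • v.snd x).ofLp ⬝ᵥ (a x *ᵥ (η x • v.snd x).ofLp) +
          2 * ((η x • v.snd x).ofLp ⬝ᵥ (a x *ᵥ (v.fst x • gradient η x).ofLp)) +
          (v.fst x • gradient η x).ofLp ⬝ᵥ (a x *ᵥ (v.fst x • gradient η x).ofLp) := by
      rw [h1, WithLp.ofLp_add, mulVec_add, dotProduct_add, add_dotProduct, add_dotProduct,
        dotProduct_mulVec_comm h3 (v.fst x • gradient η x).ofLp (η x • v.snd x).ofLp]
      ring
    have h7 : (η x • v.snd x).ofLp ⬝ᵥ (a x *ᵥ (η x • v.snd x).ofLp) ≤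
        (v.snd x).ofLp ⬝ᵥ (a x *ᵥ (v.snd x).ofLp) := by
      rw [WithLp.ofLp_smul, mulVec_smul, dotProduct_smul, smul_dotProduct, smul_eq_mul, smul_eq_mul,
        ← mul_assoc, ← sq]
      refine mul_le_of_le_one_left (h2 _) ?_
      rw [← sq_abs]
      exact pow_le_one₀ (abs_nonneg _) (hη1 x hx)
    have h8 := mul_le_mul_of_nonneg_left h7 (show 0 ≤ 1 + t by positivity)
    have h9 : 2 * (1 / (2 * t) * ((v.fst x • gradient η x).ofLp ⬝ᵥ
      (a x *ᵥ (v.fst x • gradient η x).ofLp))) = 1 / t * ((v.fst x • gradient η x).ofLp ⬝ᵥ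
      (a x *ᵥ (v.fst x • gradient η x).ofLp)) := by field_simp
    show _ ≤ _ + _
    linarith
  rw [integral_add (hqi.const_mul _) (hint.const_mul _), integral_const_mul, integral_const_mul]
    at h1
  refine h1.trans ?_
  change (1 + t) * energyInner a (τ j) v v + _ ≤ _
  have h2 : (1 + 1 / t) * (∫ x in τ j, (v.fst x • gradient η x).ofLp ⬝ᵥ
      (a x *ᵥ (v.fst x • gradient η x).ofLp)) ≤ (1 + 1 / t) * (t ^ 2 *
        energyInner a (τ j) v v) := by gcongr
  have h3 : (1 + 1 / t) * (t ^ 2 * energyInner a (τ j) v v) =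
    (t ^ 2 + t) * energyInner a (τ j) v v := by field_simp
  nlinarith

end Cell

end

/-! ### Exponential decay of the gamblets. -/

section

variable {d m : ℕ} {Ω : Set (Rd d)} {a : Rd d → Matrix (Fin d) (Fin d) ℝ} {lmin lmax H δ : ℝ}
  {τ : Fin m → Set (Rd d)}

/-- The bound `k / H` for the gradients of the cell bumps. -/
def bumpConst (d : ℕ) (δ : ℝ) : ℝ := 11 / 10 * (d + 1) * (2 / δ)

theorem bumpConst_pos (hδ : 0 < δ) : 0 < bumpConst d δ := by unfold bumpConst; positivity

theorem exists_cell_bumps (hd : 1 ≤ d) (hΩb : Bornology.IsBounded Ω)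
    (ha : IsElliptic Ω a lmin lmax) (hl : 0 ≤ lmax) (hτ : IsConvexPartition Ω H δ τ) (hH : 0 < H)
    (hδ : 0 < δ) : ∃ b : Fin m → L2Pair d, ∀ j, b j ∈ H10 (interior (τ j)) ∧
      ∫ x in τ j, (b j).fst x = 1 ∧
      energyInner a (τ j) (b j) (b j) ≤
        lmax * (bumpConst d δ / H) ^ 2 / volume.real (τ j) := by
  choose b hb using exists_cell_bump hd hΩb ha hl hτ hH hδ
  refine ⟨b, fun j => ⟨(hb j).1, (hb j).2.1, (hb j).2.2.trans (le_of_eq ?_)⟩⟩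
  unfold bumpConst
  congr 3
  field_simp

theorem integral_sum_smul_bumps (hΩb : Bornology.IsBounded Ω) (hτ : IsConvexPartition Ω H δ τ)
    {b : Fin m → L2Pair d} (hb : ∀ j, b j ∈ H10 (interior (τ j)))
    (hb1 : ∀ j, ∫ x in τ j, (b j).fst x = 1) (c : Fin m → ℝ) (k : Fin m) :
    ∫ x in τ k, (∑ j, c j • b j).fst x = c k := by
  have h := map_sum (integralForm (τ k) (hτ.volume_ne_top hΩb k)) (fun j => c j • b j) Finset.univ
  rw [integralForm_apply] at h
  rw [h, Finset.sum_eq_single k]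
  · rw [map_smul, integralForm_apply, hb1, smul_eq_mul, mul_one]
  · intro j _ hj
    rw [map_smul, integralForm_apply, hτ.setIntegral_eq_zero_of_mem_H10 hj (hb j), smul_zero]
  · simp

/-- The positive part of dist - 3H/2, mollified at scale H/4. It vanishes for dist < 5H/4, in
particular on the cell of x₀, and falls short of the distance by at most 7H/4. -/
theorem exists_weight (x₀ : Rd d) (α : ℝ) (hH : 0 < H) :
    ∃ θ : Rd d → ℝ, ContDiff ℝ ∞ θ ∧ (∀ x, ‖gradient θ x‖ ≤ 1) ∧
      (∀ x, dist x x₀ ≤ H → θ x = 0 ∧ gradient θ x = 0) ∧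
      (∀ x, dist x x₀ - 7 / 4 * H ≤ θ x) ∧ ContDiff ℝ ∞ (fun x => Real.exp (α * θ x) - 1) ∧
      ∀ x, gradient (fun x => Real.exp (α * θ x) - 1) x =
        (α * Real.exp (α * θ x)) • gradient θ x := by
  have hf : LipschitzWith 1 fun x : Rd d => max (dist x x₀ - 3 / 2 * H) 0 := by
    refine LipschitzWith.max_const (LipschitzWith.of_dist_le_mul fun x y => ?_) 0
    rw [dist_sub_right]
    exact (LipschitzWith.dist_left x₀).dist_le_mul x y
  obtain ⟨θ, hθ, hθ1, hθf, hθc, -⟩ := exists_smooth_approx hf (show 0 < H / 4 by positivity)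
  have h0 : ∀ x, dist x x₀ < 5 / 4 * H → θ x = 0 := fun x hx => hθc x 0 fun y hy => by
    rw [Metric.mem_ball] at hy
    have := dist_triangle y x x₀
    exact max_eq_right (by linarith)
  refine ⟨θ, hθ, hθ1, fun x hx => ⟨h0 x (by linarith), ?_⟩, fun x => ?_, ?_, fun x => ?_⟩
  · have : θ =ᶠ[nhds x] fun _ => 0 := by
      filter_upwards [Metric.isOpen_ball.mem_nhds
        (show x ∈ Metric.ball x₀ (5 / 4 * H) by rw [Metric.mem_ball]; linarith)] with y hy
      exact h0 y hy
    unfold gradient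
    rw [this.fderiv_eq]
    simp
  · have h1 := (abs_le.1 (hθf x)).1
    have h2 := le_max_left (dist x x₀ - 3 / 2 * H) 0
    linarith
  · exact ((contDiff_const.mul hθ).exp).sub contDiff_const
  · have h := (((hθ.differentiable (by simp) x).hasFDerivAt.const_mul α).exp).sub_const 1
    unfold gradient
    rw [h.fderiv, map_smul, map_smul, smul_smul, mul_comm]

/-- The exponential decay of the gamblets. -/
theorem gamblet_decay (hd : 1 ≤ d) (hΩo : IsOpen Ω) (hΩb : Bornology.IsBounded Ω)
    (ha : IsElliptic Ω a lmin lmax) (hl : 0 < lmax) (hτ : IsConvexPartition Ω H δ τ) (hH : 0 < H)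
    (hδ : 0 < δ) {i : Fin m} {x₀ : Rd d} (hx₀ : x₀ ∈ τ i) {ψ : L2Pair d}
    (hψ : IsGamblet a τ Ω i ψ) {l : ℝ} (hl0 : 0 < l)
    (hQ : Real.exp (1 / l) * (5 / 6 * Real.sqrt (lmax / lmin) * (1 + bumpConst d δ) / l) ≤ 7 / 10)
    {R : ℝ} (J : Finset (Fin m)) (hJ : ∀ j ∈ J, ∀ y ∈ τ j, R ≤ dist y x₀) :
    ∑ j ∈ J, energyInner a (τ j) ψ ψ ≤
      10 / 3 * Real.exp (-((R - 7 / 4 * H) / (l * H))) * energyInner a Ω ψ ψ := by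
  set K := bumpConst d δ
  have hK : 0 < K := bumpConst_pos hδ
  have hp := ha.pos
  obtain ⟨b, hb⟩ := exists_cell_bumps hd hΩb ha hl.le hτ hH hδ
  -- At this rate the weight exp(αθ) varies by a factor at most e^(1/l) over one cell.
  set α : ℝ := 1 / (l * H)
  have hα : 0 < α := by positivity
  obtain ⟨θ, hθ, hθ1, hθ0, hθl, hη, hgη⟩ := exists_weight x₀ α hH
  set η : Rd d → ℝ := fun x => Real.exp (α * θ x) - 1
  have hψadm := (mem_admissible_iff hτ).1 hψ.1
  rw [hΩo.interior_eq] at hψadm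
  have hψΩ := hψadm.1
  have hψ0 : ∀ j, i ≠ j → ∫ x in τ j, ψ.fst x = 0 := fun j hj => by
    rw [hψadm.2 j (hτ.subset j), if_neg hj]
  obtain ⟨w, hw, hw1, hw2⟩ := exists_mul_mem_H10 (U' := Ω) hΩo.measurableSet hΩb hη
    Set.inter_subset_left hψΩ
  set c : Fin m → ℝ := fun j => ∫ x in τ j, w.fst x
  set q : Rd d → ℝ := fun x => (ψ.snd x).ofLp ⬝ᵥ (a x *ᵥ (ψ.snd x).ofLp)
  have hq : IntegrableOn q Ω := integrableOn_energy ha hl.le ψ ψ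
  have hbd : ∀ {f : Rd d → ℝ}, Continuous f → IntegrableOn (fun x => f x * q x) Ω := by
    intro f hf
    obtain ⟨C, hC⟩ := (hΩb.isCompact_closure.image hf).isBounded.exists_norm_le
    refine Integrable.bdd_mul (c := C) hq hf.aestronglyMeasurable ?_
    filter_upwards [ae_restrict_mem hΩo.measurableSet] with x hx
    exact hC _ ⟨x, subset_closure hx, rfl⟩
  have hθc := hθ.continuous
  have hζq : IntegrableOn (fun x => Real.exp (α * θ x) * q x) Ω := hbd (by fun_prop)
  have hηq : IntegrableOn (fun x => η x * q x) Ω := hbd hη.continuous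
  have hq0 : ∀ᵐ x ∂volume.restrict Ω, 0 ≤ q x := by
    filter_upwards [ha.ae_nonneg] with x hx
    exact hx _
  have hq0' : ∀ j, ∀ᵐ x ∂volume.restrict (τ j), 0 ≤ q x := fun j =>
    ae_restrict_of_ae_restrict_of_subset (hτ.subset j) hq0
  have hmem : ∀ j, ∀ᵐ x ∂volume.restrict (τ j), x ∈ τ j := fun j =>
    ae_restrict_mem₀ (hτ.nullMeasurableSet j)
  set Z : Fin m → ℝ := fun j => ∫ x in τ j, Real.exp (α * θ x) * q x
  have hZ0 : ∀ j, 0 ≤ Z j := fun j => integral_nonneg_of_ae (by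
    filter_upwards [hq0' j] with x hx
    exact mul_nonneg (Real.exp_nonneg _) hx)
  have hZη : ∀ j, Z j = energyInner a (τ j) ψ ψ + ∫ x in τ j, η x * q x := fun j => by
    have : energyInner a (τ j) ψ ψ = ∫ x in τ j, q x := rfl
    rw [this, ← integral_add (hq.mono_set (hτ.subset j)) (hηq.mono_set (hτ.subset j))]
    refine integral_congr_ae (ae_of_all _ fun x => ?_)
    simp only [η]; ring
  -- Orthogonality of ψ to w minus its cell bumps, whose measurements all vanish, split over the
  -- cells.
  have horth : ∑ j, (energyInner a (τ j) ψ w - c j * energyInner a (τ j) ψ (b j)) = 0 := by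
    have hbΩ : ∀ j, b j ∈ H10 Ω := fun j =>
      H10_mono (interior_subset.trans (hτ.subset j)) (hb j).1
    have h := energyInner_gamblet_eq_zero hΩo hΩb ha hl.le hτ hψ
      (v := w - ∑ j, c j • b j)
      (Submodule.sub_mem _ hw (Submodule.sum_mem _ fun j _ => Submodule.smul_mem _ _ (hbΩ j)))
      (fun k => by
        have := (integralForm (τ k) (hτ.volume_ne_top hΩb k)).map_sub w (∑ j, c j • b j)
        rw [integralForm_apply, integralForm_apply, integralForm_apply,
          integral_sum_smul_bumps hΩb hτ (fun j => (hb j).1) (fun j => (hb j).2.1), sub_self] at this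
        exact this)
    rw [← energyForm_apply ha hl.le le_rfl, map_sub, map_sum] at h
    simp only [map_smul, energyForm_apply, smul_eq_mul] at h
    rw [Finset.sum_sub_distrib, ← h]
    congr 1
    · exact (hτ.setIntegral_eq_sum (integrableOn_energy ha hl.le ψ w)).symm
    · refine Finset.sum_congr rfl fun j _ => ?_
      rw [energyInner_eq_of_mem_H10 hΩo.measurableSet.nullMeasurableSet
        isOpen_interior.measurableSet interior_subset (hτ.subset j) ψ (hb j).1]
  have hcell : ∀ j, Z j ≤ energyInner a (τ j) ψ ψ +
      (energyInner a (τ j) ψ w - c j * energyInner a (τ j) ψ (b j)) + 7 / 10 * Z j := by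
    intro j
    -- On its own cell ψ has integral one, so the mean-zero estimates are not available; but η and
    -- its gradient vanish there.
    by_cases hij : i = j
    · subst hij
      have hθi : ∀ x ∈ τ i, θ x = 0 ∧ gradient θ x = 0 := fun x hx =>
        hθ0 x (hτ.dist_le hΩb i hx hx₀)
      have h1 : c i = 0 := by
        refine integral_eq_zero_of_ae ?_
        filter_upwards [ae_restrict_of_ae hw1, hmem i] with x h1 h2
        rw [h1]
        simp [η, (hθi x h2).1]
      have h2 : energyInner a (τ i) ψ w = 0 := by
        refine integral_eq_zero_of_ae ?_
        filter_upwards [ae_restrict_of_ae hw2, hmem i] with x h1 h2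
        rw [h1, hgη, (hθi x h2).2]
        simp [η, (hθi x h2).1]
      have h3 : ∫ x in τ i, η x * q x = 0 := by
        refine integral_eq_zero_of_ae ?_
        filter_upwards [hmem i] with x h2
        simp [η, (hθi x h2).1]
      rw [h1, h2, hZη i, h3]
      have := energyInner_self_nonneg ha (hτ.subset i) ψ
      linarith
    · have hlip : ∀ x y, |θ y - θ x| ≤ 1 * ‖y - x‖ := fun x y =>
        norm_sub_le_of_gradient_le hθ convex_univ (fun x _ => hθ1 x) (Set.mem_univ x)
          (Set.mem_univ y)
      have hθH : ∀ x ∈ τ j, ∀ y ∈ τ j, θ y ≤ θ x + H := fun x hx y hy => by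
        have h1 := (le_abs_self _).trans (hlip x y)
        have h2 := hτ.dist_le hΩb j hy hx
        rw [dist_eq_norm] at h2
        linarith
      obtain ⟨y₀, hy₀⟩ := hτ.nonempty hH hδ j
      have hbdd : BddAbove (θ '' τ j) := ⟨θ y₀ + H, by
        rintro _ ⟨y, hy, rfl⟩; exact hθH y₀ hy₀ y hy⟩
      -- With s = exp(αM), the gradient of η is at most αs on the cell, while s is at most e^(1/l)
      -- times the weight at every point. This converts the unweighted cell errors into the weighted
      -- energy Z j.
      set M := sSup (θ '' τ j)
      have hM1 : ∀ x ∈ τ j, θ x ≤ M := fun x hx => le_csSup hbdd ⟨x, hx, rfl⟩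
      have hM2 : ∀ x ∈ τ j, M ≤ θ x + H := fun x hx => csSup_le ⟨_, y₀, hy₀, rfl⟩ (by
        rintro _ ⟨y, hy, rfl⟩; exact hθH x hx y hy)
      set s := Real.exp (α * M)
      have hs : 0 < s := Real.exp_pos _
      have hG : ∀ x ∈ τ j, ‖gradient η x‖ ≤ α * s := fun x hx => by
        rw [hgη, norm_smul, Real.norm_of_nonneg (by positivity)]
        have h1 : Real.exp (α * θ x) ≤ s := Real.exp_le_exp.2 (by gcongr; exact hM1 x hx)
        calc α * Real.exp (α * θ x) * ‖gradient θ x‖ ≤ α * s * 1 := by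
              gcongr
              exact hθ1 x
          _ = α * s := mul_one _
      have h1 := le_energyInner_mul hΩb ha hl hτ hH hδ hψΩ (hψ0 j hij) hη hG hw2 (by positivity)
        (hηq.mono_set (hτ.subset j))
      have h2 := abs_setIntegral_mul_energyNorm_le hΩb ha hl hτ hH hδ hψΩ (hψ0 j hij) hη hG hw1
        hK.le (hb j).2.2
      set e := energyInner a (τ j) ψ ψ
      have he : 0 ≤ e := energyInner_self_nonneg ha (hτ.subset j) ψ
      have h3 : c j * energyInner a (τ j) ψ (b j) ≤
          α * s * (5 / 6) * H * Real.sqrt (lmax / lmin) * K * e := by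
        calc c j * energyInner a (τ j) ψ (b j) ≤ |c j| * |energyInner a (τ j) ψ (b j)| := by
              rw [← abs_mul]; exact le_abs_self _
          _ ≤ |c j| * (energyNorm a (τ j) ψ * energyNorm a (τ j) (b j)) := by
              gcongr
              exact abs_energyInner_le ha hl.le (hτ.subset j) _ _
          _ = (|c j| * energyNorm a (τ j) (b j)) * energyNorm a (τ j) ψ := by ring
          _ ≤ (α * s * (5 / 6) * H * Real.sqrt (lmax / lmin) * K * energyNorm a (τ j) ψ) *
              energyNorm a (τ j) ψ := by
              exact mul_le_mul_of_nonneg_right h2 (energyNorm_nonneg _)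
          _ = α * s * (5 / 6) * H * Real.sqrt (lmax / lmin) * K * energyNorm a (τ j) ψ ^ 2 := by
              ring
          _ = _ := by rw [energyNorm_sq ha (hτ.subset j)]
      have h4 : s * e ≤ Real.exp (1 / l) * Z j := by
        have hZs : ∫ x in τ j, s * q x ≤ ∫ x in τ j, Real.exp (1 / l) *
            (Real.exp (α * θ x) * q x) := by
          refine integral_mono_ae ((hq.mono_set (hτ.subset j)).const_mul _)
            ((hζq.mono_set (hτ.subset j)).const_mul _) ?_
          filter_upwards [hmem j, hq0' j] with x hx hx0
          show s * q x ≤ _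
          rw [← mul_assoc, ← Real.exp_add]
          refine mul_le_mul_of_nonneg_right (Real.exp_le_exp.2 ?_) hx0
          have h5 : α * M ≤ α * (θ x + H) := by gcongr; exact hM2 x hx
          have h6 : α * H = 1 / l := by simp only [α]; field_simp
          linarith
        rw [integral_const_mul, integral_const_mul] at hZs
        exact hZs
      have h5 : α * s * (5 / 6) * H * Real.sqrt (lmax / lmin) * e +
          α * s * (5 / 6) * H * Real.sqrt (lmax / lmin) * K * e ≤ 7 / 10 * Z j := by
        have e1 : α * s * (5 / 6) * H * Real.sqrt (lmax / lmin) * e +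
          α * s * (5 / 6) * H * Real.sqrt (lmax / lmin) * K * e =
          (5 / 6 * Real.sqrt (lmax / lmin) * (1 + K) / l) * (s * e) := by
          simp only [α]; field_simp
        rw [e1]
        calc (5 / 6 * Real.sqrt (lmax / lmin) * (1 + K) / l) * (s * e)
            ≤ (5 / 6 * Real.sqrt (lmax / lmin) * (1 + K) / l) * (Real.exp (1 / l) * Z j) := by
              gcongr
          _ = (Real.exp (1 / l) * (5 / 6 * Real.sqrt (lmax / lmin) * (1 + K) / l)) * Z j := by ring
          _ ≤ 7 / 10 * Z j := mul_le_mul_of_nonneg_right hQ (hZ0 j)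
      rw [hZη j] at h5 ⊢
      linarith
  -- The middle terms of `hcell` sum to zero by `horth`; absorbing the factor 7/10 leaves the
  -- constant 10/3.
  have hsum : ∑ j, Z j ≤ energyInner a Ω ψ ψ + 7 / 10 * ∑ j, Z j := by
    have h1 := Finset.sum_le_sum fun j (_ : j ∈ Finset.univ) => hcell j
    rw [Finset.sum_add_distrib, Finset.sum_add_distrib, horth, ← Finset.mul_sum] at h1
    have h2 : energyInner a Ω ψ ψ = ∑ j, energyInner a (τ j) ψ ψ := hτ.setIntegral_eq_sum hq
    linarith
  have hJZ : ∀ j ∈ J, energyInner a (τ j) ψ ψ ≤ Real.exp (-((R - 7 / 4 * H) / (l * H))) * Z j := by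
    intro j hj
    have e1 : energyInner a (τ j) ψ ψ = ∫ x in τ j, q x := rfl
    rw [e1, ← integral_const_mul]
    refine integral_mono_ae (hq.mono_set (hτ.subset j))
      ((hζq.mono_set (hτ.subset j)).const_mul _) ?_
    filter_upwards [hmem j, hq0' j] with x hx hx0
    show q x ≤ _
    rw [← mul_assoc, ← Real.exp_add]
    refine le_mul_of_one_le_left hx0 (Real.one_le_exp ?_)
    have h1 : α * (R - 7 / 4 * H) ≤ α * θ x := by
      gcongr
      linarith [hθl x, hJ j hj x hx]
    have h2 : (R - 7 / 4 * H) / (l * H) = α * (R - 7 / 4 * H) := by simp only [α]; ring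
    linarith
  calc ∑ j ∈ J, energyInner a (τ j) ψ ψ
      ≤ ∑ j ∈ J, Real.exp (-((R - 7 / 4 * H) / (l * H))) * Z j := Finset.sum_le_sum hJZ
    _ = Real.exp (-((R - 7 / 4 * H) / (l * H))) * ∑ j ∈ J, Z j := by rw [Finset.mul_sum]
    _ ≤ Real.exp (-((R - 7 / 4 * H) / (l * H))) * ∑ j, Z j := by
      exact mul_le_mul_of_nonneg_left
        (Finset.sum_le_sum_of_subset_of_nonneg (Finset.subset_univ _) fun j _ _ => hZ0 j)
        (Real.exp_nonneg _)
    _ ≤ Real.exp (-((R - 7 / 4 * H) / (l * H))) * (10 / 3 * energyInner a Ω ψ ψ) := by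
      gcongr
      linarith
    _ = _ := by ring

end

/-! ### Localization: best approximation on the patch, and a cutoff competitor. -/

section

variable {d m : ℕ} {Ω : Set (Rd d)} {a : Rd d → Matrix (Fin d) (Fin d) ℝ} {lmin lmax H δ : ℝ}
  {τ : Fin m → Set (Rd d)}

theorem patch_subset (hτ : IsConvexPartition Ω H δ τ) (y : Rd d) (r : ℝ) : patch τ y r ⊆ Ω :=
  Set.iUnion₂_subset fun j _ => hτ.subset j

theorem subset_patch {y : Rd d} {r : ℝ} {j : Fin m} (h : (τ j ∩ Metric.ball y r).Nonempty) :
    τ j ⊆ patch τ y r := Set.subset_biUnion_of_mem (u := τ) h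

theorem inter_ball_subset_patch (hτ : IsConvexPartition Ω H δ τ) (y : Rd d) (r : ℝ) :
    Ω ∩ Metric.ball y r ⊆ patch τ y r := by
  rintro z ⟨hz, hzb⟩
  rw [← hτ.iUnion_eq] at hz
  obtain ⟨j, hj⟩ := Set.mem_iUnion.1 hz
  exact subset_patch ⟨z, hj, hzb⟩ hj

theorem disjoint_patch (hτ : IsConvexPartition Ω H δ τ) {y : Rd d} {r : ℝ} {j : Fin m}
    (h : ¬(τ j ∩ Metric.ball y r).Nonempty) : Disjoint (τ j) (patch τ y r) := by
  refine Set.disjoint_iUnion₂_right.2 fun k hk => hτ.disjoint ?_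
  rintro rfl
  exact h hk

theorem energyInner_sub_self_comm (ha : IsElliptic Ω a lmin lmax) (hl : 0 ≤ lmax) {S : Set (Rd d)}
    (hS : S ⊆ Ω) (v w : L2Pair d) : energyNorm a S (v - w) = energyNorm a S (w - v) := by
  have h := energyNorm_smul (-1) ha hl hS (w - v)
  rw [neg_one_smul, neg_sub, abs_neg, abs_one, one_mul] at h
  exact h

section Localization

variable (hΩo : IsOpen Ω) (hΩb : Bornology.IsBounded Ω) (ha : IsElliptic Ω a lmin lmax)
  (hl : 0 < lmax) (hτ : IsConvexPartition Ω H δ τ) (hH : 0 < H) (hδ : 0 < δ) {i : Fin m}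
  {x₀ : Rd d} (hx₀ : x₀ ∈ τ i) {ψ ψloc : L2Pair d} (hψ : IsGamblet a τ Ω i ψ) {r : ℝ} (hr : 0 < r)
  (hψloc : IsGamblet a τ (patch τ x₀ r) i ψloc)

include hΩo hΩb ha hl hτ hx₀ hψ hr in
/-- Pythagoras: the energy of an admissible function on the patch. -/
theorem energyInner_eq_add_of_mem_admissible_patch {χ : L2Pair d}
    (hχ : χ ∈ admissible τ (patch τ x₀ r) i) :
    energyInner a (patch τ x₀ r) χ χ =
      energyInner a Ω ψ ψ + energyInner a Ω (χ - ψ) (χ - ψ) := by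
  have hSΩ := patch_subset hτ x₀ r
  rw [mem_admissible_iff hτ] at hχ
  have hψadm := (mem_admissible_iff hτ).1 hψ.1
  rw [hΩo.interior_eq] at hψadm
  have hχΩ : χ ∈ H10 Ω := H10_mono (interior_subset.trans hSΩ) hχ.1
  have horth := energyInner_gamblet_eq_zero hΩo hΩb ha hl.le hτ hψ (v := χ - ψ)
    (Submodule.sub_mem _ hχΩ hψadm.1) (fun j => by
      have h := (integralForm (τ j) (hτ.volume_ne_top hΩb j)).map_sub χ ψ
      rw [integralForm_apply, integralForm_apply, integralForm_apply, hψadm.2 j (hτ.subset j)] at h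
      rw [h, sub_eq_zero]
      -- On a cell that misses the ball, χ is zero almost everywhere and ψ has zero integral,
      -- because the cell i contains the centre x₀ and so meets the ball.
      by_cases hj : (τ j ∩ Metric.ball x₀ r).Nonempty
      · exact hχ.2 j (subset_patch hj)
      · have hij : i ≠ j := by
          rintro rfl
          exact hj ⟨x₀, hx₀, Metric.mem_ball_self hr⟩
        rw [if_neg hij]
        refine setIntegral_eq_zero_of_ae_eq_zero ?_
        filter_upwards [fst_ae_eq_zero_of_mem_H10 isOpen_interior.measurableSet hχ.1] with x hx hxj
        exact hx fun hxS => (disjoint_patch hτ hj).le_bot ⟨hxj, interior_subset hxS⟩)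
  rw [← energyInner_eq_of_mem_H10 hΩo.measurableSet.nullMeasurableSet
    isOpen_interior.measurableSet interior_subset hSΩ χ hχ.1]
  have h := energyInner_add_self ha hl.le le_rfl ψ (χ - ψ)
  rw [horth, add_sub_cancel] at h
  rw [h]
  ring

-- Pythagoras for χ and for the localized gamblet: minimal energy on the patch is the same as
-- minimal energy distance to ψ.
include hΩo hΩb ha hl hτ hx₀ hψ hr hψloc in
theorem energyNorm_sub_le_of_admissible {χ : L2Pair d}
    (hχ : χ ∈ admissible τ (patch τ x₀ r) i) :
    energyNorm a Ω (ψ - ψloc) ≤ energyNorm a Ω (χ - ψ) := by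
  have h1 := energyInner_eq_add_of_mem_admissible_patch hΩo hΩb ha hl hτ hx₀ hψ hr hχ
  have h2 := energyInner_eq_add_of_mem_admissible_patch hΩo hΩb ha hl hτ hx₀ hψ hr hψloc.1
  have h3 := pow_le_pow_left₀ (energyNorm_nonneg _) (hψloc.2 χ hχ) 2
  rw [energyNorm_sq ha (patch_subset hτ x₀ r), energyNorm_sq ha (patch_subset hτ x₀ r)] at h3
  rw [energyInner_sub_self_comm ha hl.le le_rfl]
  exact Real.sqrt_le_sqrt (by linarith)

-- A crude form, in which the energy of ψ is dropped. Applied to a single cell bump it handles small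
-- r, where there is no room for a cutoff.
include hΩo hΩb ha hl hτ hx₀ hψ hr hψloc in
theorem energyNorm_sub_le_of_admissible' {χ : L2Pair d}
    (hχ : χ ∈ admissible τ (patch τ x₀ r) i) :
    energyNorm a Ω (ψ - ψloc) ≤ energyNorm a (patch τ x₀ r) χ := by
  have h1 := energyInner_eq_add_of_mem_admissible_patch hΩo hΩb ha hl hτ hx₀ hψ hr hχ
  have h2 := energyInner_self_nonneg ha le_rfl ψ
  refine (energyNorm_sub_le_of_admissible hΩo hΩb ha hl hτ hx₀ hψ hr hψloc hχ).trans ?_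
  exact Real.sqrt_le_sqrt (by linarith)

include hΩo hΩb ha hl hτ hx₀ hψ hr hψloc in
/-- If the patch is the whole domain there is no localization error. -/
theorem energyNorm_sub_eq_zero (hΩr : ∀ y ∈ Ω, dist y x₀ < r) :
    energyNorm a Ω (ψ - ψloc) = 0 := by
  have hS : patch τ x₀ r = Ω := (patch_subset hτ x₀ r).antisymm fun y hy =>
    inter_ball_subset_patch hτ x₀ r ⟨hy, hΩr y hy⟩
  have h := energyNorm_sub_le_of_admissible hΩo hΩb ha hl hτ hx₀ hψ hr hψloc
    (χ := ψ) (by rw [hS]; exact hψ.1)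
  have h0 : energyNorm a Ω (ψ - ψ) = 0 := by
    have := energyNorm_smul 0 ha hl.le le_rfl (S := Ω) (ψ - ψ)
    rwa [zero_smul, abs_zero, zero_mul, ← sub_self ψ] at this
  rw [h0] at h
  exact h.antisymm (energyNorm_nonneg _)

include hτ in
theorem bump_mem_admissible {S : Set (Rd d)} (hS : τ i ⊆ S) {b : L2Pair d}
    (hb : b ∈ H10 (interior (τ i))) (hb1 : ∫ x in τ i, b.fst x = 1) : b ∈ admissible τ S i := by
  rw [mem_admissible_iff hτ]
  refine ⟨H10_mono (interior_mono hS) hb, fun j _ => ?_⟩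
  by_cases hij : i = j
  · subst hij
    rw [hb1, if_pos rfl]
  · rw [if_neg hij, hτ.setIntegral_eq_zero_of_mem_H10 hij hb]

/-- A ramp from distance r - 2H to r - H, of slope 1/H, mollified at scale H/4. It reaches 1
strictly inside the ball of radius r, so the support of 1 - η stays in that ball. -/
theorem exists_cutoff (x₀ : Rd d) (hH : 0 < H) (r : ℝ) :
    ∃ η : Rd d → ℝ, ContDiff ℝ ∞ η ∧ (∀ x, ‖gradient η x‖ ≤ 1 / H) ∧ (∀ x, |η x| ≤ 1) ∧
      (∀ x, dist x x₀ < r - 9 / 4 * H → η x = 0 ∧ gradient η x = 0) ∧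
      (∀ x, r - 3 / 4 * H ≤ dist x x₀ → η x = 1) := by
  have hf : LipschitzWith 1 fun x : Rd d => min (max (dist x x₀ - (r - 2 * H)) 0) H := by
    refine LipschitzWith.min_const (LipschitzWith.max_const
      (LipschitzWith.of_dist_le_mul fun x y => ?_) 0) H
    rw [dist_sub_right]
    exact (LipschitzWith.dist_left x₀).dist_le_mul x y
  obtain ⟨g, hg, hg1, -, hgc, hgI⟩ := exists_smooth_approx hf (show 0 < H / 4 by positivity)
  have hI := hgI 0 H fun y => ⟨le_min (le_max_right _ _) hH.le, min_le_right _ _⟩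
  have h0 : ∀ x, dist x x₀ < r - 9 / 4 * H → g x = 0 := fun x hx => hgc x 0 fun y hy => by
    rw [Metric.mem_ball] at hy
    have := dist_triangle y x x₀
    rw [max_eq_right (by linarith), min_eq_left hH.le]
  have hgr : ∀ x, gradient (fun x => 1 / H * g x) x = (1 / H) • gradient g x :=
    gradient_const_mul_apply hg _
  refine ⟨fun x => 1 / H * g x, contDiff_const.mul hg, fun x => ?_, fun x => ?_, fun x hx => ?_,
    fun x hx => ?_⟩
  · rw [hgr, norm_smul, Real.norm_of_nonneg (by positivity)]
    exact mul_le_of_le_one_right (by positivity) (hg1 x)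
  · have := hI x
    rw [abs_of_nonneg (mul_nonneg (by positivity) this.1), one_div, inv_mul_le_one₀ hH]
    exact this.2
  · refine ⟨by simp [h0 x hx], ?_⟩
    have : g =ᶠ[nhds x] fun _ => 0 := by
      filter_upwards [Metric.isOpen_ball.mem_nhds
        (show x ∈ Metric.ball x₀ (r - 9 / 4 * H) from hx)] with y hy
      exact h0 y hy
    rw [hgr]
    unfold gradient
    rw [this.fderiv_eq]
    simp
  · have h1 : g x = H := hgc x H fun y hy => by
      rw [Metric.mem_ball'] at hy
      have := dist_triangle x y x₀
      exact min_eq_right (le_max_of_le_left (by linarith))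
    show 1 / H * g x = 1
    rw [h1]
    field_simp

include hΩo hΩb ha hl hτ hH hδ hx₀ hψ hr hψloc in
/-- The localization error is bounded by the energy of the gamblet away from its centre. -/
theorem energyNorm_sub_le_far (hd : 1 ≤ d) (hrH : 6 * H ≤ r) :
    ∃ J : Finset (Fin m), (∀ j ∈ J, ∀ y ∈ τ j, r - 13 / 4 * H ≤ dist y x₀) ∧
      energyNorm a Ω (ψ - ψloc) ≤
        (1 + 5 / 6 * Real.sqrt (lmax / lmin) * (1 + bumpConst d δ)) *
          Real.sqrt (∑ j ∈ J, energyInner a (τ j) ψ ψ) := by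
  classical
  set K := bumpConst d δ
  have hK : 0 < K := bumpConst_pos hδ
  set S := patch τ x₀ r
  have hSΩ : S ⊆ Ω := patch_subset hτ x₀ r
  obtain ⟨b, hb⟩ := exists_cell_bumps hd hΩb ha hl.le hτ hH hδ
  obtain ⟨η, hη, hη1, hηb, hη0, hηone⟩ := exists_cutoff x₀ hH r
  have hψadm := (mem_admissible_iff hτ).1 hψ.1
  rw [hΩo.interior_eq] at hψadm
  have hη' : ContDiff ℝ ∞ fun x => 1 + (-1) * η x := contDiff_const.add (contDiff_const.mul hη)
  have hgη' : ∀ x, gradient (fun x => 1 + (-1) * η x) x = -gradient η x := fun x => by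
    rw [gradient_add_apply contDiff_const (contDiff_const.mul hη), gradient_const_mul_apply hη]
    simp [gradient]
  have hsupp : Ω ∩ tsupport (fun x => 1 + (-1) * η x) ⊆ interior S := by
    have h1 : tsupport (fun x => 1 + (-1) * η x) ⊆ Metric.closedBall x₀ (r - 3 / 4 * H) := by
      refine closure_minimal (fun x hx => ?_) Metric.isClosed_closedBall
      by_contra h
      rw [Metric.mem_closedBall, not_le] at h
      exact hx (by simp [hηone x h.le])
    refine (Set.inter_subset_inter_right Ω (h1.trans
      (Metric.closedBall_subset_ball (show r - 3 / 4 * H < r by linarith)))).trans ?_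
    exact interior_maximal (inter_ball_subset_patch hτ x₀ r) (hΩo.inter Metric.isOpen_ball)
  obtain ⟨w', hw', hw1', hw2'⟩ := exists_mul_mem_H10 hΩo.measurableSet hΩb hη' hsupp hψadm.1
  set w := ψ - w'
  have hw1 : w.fst =ᵐ[volume] fun x => η x * ψ.fst x := by
    filter_upwards [Lp.coeFn_sub ψ.fst w'.fst, hw1'] with x h1 h2
    refine h1.trans ?_
    rw [Pi.sub_apply, h2]
    ring
  have hw2 : w.snd =ᵐ[volume] fun x => η x • ψ.snd x + ψ.fst x • gradient η x := by
    filter_upwards [Lp.coeFn_sub ψ.snd w'.snd, hw2'] with x h1 h2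
    refine h1.trans ?_
    rw [Pi.sub_apply, h2, hgη']
    module
  -- Only cells of the patch are corrected: elsewhere there is no constraint, and the bumps would
  -- leave H¹₀ of the patch.
  set c : Fin m → ℝ := fun j =>
    if (τ j ∩ Metric.ball x₀ r).Nonempty then ∫ x in τ j, w.fst x else 0
  have hc : ∀ j, |c j| ≤ |∫ x in τ j, w.fst x| := fun j => by
    simp only [c]
    split_ifs
    · exact le_rfl
    · simp
  set χ := w' + ∑ j, c j • b j
  have hχ : χ ∈ admissible τ S i := by
    rw [mem_admissible_iff hτ]
    refine ⟨Submodule.add_mem _ hw' (Submodule.sum_mem _ fun j _ => ?_), fun k hk => ?_⟩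
    · by_cases hj : (τ j ∩ Metric.ball x₀ r).Nonempty
      · exact Submodule.smul_mem _ _ (H10_mono (interior_mono (subset_patch hj)) (hb j).1)
      · simp only [c, if_neg hj, zero_smul]
        exact Submodule.zero_mem _
    · have hkJ : (τ k ∩ Metric.ball x₀ r).Nonempty := by
        by_contra h
        obtain ⟨y, hy⟩ := hτ.nonempty hH hδ k
        exact (disjoint_patch hτ h).le_bot ⟨hy, hk hy⟩
      have h1 := (integralForm (τ k) (hτ.volume_ne_top hΩb k)).map_add w' (∑ j, c j • b j)
      have h2 := (integralForm (τ k) (hτ.volume_ne_top hΩb k)).map_sub ψ w'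
      rw [integralForm_apply, integralForm_apply, integralForm_apply] at h1 h2
      rw [integral_sum_smul_bumps hΩb hτ (fun j => (hb j).1) (fun j => (hb j).2.1)] at h1
      rw [hψadm.2 k (hτ.subset k)] at h2
      have h3 : c k = ∫ x in τ k, w.fst x := if_pos hkJ
      rw [h1, h3, h2]
      ring
  set D := w - ∑ j, c j • b j
  have hχD : energyNorm a Ω (χ - ψ) = energyNorm a Ω D := by
    rw [energyInner_sub_self_comm ha hl.le le_rfl]
    congr 1
    simp only [D, χ, w]
    abel
  have hbk : ∀ k, energyNorm a (τ k) (∑ j, c j • b j) ≤ |c k| * energyNorm a (τ k) (b k) := by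
    intro k
    refine (energyNorm_sum_le _ ha hl.le (hτ.subset k) _).trans (le_of_eq ?_)
    rw [Finset.sum_eq_single k]
    · exact energyNorm_smul _ ha hl.le (hτ.subset k) _
    · intro j _ hjk
      rw [energyNorm_smul _ ha hl.le (hτ.subset k)]
      have : energyInner a (τ k) (b j) (b j) = 0 := by
        refine setIntegral_eq_zero_of_ae_eq_zero ?_
        filter_upwards [snd_ae_eq_zero_of_mem_H10 isOpen_interior.measurableSet (hb j).1]
          with x hx hxk
        rw [hx fun hxj => (hτ.disjoint hjk).le_bot ⟨interior_subset hxj, hxk⟩]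
        simp
      simp [energyNorm, this]
    · simp
  have hDk : ∀ k, energyNorm a (τ k) D ≤
      energyNorm a (τ k) w + |∫ x in τ k, w.fst x| * energyNorm a (τ k) (b k) := by
    intro k
    have h1 := energyNorm_add_le ha hl.le (hτ.subset k) w ((-1 : ℝ) • ∑ j, c j • b j)
    rw [energyNorm_smul _ ha hl.le (hτ.subset k), abs_neg, abs_one, one_mul, neg_one_smul,
      ← sub_eq_add_neg] at h1
    refine h1.trans ?_
    gcongr
    exact (hbk k).trans (mul_le_mul_of_nonneg_right (hc k) (energyNorm_nonneg _))
  -- The cells that reach the region where η may be nonzero. One cell diameter turns 9/4 into 13/4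
  -- for all their points.
  set J : Finset (Fin m) := Finset.univ.filter fun j => ∃ y ∈ τ j, r - 9 / 4 * H ≤ dist y x₀
  have hJ : ∀ j ∈ J, ∀ y ∈ τ j, r - 13 / 4 * H ≤ dist y x₀ := fun j hj y hy => by
    obtain ⟨z, hz, hzr⟩ := (Finset.mem_filter.1 hj).2
    have h1 := hτ.dist_le hΩb j hz hy
    have h2 := dist_triangle z y x₀
    linarith
  refine ⟨J, hJ, ?_⟩
  set T := 1 + 5 / 6 * Real.sqrt (lmax / lmin) * (1 + K)
  have hp := ha.pos
  have hT : 0 ≤ T := by positivity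
  have hnear : ∀ k ∉ J, energyInner a (τ k) D D = 0 := by
    intro k hk
    have hk' : ∀ y ∈ τ k, dist y x₀ < r - 9 / 4 * H := fun y hy => by
      by_contra h
      exact hk (Finset.mem_filter.2 ⟨Finset.mem_univ _, y, hy, not_lt.1 h⟩)
    have h1 : ∫ x in τ k, w.fst x = 0 := by
      refine setIntegral_eq_zero_of_ae_eq_zero ?_
      filter_upwards [hw1] with x hx hxk
      rw [hx, (hη0 x (hk' x hxk)).1, zero_mul]
    have h2 : energyInner a (τ k) w w = 0 := by
      refine setIntegral_eq_zero_of_ae_eq_zero ?_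
      filter_upwards [hw2] with x hx hxk
      rw [hx, (hη0 x (hk' x hxk)).1, (hη0 x (hk' x hxk)).2]
      simp
    have h3 := hDk k
    rw [h1, energyNorm, energyNorm, h2, Real.sqrt_zero, abs_zero, zero_mul, add_zero] at h3
    exact le_antisymm (Real.sqrt_eq_zero'.1 (h3.antisymm (Real.sqrt_nonneg _)))
      (energyInner_self_nonneg ha (hτ.subset k) D)
  have hfar : ∀ k ∈ J, energyInner a (τ k) D D ≤ T ^ 2 * energyInner a (τ k) ψ ψ := by
    intro k hk
    -- The i-th cell is not in J because 6H ≤ r makes r - 13H/4 positive; hence ψ has mean zero on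
    -- every cell of J.
    have hik : i ≠ k := by
      rintro rfl
      have := hJ i hk x₀ hx₀
      rw [dist_self] at this
      linarith
    have hψ0 : ∫ x in τ k, ψ.fst x = 0 := by rw [hψadm.2 k (hτ.subset k), if_neg hik]
    have h1 := energyNorm_mul_le hΩb ha hl hτ hH hδ hψadm.1 hψ0 hη (fun x _ => hη1 x) hw2
      (by positivity) (fun x _ => hηb x)
    have h2 := abs_setIntegral_mul_energyNorm_le hΩb ha hl hτ hH hδ hψadm.1 hψ0 hη
      (fun x _ => hη1 x) hw1 hK.le (hb k).2.2
    have e1 : 1 / H * (5 / 6) * H * Real.sqrt (lmax / lmin) = 5 / 6 * Real.sqrt (lmax / lmin) := by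
      field_simp
    rw [e1] at h1 h2
    have h3 : energyNorm a (τ k) D ≤ T * energyNorm a (τ k) ψ := by
      refine (hDk k).trans ((add_le_add h1 h2).trans (le_of_eq ?_))
      simp only [T]
      ring
    have h4 := pow_le_pow_left₀ (energyNorm_nonneg _) h3 2
    rwa [mul_pow, energyNorm_sq ha (hτ.subset k), energyNorm_sq ha (hτ.subset k)] at h4
  refine (energyNorm_sub_le_of_admissible hΩo hΩb ha hl hτ hx₀ hψ hr hψloc hχ).trans ?_
  rw [hχD, energyNorm, ← Real.sqrt_sq hT, ← Real.sqrt_mul (sq_nonneg T)]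
  refine Real.sqrt_le_sqrt ?_
  have h5 : energyInner a Ω D D = ∑ k, energyInner a (τ k) D D :=
    hτ.setIntegral_eq_sum (integrableOn_energy ha hl.le D D)
  rw [h5, ← Finset.sum_subset (Finset.subset_univ J) fun k _ hk => hnear k hk, Finset.mul_sum]
  exact Finset.sum_le_sum hfar

end Localization

end

/-! ### Numerical constants. -/

section

theorem rpow_one_add_half {x : ℝ} (hx : 0 ≤ x) (d : ℕ) :
    x ^ (1 + (d : ℝ) / 2) = Real.sqrt (x ^ (d + 2)) := by
  rw [Real.sqrt_eq_rpow, ← Real.rpow_natCast, ← Real.rpow_mul hx]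
  congr 1
  push_cast
  ring

/-- Equality holds at d = 2, where the induction starts; d = 1 is separate. -/
theorem sq_succ_le {d : ℕ} (hd : 1 ≤ d) : ((d : ℝ) + 1) ^ 2 ≤ 9 / 4 * 2 ^ d := by
  rcases hd.eq_or_lt with rfl | hd
  · norm_num
  induction d, hd using Nat.le_induction with
  | base => norm_num
  | succ n hn ih =>
    have : (2 : ℝ) ≤ n := by exact_mod_cast hn
    rw [pow_succ (2 : ℝ)]
    have ih := ih (by omega)
    push_cast
    nlinarith

theorem succ_le_sqrt {d : ℕ} (hd : 1 ≤ d) : (d : ℝ) + 1 ≤ 3 / 2 * Real.sqrt (2 ^ d) := by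
  refine le_of_sq_le_sq ?_ (by positivity)
  rw [mul_pow, Real.sq_sqrt (by positivity)]
  linarith [sq_succ_le hd]

theorem exp_one_div_le {l : ℝ} (hl : 87 / 10 ≤ l) : Real.exp (1 / l) ≤ 113 / 100 := by
  have h0 : 1 / l ≤ 10 / 87 := by
    rw [div_le_div_iff₀ (by linarith) (by norm_num)]
    linarith
  have h1 := Real.add_one_le_exp (-(10 / 87 : ℝ))
  rw [Real.exp_neg] at h1
  have h2 : Real.exp (10 / 87) ≤ 113 / 100 := by
    have h3 := le_inv_of_le_inv₀ (by norm_num : (0 : ℝ) < -(10 / 87) + 1) h1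
    exact h3.trans (by norm_num)
  exact (Real.exp_le_exp.2 h0).trans h2

section Constants

variable {d : ℕ} {lmin lmax δ : ℝ} (hd : 1 ≤ d) (hmin : 0 < lmin) (hlm : lmin ≤ lmax) (hδ0 : 0 < δ)
  (hδ1 : δ < 1)

include hd hδ0 hδ1 in
theorem bumpConst_le : bumpConst d δ ≤ 33 / 20 * (2 / δ) ^ (1 + (d : ℝ) / 2) := by
  have h1 := succ_le_sqrt hd
  have h2 : 2 / δ * Real.sqrt (2 ^ d) ≤ (2 / δ) ^ (1 + (d : ℝ) / 2) := by
    rw [rpow_one_add_half (by positivity), pow_add, mul_comm,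
      Real.sqrt_mul (by positivity), Real.sqrt_sq (by positivity)]
    gcongr
    rw [le_div_iff₀ hδ0]
    linarith
  unfold bumpConst
  calc 11 / 10 * (d + 1) * (2 / δ) ≤ 11 / 10 * (3 / 2 * Real.sqrt (2 ^ d)) * (2 / δ) := by gcongr
    _ = 33 / 20 * (2 / δ * Real.sqrt (2 ^ d)) := by ring
    _ ≤ _ := by gcongr

include hd hδ0 hδ1 in
theorem le_rpow_one_add_half : 14 / 5 ≤ (2 / δ) ^ (1 + (d : ℝ) / 2) := by
  rw [rpow_one_add_half (by positivity)]
  refine Real.le_sqrt_of_sq_le ?_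
  have h1 : (2 : ℝ) ≤ 2 / δ := by
    rw [le_div_iff₀ hδ0]
    linarith
  calc (14 / 5 : ℝ) ^ 2 ≤ 2 ^ 3 := by norm_num
    _ ≤ (2 / δ) ^ 3 := by gcongr
    _ ≤ _ := pow_le_pow_right₀ (by linarith) (by omega)

include hδ0 in
theorem le_decayLength : Real.sqrt (lmax / lmin) * (173 / 200) *
    (1 + 2828 / 1000 * (2 / δ) ^ (1 + (d : ℝ) / 2)) + 1 ≤ decayLength d lmin lmax δ := by
  have h1 : (2828 / 1000 : ℝ) ≤ 2 ^ (3 / 2 : ℝ) := by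
    have := rpow_one_add_half (x := 2) (by norm_num) 1
    norm_num at this
    rw [this]
    exact Real.le_sqrt_of_sq_le (by norm_num)
  have h2 : (173 / 200 : ℝ) ≤ Real.exp 1 / Real.pi := by
    rw [le_div_iff₀ Real.pi_pos]
    linarith [Real.exp_one_gt_d9, Real.pi_lt_d4]
  unfold decayLength
  rw [add_comm, mul_comm (Real.sqrt _)]
  gcongr

include hmin hlm in
theorem one_le_sqrt_div : 1 ≤ Real.sqrt (lmax / lmin) := by
  rw [Real.one_le_sqrt, le_div_iff₀ hmin]
  linarith

include hd hmin hlm hδ0 hδ1 in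
theorem decayLength_ge : 87 / 10 ≤ decayLength d lmin lmax δ := by
  have h1 := le_decayLength (d := d) (lmin := lmin) (lmax := lmax) hδ0
  have h2 := le_rpow_one_add_half hd hδ0 hδ1
  have h3 := one_le_sqrt_div hmin hlm
  refine le_trans ?_ h1
  calc (87 / 10 : ℝ) ≤ 1 * (173 / 200) * (1 + 2828 / 1000 * (14 / 5)) + 1 := by norm_num
    _ ≤ _ := by gcongr

-- The absorption condition of `gamblet_decay`. With X = (2/δ)^(1 + d/2) and k = √(lmax/lmin), the
-- length l exceeds 0.865 · 2.828 kX, whereas the numerator grows like 1.13 · (5/6) · 1.65 kX. The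
-- gap pays for the Poincaré constant 5/6, and X ≥ 14/5 takes care of the lower-order terms.
include hd hmin hlm hδ0 hδ1 in
theorem exp_mul_div_decayLength_le : Real.exp (1 / decayLength d lmin lmax δ) *
    (5 / 6 * Real.sqrt (lmax / lmin) * (1 + bumpConst d δ) / decayLength d lmin lmax δ) ≤
      7 / 10 := by
  have h1 := le_decayLength (d := d) (lmin := lmin) (lmax := lmax) hδ0
  have h2 := le_rpow_one_add_half hd hδ0 hδ1
  have h3 := one_le_sqrt_div hmin hlm
  have h4 := decayLength_ge hd hmin hlm hδ0 hδ1
  have h5 := exp_one_div_le h4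
  have h6 := bumpConst_le hd hδ0 hδ1
  have h7 := bumpConst_pos (d := d) hδ0
  set l := decayLength d lmin lmax δ
  set X := (2 / δ) ^ (1 + (d : ℝ) / 2)
  set k := Real.sqrt (lmax / lmin)
  rw [← mul_div_assoc, div_le_iff₀ (by linarith)]
  calc _ ≤ 113 / 100 * (5 / 6 * k * (1 + 33 / 20 * X)) := by gcongr
    _ ≤ 7 / 10 * (k * (173 / 200) * (1 + 2828 / 1000 * X) + 1) := by nlinarith
    _ ≤ _ := by gcongr

/-- The bound for the energy norm of the cell bumps. -/
def bumpBound (d : ℕ) (lmax δ H : ℝ) : ℝ :=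
  33 / 10 * Real.sqrt lmax * Real.sqrt (2 ^ d) ^ 2 * H ^ (-(d : ℝ) / 2 - 1) /
    (Real.sqrt (unitBallVol d) * Real.sqrt (δ ^ (d + 2)))

/-- The constant of the localization estimate when `H ≤ 1`. -/
def sharpLocConst (d : ℕ) (lmin lmax δ H : ℝ) : ℝ :=
  256 / 3 * (lmax / Real.sqrt lmin) * Real.sqrt (2 ^ d) ^ 3 * H ^ (-(d : ℝ) / 2 - 1) /
    (Real.sqrt (unitBallVol d) * δ ^ (d + 2))

theorem unitBallVol_pos (d : ℕ) : 0 < unitBallVol d :=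
  ENNReal.toReal_pos (Metric.measure_ball_pos _ _ one_pos).ne' measure_ball_lt_top.ne

variable {H : ℝ} (hH : 0 < H)

include hH in
theorem rpow_neg_sub_one_sq (d : ℕ) : (H ^ (-(d : ℝ) / 2 - 1)) ^ 2 * H ^ (d + 2) = 1 := by
  rw [← Real.rpow_natCast, ← Real.rpow_natCast, ← Real.rpow_mul hH.le, ← Real.rpow_add hH]
  convert Real.rpow_zero H using 2
  push_cast
  ring

include hd hmin hlm hδ0 hH in
theorem sqrt_bump_energy_le {W : ℝ} (hW : (δ * H / 2) ^ d * unitBallVol d ≤ W) :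
    Real.sqrt (lmax * (bumpConst d δ / H) ^ 2 / W) ≤ bumpBound d lmax δ H := by
  have hV := unitBallVol_pos d
  have hl : 0 < lmax := hmin.trans_le hlm
  have h1 := succ_le_sqrt hd
  have hh := rpow_neg_sub_one_sq hH d
  have hh0 : 0 < H ^ (-(d : ℝ) / 2 - 1) := Real.rpow_pos_of_pos hH _
  unfold bumpBound bumpConst
  set h := H ^ (-(d : ℝ) / 2 - 1)
  refine Real.sqrt_le_iff.2 ⟨by positivity, ?_⟩
  have hh' : h ^ 2 = 1 / H ^ (d + 2) := by
    rw [eq_div_iff (by positivity), hh]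
  have hsq : (33 / 10 * Real.sqrt lmax * Real.sqrt (2 ^ d) ^ 2 * h /
      (Real.sqrt (unitBallVol d) * Real.sqrt (δ ^ (d + 2)))) ^ 2 =
      1089 / 100 * lmax * (2 ^ d) ^ 2 * (1 / H ^ (d + 2)) / (unitBallVol d * δ ^ (d + 2)) := by
    rw [div_pow, mul_pow, mul_pow, mul_pow, mul_pow, Real.sq_sqrt hl.le, Real.sq_sqrt hV.le,
      Real.sq_sqrt (by positivity), Real.sq_sqrt (by positivity), hh']
    ring
  rw [hsq]
  -- The constant 33/10 arises as (11/5)² · 9/4 = (33/10)².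
  calc lmax * (11 / 10 * (d + 1) * (2 / δ) / H) ^ 2 / W
      ≤ lmax * (11 / 10 * (d + 1) * (2 / δ) / H) ^ 2 / ((δ * H / 2) ^ d * unitBallVol d) := by
        gcongr
    _ = 121 / 25 * lmax * 2 ^ d * (d + 1) ^ 2 * (1 / H ^ (d + 2)) /
        (unitBallVol d * δ ^ (d + 2)) := by
        rw [div_pow (δ * H), mul_pow δ H]
        field_simp
        ring
    _ ≤ 121 / 25 * lmax * 2 ^ d * (9 / 4 * 2 ^ d) * (1 / H ^ (d + 2)) /
        (unitBallVol d * δ ^ (d + 2)) := by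
        gcongr
        exact sq_succ_le hd
    _ = _ := by ring

include hmin hlm in
theorem sqrt_div_mul_sqrt :
    Real.sqrt (lmax / lmin) * Real.sqrt lmax = lmax / Real.sqrt lmin := by
  have hl : 0 < lmax := hmin.trans_le hlm
  rw [Real.sqrt_div hl.le, div_mul_eq_mul_div, Real.mul_self_sqrt hl.le]

theorem one_le_sqrt_two_pow (d : ℕ) : 1 ≤ Real.sqrt (2 ^ d) :=
  Real.one_le_sqrt.2 (one_le_pow₀ one_le_two)

include hmin hlm in
theorem sqrt_le_div_sqrt : Real.sqrt lmax ≤ lmax / Real.sqrt lmin := by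
  have h := one_le_sqrt_div hmin hlm
  rw [← sqrt_div_mul_sqrt hmin hlm]
  exact le_mul_of_one_le_left (Real.sqrt_nonneg _) h

include hδ0 hδ1 in
theorem pow_le_sqrt_pow (d : ℕ) : δ ^ (d + 2) ≤ δ * Real.sqrt (δ ^ (d + 2)) := by
  have h1 : Real.sqrt (δ ^ (d + 2)) ≤ δ := by
    rw [Real.sqrt_le_left hδ0.le]
    exact pow_le_pow_of_le_one hδ0.le hδ1.le (by omega)
  have h2 : 0 ≤ Real.sqrt (δ ^ (d + 2)) := Real.sqrt_nonneg _
  calc δ ^ (d + 2) = Real.sqrt (δ ^ (d + 2)) * Real.sqrt (δ ^ (d + 2)) :=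
        (Real.mul_self_sqrt (by positivity)).symm
    _ ≤ _ := by gcongr

-- The numbers multiply to (24/5)(27/10)(33/10) = 42.768, about half of the available 256/3.
include hd hmin hlm hδ0 hδ1 hH in
theorem far_const_le : (1 + 5 / 6 * Real.sqrt (lmax / lmin) * (1 + bumpConst d δ)) *
    (27 / 10 * bumpBound d lmax δ H) ≤ sharpLocConst d lmin lmax δ H := by
  have hV := unitBallVol_pos d
  have hl : 0 < lmax := hmin.trans_le hlm
  have h1 := succ_le_sqrt hd
  have h2 : (2 : ℝ) ≤ d + 1 := by
    have : (1 : ℝ) ≤ d := by exact_mod_cast hd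
    linarith
  have hh0 : 0 < H ^ (-(d : ℝ) / 2 - 1) := Real.rpow_pos_of_pos hH _
  have h3 := one_le_sqrt_div hmin hlm
  have h4 : 1 + 5 / 6 * Real.sqrt (lmax / lmin) * (1 + bumpConst d δ) ≤
      Real.sqrt (lmax / lmin) * (24 / 5 * Real.sqrt (2 ^ d) / δ) := by
    have h5 : 2 + bumpConst d δ ≤ 24 / 5 * Real.sqrt (2 ^ d) / δ := by
      have h6 : 2 ≤ (d + 1) / δ := by
        rw [le_div_iff₀ hδ0]
        nlinarith
      have h7 : (d + 1) / δ ≤ 3 / 2 * Real.sqrt (2 ^ d) / δ := by gcongr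
      have h8 : bumpConst d δ = 11 / 5 * ((d + 1) / δ) := by
        unfold bumpConst
        ring
      rw [h8]
      have h9 : 24 / 5 * Real.sqrt (2 ^ d) / δ = 16 / 5 * (3 / 2 * Real.sqrt (2 ^ d) / δ) := by ring
      rw [h9]
      linarith
    have h6 := bumpConst_pos (d := d) hδ0
    refine le_trans ?_ (mul_le_mul_of_nonneg_left h5 (by positivity))
    nlinarith
  unfold bumpBound sharpLocConst
  set h := H ^ (-(d : ℝ) / 2 - 1)
  set s := Real.sqrt (2 ^ d) with hs
  have hs0 : 0 < s := by positivity
  have hD : 0 < Real.sqrt (δ ^ (d + 2)) := by positivity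
  calc _ ≤ (Real.sqrt (lmax / lmin) * (24 / 5 * s / δ)) * (27 / 10 * (33 / 10 * Real.sqrt lmax *
        s ^ 2 * h / (Real.sqrt (unitBallVol d) * Real.sqrt (δ ^ (d + 2))))) := by gcongr
    _ = 42.768 * (Real.sqrt (lmax / lmin) * Real.sqrt lmax) * s ^ 3 * h /
        (Real.sqrt (unitBallVol d) * (δ * Real.sqrt (δ ^ (d + 2)))) := by
        field_simp
        ring
    _ ≤ _ := by
        rw [sqrt_div_mul_sqrt hmin hlm]
        have := pow_le_sqrt_pow hδ0 hδ1 d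
        gcongr
        norm_num

include hmin hlm hδ0 hδ1 hH in
theorem bumpBound_le_sharpLocConst (d : ℕ) :
    2 * bumpBound d lmax δ H ≤ sharpLocConst d lmin lmax δ H := by
  have hV := unitBallVol_pos d
  have hl : 0 < lmax := hmin.trans_le hlm
  have hh0 : 0 < H ^ (-(d : ℝ) / 2 - 1) := Real.rpow_pos_of_pos hH _
  have hs := one_le_sqrt_two_pow d
  have h1 := sqrt_le_div_sqrt hmin hlm
  have hD : 0 < Real.sqrt (δ ^ (d + 2)) := by positivity
  have h2 : δ ^ (d + 2) ≤ Real.sqrt (δ ^ (d + 2)) :=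
    (pow_le_sqrt_pow hδ0 hδ1 d).trans (mul_le_of_le_one_left hD.le hδ1.le)
  unfold bumpBound sharpLocConst
  rw [← mul_div_assoc, ← mul_assoc, ← mul_assoc, ← mul_assoc]
  gcongr
  · norm_num
  · norm_num

theorem locConst_eq (hH : 0 < H) : locConst d lmin lmax δ H =
    512 * (lmax / Real.sqrt lmin) * Real.sqrt (2 ^ d) ^ 4 * H ^ (-(d : ℝ) / 2 - 1) /
      (Real.sqrt (unitBallVol d) * δ ^ (d + 2)) / H := by
  have h1 : H ^ (-(d : ℝ) / 2 - 2) = H ^ (-(d : ℝ) / 2 - 1) / H := by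
    rw [← Real.rpow_sub_one hH.ne']
    ring_nf
  have h2 : Real.sqrt (2 ^ d) ^ 4 = 2 ^ (2 * d) := by
    rw [show (4 : ℕ) = 2 * 2 from rfl, pow_mul, Real.sq_sqrt (by positivity), ← pow_mul, mul_comm]
  rw [locConst, h1, h2, pow_add]
  ring

include hmin hlm hδ0 hH in
theorem sharpLocConst_le (hH1 : H ≤ 1) :
    sharpLocConst d lmin lmax δ H ≤ locConst d lmin lmax δ H := by
  have hV := unitBallVol_pos d
  have hl : 0 < lmax := hmin.trans_le hlm
  have hh0 : 0 < H ^ (-(d : ℝ) / 2 - 1) := Real.rpow_pos_of_pos hH _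
  have hs := one_le_sqrt_two_pow d
  rw [locConst_eq hH]
  refine le_trans ?_ (le_div_self (by positivity) hH hH1)
  unfold sharpLocConst
  gcongr
  · norm_num
  · norm_num

-- The extra factor 1/H in C is harmful when H > 1. Passing from δ^(d + 2) to its square root leaves
-- a spare δ, and δH ≤ 1 compensates.
include hmin hlm hδ0 hδ1 hH in
theorem bumpBound_le_locConst (d : ℕ) (hHδ : δ * H ≤ 1) :
    2 * bumpBound d lmax δ H ≤ locConst d lmin lmax δ H := by
  have hV := unitBallVol_pos d
  have hl : 0 < lmax := hmin.trans_le hlm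
  have hh0 : 0 < H ^ (-(d : ℝ) / 2 - 1) := Real.rpow_pos_of_pos hH _
  have hs := one_le_sqrt_two_pow d
  have h1 := sqrt_le_div_sqrt hmin hlm
  have hD : 0 < Real.sqrt (δ ^ (d + 2)) := by positivity
  have h2 : δ ^ (d + 2) * H ≤ Real.sqrt (δ ^ (d + 2)) := by
    have := pow_le_sqrt_pow hδ0 hδ1 d
    nlinarith
  rw [locConst_eq hH, div_div, mul_assoc (Real.sqrt _)]
  unfold bumpBound
  rw [← mul_div_assoc, ← mul_assoc, ← mul_assoc, ← mul_assoc]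
  gcongr
  · norm_num
  · norm_num

-- For r ≤ 6H the exponent is at most 3/l, and e^(1/l) ≤ 1.13, so no decay has to be proved in this
-- range.
include hd hmin hlm hδ0 hδ1 hH in
theorem exp_le_two {r : ℝ} (hr : r ≤ 6 * H) :
    Real.exp (r / (2 * decayLength d lmin lmax δ * H)) ≤ 2 := by
  have h4 := decayLength_ge hd hmin hlm hδ0 hδ1
  set l := decayLength d lmin lmax δ
  have h5 := exp_one_div_le h4
  have hl0 : 0 < l := by linarith
  have h1 : r / (2 * l * H) ≤ 1 / l + 1 / l + 1 / l := by
    rw [div_le_iff₀ (by positivity)]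
    field_simp
    linarith
  refine (Real.exp_le_exp.2 h1).trans ?_
  rw [Real.exp_add, Real.exp_add]
  calc _ ≤ 113 / 100 * (113 / 100) * (113 / 100 : ℝ) := by gcongr
    _ ≤ 2 := by norm_num

-- The losses 13H/4 (cutoff and cell) and 7H/4 (weight) add to 5H. After the square root they cost
-- e^(5/(2l)) ≤ 1.45, which together with √(10/3) ≤ 1.83 stays below 27/10.
include hd hmin hlm hδ0 hδ1 hH in
theorem sqrt_mul_exp_le {r E B : ℝ} (hE : Real.sqrt E ≤ B) :
    Real.sqrt (10 / 3 * Real.exp (-((r - 13 / 4 * H - 7 / 4 * H) /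
      (decayLength d lmin lmax δ * H))) * E) ≤
        27 / 10 * B * Real.exp (-(r / (2 * decayLength d lmin lmax δ * H))) := by
  have h4 := decayLength_ge hd hmin hlm hδ0 hδ1
  set l := decayLength d lmin lmax δ
  have h5 := exp_one_div_le h4
  have hl0 : 0 < l := by linarith
  have h1 : Real.exp (-((r - 13 / 4 * H - 7 / 4 * H) / (l * H))) =
      (Real.exp (5 / (2 * l)) * Real.exp (-(r / (2 * l * H)))) ^ 2 := by
    rw [← Real.exp_add, sq, ← Real.exp_add]
    congr 1
    field_simp
    ring
  have h2 : Real.exp (5 / (2 * l)) ≤ 145 / 100 := by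
    have h1 : 5 / (2 * l) ≤ 1 / l + 1 / l + 1 / l := by
      field_simp
      norm_num
    refine (Real.exp_le_exp.2 h1).trans ?_
    rw [Real.exp_add, Real.exp_add]
    calc _ ≤ 113 / 100 * (113 / 100) * (113 / 100 : ℝ) := by gcongr
      _ ≤ _ := by norm_num
  have h3 : Real.sqrt (10 / 3) ≤ 183 / 100 := Real.sqrt_le_iff.2 ⟨by norm_num, by norm_num⟩
  have hB : 0 ≤ B := (Real.sqrt_nonneg _).trans hE
  rw [h1, Real.sqrt_mul (by positivity), Real.sqrt_mul (by norm_num), Real.sqrt_sq (by positivity)]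
  calc _ ≤ 183 / 100 * (145 / 100 * Real.exp (-(r / (2 * l * H)))) * B := by gcongr
    _ = 183 / 100 * (145 / 100) * B * Real.exp (-(r / (2 * l * H))) := by ring
    _ ≤ _ := by
      gcongr
      norm_num

include hmin hlm in
theorem one_le_div_div_pow (d : ℕ) (hδ0 : 0 < δ) (hδ1 : δ < 1) :
    1 ≤ lmax / lmin * (Real.sqrt (2 ^ d) ^ 3 / δ ^ (d + 2)) := by
  have h1 : 1 ≤ lmax / lmin := by rwa [one_le_div hmin]
  have h2 : 1 ≤ Real.sqrt (2 ^ d) ^ 3 / δ ^ (d + 2) := by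
    rw [one_le_div (by positivity)]
    exact (pow_le_one₀ hδ0.le hδ1.le).trans (one_le_pow₀ (one_le_sqrt_two_pow d))
  exact one_le_mul_of_one_le_of_one_le h1 h2

theorem radiusConst₂_eq (d : ℕ) (lmin lmax δ : ℝ) : radiusConst₂ d lmin lmax δ =
    2 * decayLength d lmin lmax δ *
      Real.log (2048 * (lmax / lmin * (Real.sqrt (2 ^ d) ^ 3 / δ ^ (d + 2)))) := by
  have h : (2 : ℝ) ^ (3 / 2 * (d : ℝ) + 11) = 2048 * Real.sqrt (2 ^ d) ^ 3 := by
    rw [Real.sqrt_eq_rpow, ← Real.rpow_natCast, ← Real.rpow_natCast, ← Real.rpow_mul (by norm_num),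
      ← Real.rpow_mul (by norm_num), Real.rpow_add (by norm_num)]
    rw [mul_comm]
    congr 1
    · norm_num
    · congr 1
      push_cast
      ring
  rw [radiusConst₂, h]
  congr 2
  ring

-- The lower bound on r makes the exponential at most H^(d/2 + 2)/(2048 M). The powers of H combine
-- to H, M cancels the remaining parameters, and (256/3)/2048 = 1/24.
include hd hmin hlm hδ0 hδ1 hH in
theorem sharpLocConst_mul_exp_le {r : ℝ}
    (hr : H * (radiusConst₁ d lmin lmax δ * Real.log (1 / H) + radiusConst₂ d lmin lmax δ) ≤ r) :
    sharpLocConst d lmin lmax δ H * Real.exp (-(r / (2 * decayLength d lmin lmax δ * H))) ≤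
      1 / 24 * Real.sqrt lmin * H / Real.sqrt (unitBallVol d) := by
  have hl := decayLength_ge hd hmin hlm hδ0 hδ1
  have hM := one_le_div_div_pow hmin hlm d hδ0 hδ1
  have hV := unitBallVol_pos d
  have hlx : 0 < lmax := hmin.trans_le hlm
  rw [radiusConst₂_eq, radiusConst₁] at hr
  set l := decayLength d lmin lmax δ
  have hh0 : 0 < H ^ (-(d : ℝ) / 2 - 1) := Real.rpow_pos_of_pos hH _
  set M := lmax / lmin * (Real.sqrt (2 ^ d) ^ 3 / δ ^ (d + 2)) with hMdef
  have h1 : Real.log (1 / H) * (d / 2 + 2) + Real.log (2048 * M) ≤ r / (2 * l * H) := by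
    rw [le_div_iff₀ (by positivity)]
    refine le_trans (le_of_eq ?_) hr
    ring
  have h2 : Real.exp (-(r / (2 * l * H))) ≤ H ^ ((d : ℝ) / 2 + 2) / (2048 * M) := by
    rw [Real.rpow_def_of_pos hH, ← Real.exp_log (show 0 < 2048 * M by positivity), ← Real.exp_sub]
    refine Real.exp_le_exp.2 ?_
    rw [one_div, Real.log_inv] at h1
    linarith
  have h3 : H ^ ((d : ℝ) / 2 + 2) * H ^ (-(d : ℝ) / 2 - 1) = H := by
    rw [← Real.rpow_add hH]
    convert Real.rpow_one H using 2
    ring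
  have hs := one_le_sqrt_two_pow d
  unfold sharpLocConst
  set h := H ^ (-(d : ℝ) / 2 - 1)
  calc _ ≤ _ := mul_le_mul_of_nonneg_left h2 (by positivity)
    _ = 1 / 24 * (lmin / Real.sqrt lmin) * (H ^ ((d : ℝ) / 2 + 2) * h) /
        Real.sqrt (unitBallVol d) := by
        rw [hMdef]
        field_simp
        norm_num
    _ = _ := by rw [h3, Real.div_sqrt]

end Constants

end

/-! ### The localization error and the approximation of weak solutions. -/

section

variable {d m : ℕ} {Ω : Set (Rd d)} {a : Rd d → Matrix (Fin d) (Fin d) ℝ} {lmin lmax H δ : ℝ}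
  {τ : Fin m → Set (Rd d)}

theorem IsElliptic.lmin_le_lmax (ha : IsElliptic Ω a lmin lmax) (hd : 1 ≤ d) (hΩo : IsOpen Ω)
    (hΩ : Ω.Nonempty) : lmin ≤ lmax := by
  have : (ae (volume.restrict Ω)).NeBot := by
    rw [ae_restrict_neBot]
    exact (hΩo.measure_pos volume hΩ).ne'
  obtain ⟨x, h1, h2⟩ := (ha.lower.and ha.upper).exists
  have h := (h1 (Pi.single ⟨0, hd⟩ 1)).trans (h2 _)
  simpa using h

/-- The ball is open, so its diameter is only approached, by opposite points at every distance t <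
2ρ. -/
theorem two_mul_le_of_ball_subset (hd : 1 ≤ d) {c : Rd d} {ρ D : ℝ} (hρ : 0 < ρ)
    (h : Metric.ball c ρ ⊆ Ω) (hD : ∀ x ∈ Ω, ∀ y ∈ Ω, dist x y ≤ D) : 2 * ρ ≤ D := by
  refine le_of_forall_lt_imp_le_of_dense fun t ht => ?_
  rcases le_or_gt t 0 with h0 | h0
  · exact h0.trans (dist_nonneg.trans (hD c (h (Metric.mem_ball_self hρ)) c
      (h (Metric.mem_ball_self hρ))))
  set e : Rd d := EuclideanSpace.single ⟨0, hd⟩ (t / 2)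
  have he : ‖e‖ = t / 2 := by
    rw [PiLp.norm_single]
    exact Real.norm_of_nonneg (by positivity)
  have h1 := hD (c + e) (h (by rw [Metric.mem_ball, dist_self_add_left, he]; linarith)) (c - e)
    (h (by rw [Metric.mem_ball, dist_eq_norm, sub_sub_cancel_left, norm_neg, he]; linarith))
  rw [dist_eq_norm, show c + e - (c - e) = (2 : ℝ) • e by module, norm_smul, he,
    Real.norm_of_nonneg (by norm_num)] at h1
  linarith

theorem measureReal_le_unitBallVol (hD : ∀ x ∈ Ω, ∀ y ∈ Ω, dist x y ≤ 1) :
    volume.real Ω ≤ unitBallVol d := by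
  rcases Ω.eq_empty_or_nonempty with rfl | ⟨x, hx⟩
  · simpa using (unitBallVol_pos d).le
  refine ENNReal.toReal_mono measure_ball_lt_top.ne ?_
  refine (measure_mono fun y hy => hD y hy x hx : volume Ω ≤ volume (Metric.closedBall x 1)).trans ?_
  rw [Measure.addHaar_closedBall _ _ zero_le_one]
  simp

theorem abs_integral_mul_le {μ : Measure (Rd d)} {f g : Rd d → ℝ} (hf : MemLp f 2 μ)
    (hg : MemLp g 2 μ) :
    |∫ x, f x * g x ∂μ| ≤ (eLpNorm f 2 μ).toReal * Real.sqrt (∫ x, g x ^ 2 ∂μ) := by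
  have h1 : inner ℝ (hf.toLp f) (hg.toLp g) = ∫ x, f x * g x ∂μ := by
    rw [L2.inner_def]
    refine integral_congr_ae ?_
    filter_upwards [hf.coeFn_toLp, hg.coeFn_toLp] with x hx hy
    rw [hx, hy]
    simp [mul_comm]
  have h2 : ‖hg.toLp g‖ = Real.sqrt (∫ x, g x ^ 2 ∂μ) := by
    rw [← Real.sqrt_sq (norm_nonneg (hg.toLp g)), norm_sq_Lp_eq]
    congr 1
    refine integral_congr_ae ?_
    filter_upwards [hg.coeFn_toLp] with x hx
    rw [hx, Real.norm_eq_abs, sq_abs]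
  rw [← h1, ← h2, ← Lp.norm_toLp f hf]
  exact abs_real_inner_le_norm _ _

section Estimate

variable (hd : 1 ≤ d) (hΩo : IsOpen Ω) (hΩb : Bornology.IsBounded Ω)
  (hD : ∀ x ∈ Ω, ∀ y ∈ Ω, dist x y ≤ 1) (ha : IsElliptic Ω a lmin lmax) (hlm : lmin ≤ lmax)
  (hτ : IsConvexPartition Ω H δ τ) (hH : 0 < H) (hδ : 0 < δ) (hδ1 : δ < 1)

section Localization

variable {i : Fin m} {x₀ : Rd d} (hx₀ : x₀ ∈ τ i) {ψ ψloc : L2Pair d}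
  (hψ : IsGamblet a τ Ω i ψ) {r : ℝ} (hr : 0 < r) (hψloc : IsGamblet a τ (patch τ x₀ r) i ψloc)

include hd hΩo hΩb ha hlm hτ hH hδ in
theorem exists_admissible_energyNorm_le (i : Fin m) : ∃ b : L2Pair d, ∀ S, τ i ⊆ S → S ⊆ Ω →
    b ∈ admissible τ S i ∧ energyNorm a S b ≤ bumpBound d lmax δ H := by
  have hl : 0 < lmax := ha.pos.trans_le hlm
  obtain ⟨b, hb⟩ := exists_cell_bumps hd hΩb ha hl.le hτ hH hδ
  refine ⟨b i, fun S hS hSΩ => ⟨bump_mem_admissible hτ hS (hb i).1 (hb i).2.1, ?_⟩⟩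
  have h1 := energyInner_eq_of_mem_H10 (a := a) hΩo.measurableSet.nullMeasurableSet
    isOpen_interior.measurableSet (interior_subset.trans hS) hSΩ (b i) (hb i).1
  have h2 := energyInner_eq_of_mem_H10 (a := a) hΩo.measurableSet.nullMeasurableSet
    isOpen_interior.measurableSet interior_subset (hτ.subset i) (b i) (hb i).1
  rw [energyNorm, ← h1, h2]
  exact (Real.sqrt_le_sqrt (hb i).2.2).trans
    (sqrt_bump_energy_le hd ha.pos hlm hδ hH (hτ.le_volume hΩb hH hδ i))

include hd hΩo hΩb ha hlm hτ hH hδ hψ in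
theorem energyNorm_gamblet_le : energyNorm a Ω ψ ≤ bumpBound d lmax δ H := by
  obtain ⟨b, hb⟩ := exists_admissible_energyNorm_le hd hΩo hΩb ha hlm hτ hH hδ i
  obtain ⟨h1, h2⟩ := hb Ω (hτ.subset i) le_rfl
  exact (hψ.2 b h1).trans h2

include hd hΩo hΩb ha hlm hτ hH hδ hψ hx₀ hr hψloc in
theorem energyNorm_sub_le_bumpBound : energyNorm a Ω (ψ - ψloc) ≤ bumpBound d lmax δ H := by
  have hl : 0 < lmax := ha.pos.trans_le hlm
  obtain ⟨b, hb⟩ := exists_admissible_energyNorm_le hd hΩo hΩb ha hlm hτ hH hδ i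
  obtain ⟨h1, h2⟩ := hb (patch τ x₀ r) (subset_patch ⟨x₀, hx₀, Metric.mem_ball_self hr⟩)
    (patch_subset hτ x₀ r)
  exact (energyNorm_sub_le_of_admissible' hΩo hΩb ha hl hτ hx₀ hψ hr hψloc h1).trans h2

include hd hΩo hΩb ha hlm hτ hH hδ hδ1 hψ hx₀ hr hψloc in
theorem energyNorm_sub_le_of_two_mul_le {C : ℝ} (hr6 : r ≤ 6 * H)
    (hC : 2 * bumpBound d lmax δ H ≤ C) : energyNorm a Ω (ψ - ψloc) ≤
      C * Real.exp (-(r / (2 * decayLength d lmin lmax δ * H))) := by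
  have h1 := energyNorm_sub_le_bumpBound hd hΩo hΩb ha hlm hτ hH hδ hx₀ hψ hr hψloc
  have h2 := exp_le_two hd ha.pos hlm hδ hδ1 hH hr6
  have h3 := energyNorm_nonneg (a := a) (S := Ω) (ψ - ψloc)
  rw [Real.exp_neg, ← div_eq_mul_inv, le_div_iff₀ (Real.exp_pos _)]
  refine (mul_le_mul h1 h2 (Real.exp_pos _).le (h3.trans h1)).trans ?_
  linarith

include hd hΩo hΩb ha hlm hτ hH hδ hδ1 hψ hx₀ hr hψloc in
/-- Exponential decay of the localization error, without a factor `1 / H`. -/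
theorem energyNorm_sub_le_sharpLocConst : energyNorm a Ω (ψ - ψloc) ≤
    sharpLocConst d lmin lmax δ H *
      Real.exp (-(r / (2 * decayLength d lmin lmax δ * H))) := by
  have hl : 0 < lmax := ha.pos.trans_le hlm
  rcases le_total r (6 * H) with h6 | h6
  · exact energyNorm_sub_le_of_two_mul_le hd hΩo hΩb ha hlm hτ hH hδ hδ1 hx₀ hψ hr hψloc h6
      (bumpBound_le_sharpLocConst ha.pos hlm hδ hδ1 hH d)
  have hp := ha.pos
  have hK := bumpConst_pos (d := d) hδ
  have hl0 := decayLength_ge hd hp hlm hδ hδ1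
  obtain ⟨J, hJ, hle⟩ := energyNorm_sub_le_far hΩo hΩb ha hl hτ hH hδ hx₀ hψ hr hψloc hd h6
  have h1 := gamblet_decay hd hΩo hΩb ha hl hτ hH hδ hx₀ hψ (by linarith)
    (exp_mul_div_decayLength_le hd hp hlm hδ hδ1) J hJ
  have h2 := sqrt_mul_exp_le (r := r) hd hp hlm hδ hδ1 hH
    (energyNorm_gamblet_le hd hΩo hΩb ha hlm hτ hH hδ hψ)
  have h3 := far_const_le hd hp hlm hδ hδ1 hH
  calc _ ≤ _ := hle
    _ ≤ (1 + 5 / 6 * Real.sqrt (lmax / lmin) * (1 + bumpConst d δ)) *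
        (27 / 10 * bumpBound d lmax δ H *
          Real.exp (-(r / (2 * decayLength d lmin lmax δ * H)))) := by
      gcongr
      exact (Real.sqrt_le_sqrt h1).trans h2
    _ ≤ _ := by
      rw [← mul_assoc]
      gcongr

include hd hΩo hΩb hD ha hlm hτ hH hδ hδ1 hψ hx₀ hr hψloc in
theorem energyNorm_sub_le_locConst : energyNorm a Ω (ψ - ψloc) ≤
    locConst d lmin lmax δ H * Real.exp (-(r / (2 * decayLength d lmin lmax δ * H))) := by
  have hl : 0 < lmax := ha.pos.trans_le hlm
  -- For H ≤ 1 the factor 1/H in C only helps. For H ≥ 1 the unit diameter of Ω intervenes: if r > 1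
  -- the patch is Ω and the error is zero, otherwise r ≤ 6H and the crude bound suffices.
  rcases le_total H 1 with hH1 | hH1
  · refine (energyNorm_sub_le_sharpLocConst hd hΩo hΩb ha hlm hτ hH hδ hδ1 hx₀ hψ hr
      hψloc).trans ?_
    gcongr
    exact sharpLocConst_le ha.pos hlm hδ hH hH1
  rcases lt_or_ge 1 r with h1 | h1
  · rw [energyNorm_sub_eq_zero hΩo hΩb ha hl hτ hx₀ hψ hr hψloc
      fun y hy => (hD y hy x₀ (hτ.subset i hx₀)).trans_lt h1]
    have hV := unitBallVol_pos d
    unfold locConst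
    positivity
  · obtain ⟨c, hc⟩ := hτ.ball_subset i
    have h2 := two_mul_le_of_ball_subset hd (by positivity) (hc.trans (hτ.subset i)) hD
    exact energyNorm_sub_le_of_two_mul_le hd hΩo hΩb ha hlm hτ hH hδ hδ1 hx₀ hψ hr hψloc
      (by linarith) (bumpBound_le_locConst ha.pos hlm hδ hδ1 hH d (by linarith))

end Localization

section Approximation

variable {g : Rd d → ℝ} {u : L2Pair d} (hg : MemLp g 2 (volume.restrict Ω))
  (hu : IsWeakSolution Ω a g u)

include hΩo hΩb ha hlm hτ hH hδ hg hu in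
/-- The error of the approximation of `u` in the span of the gamblets. -/
theorem energyNorm_sub_sum_gamblet_le {ψ : Fin m → L2Pair d}
    (hψ : ∀ i, IsGamblet a τ Ω i (ψ i)) :
    energyNorm a Ω (u - ∑ i, (∫ y in τ i, u.fst y) • ψ i) ≤
      5 / 6 * H / Real.sqrt lmin * (eLpNorm g 2 (volume.restrict Ω)).toReal := by
  have hp := ha.pos
  have hl : 0 ≤ lmax := hp.le.trans hlm
  set c : Fin m → ℝ := fun i => ∫ y in τ i, u.fst y
  set v := u - ∑ i, c i • ψ i with hvdef
  have hadm := fun i => (mem_admissible_iff hτ).1 (hψ i).1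
  rw [hΩo.interior_eq] at hadm
  have hv : v ∈ H10 Ω := Submodule.sub_mem _ hu.1
    (Submodule.sum_mem _ fun i _ => Submodule.smul_mem _ _ (hadm i).1)
  have hv0 : ∀ j, ∫ y in τ j, v.fst y = 0 := fun j => by
    have h1 : integralForm (τ j) (hτ.volume_ne_top hΩb j) v =
        c j - ∑ i, c i * (if i = j then 1 else 0) := by
      rw [hvdef, map_sub, map_sum]
      congr 1
      refine Finset.sum_congr rfl fun i _ => ?_
      rw [map_smul, integralForm_apply, (hadm i).2 j (hτ.subset j), smul_eq_mul]
    rw [← integralForm_apply (hτ.volume_ne_top hΩb j), h1]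
    simp
  -- The error v has vanishing measurements, hence is orthogonal to every gamblet; its energy is its
  -- energy product with u, which the weak formulation expresses through g.
  have hE : energyInner a Ω v v = ∫ x in Ω, g x * v.fst x := by
    have hlin : ∀ w, energyForm ha hl le_rfl (u - ∑ i, c i • ψ i) w =
        energyForm ha hl le_rfl u w - ∑ i, energyForm ha hl le_rfl (c i • ψ i) w := fun w => by
      rw [LinearMap.map_sub₂, LinearMap.map_sum₂]
    have hlin := hlin v
    rw [← hvdef, Finset.sum_eq_zero, sub_zero] at hlin
    · rw [← hu.2 v hv]
      exact hlin
    intro i _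
    rw [LinearMap.map_smul₂, energyForm_apply,
      energyInner_gamblet_eq_zero hΩo hΩb ha hl hτ (hψ i) hv hv0, smul_zero]
  have hL : ∫ x in Ω, v.fst x ^ 2 ≤ 25 / 36 * H ^ 2 / lmin * energyInner a Ω v v := by
    have h1 : IntegrableOn (fun x => v.fst x ^ 2) Ω := by
      simpa using (integrable_norm_sq_Lp v.fst).integrableOn
    rw [energyInner, hτ.setIntegral_eq_sum h1,
      hτ.setIntegral_eq_sum (integrableOn_energy ha hl v v), Finset.mul_sum]
    exact Finset.sum_le_sum fun j _ => cell_poincare hΩb ha hl hτ hH hδ hv (hv0 j)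
  have hL' : Real.sqrt (∫ x in Ω, v.fst x ^ 2) ≤
      5 / 6 * H / Real.sqrt lmin * energyNorm a Ω v := by
    refine Real.sqrt_le_iff.2 ⟨mul_nonneg (by positivity) (energyNorm_nonneg _), hL.trans_eq ?_⟩
    rw [mul_pow, energyNorm_sq ha le_rfl, div_pow, Real.sq_sqrt hp.le]
    ring
  have h1 := abs_integral_mul_le hg ((Lp.memLp v.fst).restrict Ω)
  rw [← hE, ← energyNorm_sq ha le_rfl, abs_of_nonneg (sq_nonneg _)] at h1
  have h2 := h1.trans (mul_le_mul_of_nonneg_left hL' ENNReal.toReal_nonneg)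
  rcases (energyNorm_nonneg (a := a) (S := Ω) v).eq_or_lt with h0 | h0
  · rw [← h0]
    exact mul_nonneg (by positivity) ENNReal.toReal_nonneg
  · refine le_of_mul_le_mul_right ?_ h0
    rw [← sq]
    linarith

include hd hΩo hD ha hlm hg hu in
theorem IsWeakSolution.norm_fst_le :
    ‖u.fst‖ ≤ 4 / lmin * (eLpNorm g 2 (volume.restrict Ω)).toReal := by
  have hp := ha.pos
  have hF := friedrichs_H10 hd hD hu.1
  have h1 := abs_integral_mul_le hg ((Lp.memLp u.fst).restrict Ω)
  have h2 := lmin_mul_le_energyInner ha (hp.le.trans hlm) le_rfl u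
  rw [setIntegral_eq_integral_of_ae_compl_eq_zero (f := fun x => ‖u.snd x‖ ^ 2) (by
    filter_upwards [snd_ae_eq_zero_of_mem_H10 hΩo.measurableSet hu.1] with x hx hxΩ
    simp [hx hxΩ]), ← norm_sq_Lp_eq, hu.2 u hu.1] at h2
  have h3 : Real.sqrt (∫ x in Ω, u.fst x ^ 2) = ‖u.fst‖ := by
    rw [setIntegral_eq_integral_of_ae_compl_eq_zero (f := fun x => u.fst x ^ 2) (by
      filter_upwards [fst_ae_eq_zero_of_mem_H10 hΩo.measurableSet hu.1] with x hx hxΩ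
      simp [hx hxΩ]), ← Real.sqrt_sq (norm_nonneg u.fst), norm_sq_Lp_eq]
    simp
  rw [h3] at h1
  set G := (eLpNorm g 2 (volume.restrict Ω)).toReal
  have hG : 0 ≤ G := ENNReal.toReal_nonneg
  have h4 : lmin * ‖u.snd‖ ^ 2 ≤ G * (2 * ‖u.snd‖) :=
    (h2.trans ((le_abs_self _).trans h1)).trans (mul_le_mul_of_nonneg_left hF hG)
  have h5 : ‖u.snd‖ ≤ 2 / lmin * G := by
    rcases (norm_nonneg u.snd).eq_or_lt with h0 | h0
    · rw [← h0]
      positivity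
    · rw [div_mul_eq_mul_div, le_div_iff₀ hp]
      refine le_of_mul_le_mul_right ?_ h0
      linarith
  refine hF.trans ?_
  calc 2 * ‖u.snd‖ ≤ 2 * (2 / lmin * G) := by gcongr
    _ = _ := by ring

-- The sum is at most the L¹ norm on Ω, so the number of cells does not enter. The volume of Ω is at
-- most that of a unit ball, as Ω lies in the closed unit ball about any of its points.
include hD hΩb hτ in
theorem sum_abs_setIntegral_le (v : L2Pair d) :
    ∑ i, |∫ y in τ i, v.fst y| ≤ Real.sqrt (unitBallVol d) * ‖v.fst‖ := by
  have hfin : IsFiniteMeasure (volume.restrict Ω) := ⟨by simpa using hΩb.measure_lt_top⟩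
  have hm : MemLp (fun x => |v.fst x|) 2 (volume.restrict Ω) :=
    ((Lp.memLp v.fst).restrict Ω).norm
  have h1 : ∑ i, |∫ y in τ i, v.fst y| ≤ ∫ y in Ω, |v.fst y| := by
    rw [hτ.setIntegral_eq_sum (hm.integrable (by norm_num))]
    exact Finset.sum_le_sum fun i _ => abs_integral_le_integral_abs
  have h2 := sq_integral_le hm
  have h3 : ∫ x in Ω, |v.fst x| ^ 2 ≤ ‖v.fst‖ ^ 2 := by
    rw [norm_sq_Lp_eq]
    exact setIntegral_le_integral (f := fun x => ‖v.fst x‖ ^ 2) (integrable_norm_sq_Lp v.fst)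
      (Filter.Eventually.of_forall fun x => sq_nonneg ‖v.fst x‖)
  refine h1.trans (le_of_sq_le_sq ?_ (by positivity))
  have h4 := measureReal_le_unitBallVol hD
  rw [mul_pow, Real.sq_sqrt (unitBallVol_pos d).le]
  rw [measureReal_restrict_apply_univ] at h2
  refine h2.trans ?_
  exact mul_le_mul h4 h3 (integral_nonneg fun x => sq_nonneg |v.fst x|) (unitBallVol_pos d).le

-- The exact gamblets give 5/6. The localization errors give √V_d · (4/lmin) · (1/24) √lmin / √V_d,
-- which is 1/6 of the scale 1/√lmin.
include hd hΩo hΩb hD ha hlm hτ hH hδ hδ1 hg hu in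
theorem energyNorm_sub_sum_localized_le {x : Fin m → Rd d} (hx : ∀ i, x i ∈ τ i)
    {ψ ψloc : Fin m → L2Pair d} (hψ : ∀ i, IsGamblet a τ Ω i (ψ i)) {r : ℝ} (hr : 0 < r)
    (hψloc : ∀ i, IsGamblet a τ (patch τ (x i) r) i (ψloc i))
    (hrC : H * (radiusConst₁ d lmin lmax δ * Real.log (1 / H) + radiusConst₂ d lmin lmax δ) ≤ r) :
    energyNorm a Ω (u - ∑ i, (∫ y in τ i, u.fst y) • ψloc i) ≤
      1 / Real.sqrt lmin * H * (eLpNorm g 2 (volume.restrict Ω)).toReal := by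
  have hp := ha.pos
  have hl : 0 ≤ lmax := hp.le.trans hlm
  have hV := unitBallVol_pos d
  have h1 := energyNorm_sub_sum_gamblet_le hΩo hΩb ha hlm hτ hH hδ hg hu hψ
  have h2 := hu.norm_fst_le hd hΩo hD ha hlm hg
  have h3 := sum_abs_setIntegral_le hΩb hD hτ u
  set G := (eLpNorm g 2 (volume.restrict Ω)).toReal
  set c : Fin m → ℝ := fun i => ∫ y in τ i, u.fst y
  have h4 : energyNorm a Ω (∑ i, c i • (ψ i - ψloc i)) ≤
      ∑ i, |c i| * (1 / 24 * Real.sqrt lmin * H / Real.sqrt (unitBallVol d)) := by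
    refine (energyNorm_sum_le _ ha hl le_rfl _).trans (Finset.sum_le_sum fun i _ => ?_)
    rw [energyNorm_smul _ ha hl le_rfl]
    gcongr
    exact (energyNorm_sub_le_sharpLocConst hd hΩo hΩb ha hlm hτ hH hδ hδ1 (hx i) (hψ i) hr
      (hψloc i)).trans (sharpLocConst_mul_exp_le hd hp hlm hδ hδ1 hH hrC)
  have h5 : u - ∑ i, c i • ψloc i = (u - ∑ i, c i • ψ i) + ∑ i, c i • (ψ i - ψloc i) := by
    simp only [smul_sub, Finset.sum_sub_distrib]
    abel
  rw [h5]
  calc _ ≤ _ := energyNorm_add_le ha hl le_rfl _ _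
    _ ≤ 5 / 6 * H / Real.sqrt lmin * G + Real.sqrt (unitBallVol d) * (4 / lmin * G) *
        (1 / 24 * Real.sqrt lmin * H / Real.sqrt (unitBallVol d)) := by
      refine add_le_add h1 (h4.trans ?_)
      rw [← Finset.sum_mul]
      gcongr
      exact h3.trans (by gcongr)
    _ = 5 / 6 * H / Real.sqrt lmin * G + 1 / 6 * H * G * (Real.sqrt lmin / lmin) := by
      field_simp
      ring
    _ = _ := by
      rw [Real.sqrt_div_self]
      ring

end Approximation

end Estimate

end

end Gamblet

end

theorem mainTheorem6 {d m : ℕ} (hd : 1 ≤ d)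
    (Ω : Set (Gamblet.Rd d)) (hΩo : IsOpen Ω) (hΩb : Bornology.IsBounded Ω)
    (hΩd : Metric.diam Ω ≤ 1)
    (a : Gamblet.Rd d → Matrix (Fin d) (Fin d) ℝ) (lmin lmax : ℝ)
    (ha : Gamblet.IsElliptic Ω a lmin lmax)
    (H δ : ℝ) (hH : 0 < H) (hδ0 : 0 < δ) (hδ1 : δ < 1)
    (τ : Fin m → Set (Gamblet.Rd d)) (hτ : Gamblet.IsConvexPartition Ω H δ τ)
    (x : Fin m → Gamblet.Rd d) (hx : ∀ i, x i ∈ τ i)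
    (ψ : Fin m → Gamblet.L2Pair d) (hψ : ∀ i, Gamblet.IsGamblet a τ Ω i (ψ i))
    (r : ℝ) (hr : 0 < r) (ψloc : Fin m → Gamblet.L2Pair d)
    (hψloc : ∀ i, Gamblet.IsGamblet a τ (Gamblet.patch τ (x i) r) i (ψloc i)) :
    (∀ i, Gamblet.energyNorm a Ω (ψ i - ψloc i) ≤
      Gamblet.locConst d lmin lmax δ H *
        Real.exp (-(r / (2 * Gamblet.decayLength d lmin lmax δ * H)))) ∧
    (H * (Gamblet.radiusConst₁ d lmin lmax δ * Real.log (1 / H) +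
        Gamblet.radiusConst₂ d lmin lmax δ) ≤ r →
      ∀ (g : Gamblet.Rd d → ℝ) (u : Gamblet.L2Pair d),
        MemLp g 2 (volume.restrict Ω) → Gamblet.IsWeakSolution Ω a g u →
        (⨅ v : Submodule.span ℝ (Set.range ψloc),
            Gamblet.energyNorm a Ω (u - (v : Gamblet.L2Pair d))) ≤
          1 / Real.sqrt lmin * H * (eLpNorm g 2 (volume.restrict Ω)).toReal ∧
        Gamblet.energyNorm a Ω
            (u - ∑ i, (∫ y in Ω, u.fst y * Gamblet.measFun τ i y) • ψloc i) ≤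
          1 / Real.sqrt lmin * H * (eLpNorm g 2 (volume.restrict Ω)).toReal) := by
  have hD : ∀ y ∈ Ω, ∀ z ∈ Ω, dist y z ≤ 1 := fun y hy z hz =>
    (Metric.dist_le_diam_of_mem hΩb hy hz).trans hΩd
  refine ⟨fun i => ?_, fun hrC g u hg hu => ?_⟩
  · have hlm := ha.lmin_le_lmax hd hΩo ⟨x i, hτ.subset i (hx i)⟩
    exact Gamblet.energyNorm_sub_le_locConst hd hΩo hΩb hD ha hlm hτ hH hδ0 hδ1 (hx i) (hψ i) hr
      (hψloc i)
  have hmain : Gamblet.energyNorm a Ω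
      (u - ∑ i, (∫ y in Ω, u.fst y * Gamblet.measFun τ i y) • ψloc i) ≤
        1 / Real.sqrt lmin * H * (eLpNorm g 2 (volume.restrict Ω)).toReal := by
    -- On the empty set the ellipticity bounds are vacuous and lmin ≤ lmax may fail, but the error
    -- is zero.
    rcases Ω.eq_empty_or_nonempty with rfl | hne
    · rw [Gamblet.energyNorm, Gamblet.energyInner, setIntegral_empty, Real.sqrt_zero]
      have := ha.pos
      positivity
    have hlm := ha.lmin_le_lmax hd hΩo hne
    have hc : ∀ i, ∫ y in Ω, u.fst y * Gamblet.measFun τ i y = ∫ y in τ i, u.fst y := fun i => by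
      simp only [mul_comm (u.fst _)]
      exact hτ.setIntegral_measFun (hτ.subset i) _
    simp only [hc]
    exact Gamblet.energyNorm_sub_sum_localized_le hd hΩo hΩb hD ha hlm hτ hH hδ0 hδ1 hg hu hx hψ hr
      hψloc hrC
  refine ⟨?_, hmain⟩
  -- A real infimum needs a lower bound for the family; zero works since energy norms are
  -- nonnegative.
  refine (ciInf_le ⟨0, ?_⟩ (⟨∑ i, (∫ y in Ω, u.fst y * Gamblet.measFun τ i y) • ψloc i,
    Submodule.sum_mem _ fun i _ => Submodule.smul_mem _ _ (Submodule.subset_span ⟨i, rfl⟩)⟩ :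
      Submodule.span ℝ (Set.range ψloc))).trans hmain
  rintro _ ⟨v, rfl⟩
  exact Gamblet.energyNorm_nonneg _
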